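/- **Notation.** Let $D\ge 2$ and $x\in\mathbb R^D$. Let $M\subset\mathbb R^D$ be a compact smooth submanifold without boundary, $\exp_y:T_yM\to M$ its exponential map at $y\in M$, and $\mathrm{inj}_M(y)$ its injectivity radius at $y$. For $\gamma>0$ put $k=\lceil\gamma-1\rceil$ and $\delta=\gamma-k\in(0,1]$. A function $g:M\to\mathbb R^m$ is $\gamma$-Hölder with $\|g\|_{\mathcal H^\gamma}\le R$ if for every $y\in M$ the map $g\circ\exp_y$ is $k$ times differentiable on the ball $B_{T_yM}(0,\mathrm{inj}_M(y))$ and satisfies there $$\|d^k(g\circ\exp_y)(v)-d^k(g\circ\exp_y)(w)\|_{\mathrm{op}}\le R\|v-w\|^\delta ;$$ for $\gamma=0$ no condition is imposed. The reach of $M$ is the supremum of the $r\ge0$ such that every point at distance at most $r$ from $M$ has a unique nearest point in $M$. For $\alpha,\beta\ge0$, $\tau,L,R>0$ and $0<f_{\min}<f_{\max}$, let $\Sigma^1_{\alpha,\beta}=\Sigma^1_{\alpha,\beta}(\tau,L,f_{\min},f_{\max},R)$ be the set of Borel probability measures $P$ on $\mathbb R^D$ such that * the support $M_P$ of $P$ is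 a compact smooth one-dimensional submanifold without boundary that contains $x$, has reach at least $\tau$, and whose inclusion $\iota:M_P\hookrightarrow\mathbb R^D$ satisfies $\|\iota\|_{\mathcal H^{\alpha+1}}\le L$; * $P$ has, with respect to the length measure on $M_P$ (the restriction of the Hausdorff measure $\mathcal H^1$), a density $f_P$ with $f_{\min}\le f_P\le f_{\max}$ on $M_P$ and $\|f_P\|_{\mathcal H^\beta}\le R$. (If $\beta=0$, the value $f_P(x)$ may depend on the version of the density; the bound below holds for all versions as above.) **Estimator.** Let $\Lambda(t)=e^{-1/(1-t^2)}$ for $|t|<1$ and $\Lambda(t)=0$ otherwise, $K^{(1)}=\Lambda/\int_{\mathbb R}\Lambda$, and $K^{(\ell+1)}(t)=2^{1+1/\ell}K^{(\ell)}(2^{1/\ell}t)-K^{(\ell)}(t)$ for $\ell\ge1$. Given $X_1,\dots,X_n\in\mathbb R^D$ and $\varepsilon>0$, join two of the points $x,X_1,\dots,X_n$ by an edge when their Euclidean distance is at most $\varepsilon$, and let $\widehat d_\varepsilon(x,X_i)\in[0,\infty]$ be the smallest Euclidean length of a path from $x$ to $X_i$ in this graph ($\infty$ if there is none). For $\beta\ge0$,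 $p\ge1$ and an integer $\ell\ge\max(\beta,1)$ set $$\hat f(x)=\frac1{nh}\sum_{i=1}^nK^{(\ell)}\big(\widehat d_\varepsilon(x,X_i)/h\big),\qquad h=n^{-1/(2\beta+1)},\qquad \varepsilon=\frac{32(p+1)}{f_{\min}}\cdot\frac{\log n}{n},$$ with $K^{(\ell)}(\infty)=0$. **Theorem.** Let $\beta\ge0$, $p\ge1$, $f_{\min}>0$ and let $\ell\ge\max(\beta,1)$ be an integer. Then $\hat f(x)$ is a measurable function of the data, and it does not depend on $\alpha,\tau,L,f_{\max},R$. For all $\alpha\ge0$, $\tau,L,R>0$ and $f_{\max}>f_{\min}$ there are $C>0$ and $N\in\mathbb N$, depending only on $\alpha,\beta,\tau,L,f_{\min},f_{\max},R,p$ and $\ell$, such that for all $D\ge2$, all $x\in\mathbb R^D$ and all $n\ge N$, $$\sup_{P\in\Sigma^1_{\alpha,\beta}}\mathbb E_{P^{\otimes n}}\big[|\hat f(x)-f_P(x)|^p\big]^{1/p}\le C\,n^{-\beta/(2\beta+1)}.$$ In particular, the rate does not depend on the regularity $\alpha$ of the manifold. -/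

import Mathlib

open MeasureTheory Set
open scoped ENNReal NNReal ContDiff

noncomputable section

namespace ManifoldDensity

/-- The ambient Euclidean space `ℝ^D`. -/
abbrev Ambient (D : ℕ) : Type := EuclideanSpace ℝ (Fin D)

/-! ### Submanifolds of Euclidean space, exponential maps, Hölder functions, reach -/

/-- `M` is a smooth `d`-dimensional embedded submanifold (without boundary) of `ℝ^D`: near each of
its points it is the image of a smooth immersion of an open subset of `ℝ^d` that is a homeomorphism
onto an open subset of `M`. -/
def IsSmoothSubmanifold {D : ℕ} (d : ℕ) (M : Set (Ambient D)) : Prop :=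
  ∀ y ∈ M, ∃ (U : Set (Ambient D)) (V : Set (EuclideanSpace ℝ (Fin d)))
    (φ : EuclideanSpace ℝ (Fin d) → Ambient D) (ψ : Ambient D → EuclideanSpace ℝ (Fin d)),
    IsOpen U ∧ y ∈ U ∧ IsOpen V ∧ ContDiffOn ℝ ∞ φ V ∧
      (∀ v ∈ V, Function.Injective (fderiv ℝ φ v)) ∧ φ '' V = M ∩ U ∧
      ContinuousOn ψ (M ∩ U) ∧ ∀ v ∈ V, ψ (φ v) = v

/-- The tangent space `T_y M`: the velocities at `y` of smooth curves in `M` through `y`. For a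
submanifold these velocities already form a linear subspace. -/
def tangentSpace {D : ℕ} (M : Set (Ambient D)) (y : Ambient D) : Submodule ℝ (Ambient D) :=
  Submodule.span ℝ {v | ∃ γ : ℝ → Ambient D, ContDiffAt ℝ ∞ γ 0 ∧ (∀ᶠ t in nhds (0 : ℝ), γ t ∈ M) ∧
    γ 0 = y ∧ deriv γ 0 = v}

/-- A geodesic of `M` defined for all times: a smooth curve in `M` whose acceleration is everywhere
normal to `M`. -/
structure IsGeodesic {D : ℕ} (M : Set (Ambient D)) (γ : ℝ → Ambient D) : Prop where
  smooth : ContDiff ℝ ∞ γ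
  mem : ∀ t, γ t ∈ M
  normal : ∀ t, ∀ v ∈ tangentSpace M (γ t), inner ℝ (deriv (deriv γ) t) v = 0

open Classical in
/-- The exponential map `exp_y : T_y M → M ⊆ ℝ^D`, `v ↦ γ 1` for the geodesic `γ` with `γ 0 = y` and
`γ' 0 = v`. On a compact submanifold this geodesic always exists and is unique; the default value
`y` is never used there. -/
def expMap {D : ℕ} (M : Set (Ambient D)) (y : Ambient D) (v : tangentSpace M y) : Ambient D :=
  if h : ∃ γ : ℝ → Ambient D, IsGeodesic M γ ∧ γ 0 = y ∧ deriv γ 0 = (v : Ambient D) then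
    h.choose 1
  else y

/-- The injectivity radius of `M` at `y`: the supremum of the radii `r` such that `exp_y` is a smooth
injective immersion on the open ball of radius `r` of `T_y M` (the dimensions being equal, this is
the same as a diffeomorphism onto an open subset of `M`). -/
def injRadius {D : ℕ} (M : Set (Ambient D)) (y : Ambient D) : ℝ≥0∞ :=
  ⨆ (r : ℝ≥0) (_ : ContDiffOn ℝ ∞ (expMap M y) (Metric.ball 0 r) ∧
    InjOn (expMap M y) (Metric.ball 0 r) ∧
    ∀ v ∈ Metric.ball (0 : tangentSpace M y) r, Function.Injective (fderiv ℝ (expMap M y) v)),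
    (r : ℝ≥0∞)

/-- The open ball of `T_y M` centred at `0` whose radius is the injectivity radius at `y`. -/
def injBall {D : ℕ} (M : Set (Ambient D)) (y : Ambient D) : Set (tangentSpace M y) :=
  {v | (‖v‖₊ : ℝ≥0∞) < injRadius M y}

/-- `g`, seen as a function on `M`, belongs to the Hölder space of exponent `s` with Hölder
coefficient at most `R`: for all `y ∈ M`, with `k = ⌈s - 1⌉` and `δ = s - k ∈ (0, 1]`, the function
`g ∘ exp_y` is `k` times differentiable on the injectivity ball, with a `k`-th differential that is
`δ`-Hölder with constant `R` for the operator norm (so that this differential is continuous).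
For `s = 0` no regularity is imposed. -/
def HolderBound {D : ℕ} {F : Type*} [NormedAddCommGroup F] [NormedSpace ℝ F]
    (M : Set (Ambient D)) (s R : ℝ) (g : Ambient D → F) : Prop :=
  0 < s → ∀ y ∈ M,
    ContDiffOn ℝ (⌈s - 1⌉₊ : ℕ) (fun v => g (expMap M y v)) (injBall M y) ∧
    ∀ v ∈ injBall M y, ∀ w ∈ injBall M y,
      ‖iteratedFDeriv ℝ ⌈s - 1⌉₊ (fun u => g (expMap M y u)) v -
          iteratedFDeriv ℝ ⌈s - 1⌉₊ (fun u => g (expMap M y u)) w‖ ≤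
        R * ‖v - w‖ ^ (s - (⌈s - 1⌉₊ : ℝ))

/-- The reach of `K`: the supremum of the `r ≥ 0` such that every point at distance at most `r` from
`K` has a unique nearest point in `K`. -/
def reach {D : ℕ} (K : Set (Ambient D)) : ℝ≥0∞ :=
  ⨆ (r : ℝ≥0) (_ : ∀ z : Ambient D, Metric.infDist z K ≤ r →
    ∃! y, y ∈ K ∧ Metric.infDist z K = dist z y), (r : ℝ≥0∞)

/-! ### The statistical model -/

/-- The class `𝒞_{d,α}(τ, L)` of compact submanifolds through `x`. -/
structure IsModelManifold {D : ℕ} (d : ℕ) (α τ L : ℝ) (x : Ambient D) (M : Set (Ambient D)) :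
    Prop where
  mem : x ∈ M
  submanifold : IsSmoothSubmanifold d M
  compact : IsCompact M
  reach_ge : ENNReal.ofReal τ ≤ reach M
  inclusion : HolderBound M (α + 1) L (fun y => y)

/-- `P` belongs to the model `Σ¹_{α,β}(τ, L, fmin, fmax, R)` of probability measures supported on a
curve through `x`, and `f` is a version `f_P` of its density as required by the model. The volume
measure of a one-dimensional submanifold `M` is the one-dimensional Hausdorff measure (length)
restricted to `M`. Only the values of `f` on `M` matter. -/
structure InModel {D : ℕ} (x : Ambient D) (α β τ L fmin fmax R : ℝ) (P : Measure (Ambient D))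
    (f : Ambient D → ℝ) : Prop where
  prob : IsProbabilityMeasure P
  support : IsModelManifold 1 α τ L x P.support
  measurable : Measurable f
  density : P = ((Measure.hausdorffMeasure 1).restrict P.support).withDensity
    (fun y => ENNReal.ofReal (f y))
  lower : ∀ y ∈ P.support, fmin ≤ f y
  upper : ∀ y ∈ P.support, f y ≤ fmax
  holder : HolderBound P.support β R f

/-! ### The estimator -/

/-- The vertices of the neighbourhood graph: the point `x` and the data. -/
def vertex {D n : ℕ} (x : Ambient D) (X : Fin n → Ambient D) : Option (Fin n) → Ambient D
  | none => x
  | some i => X i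

/-- The Isomap distance from `x` to `X i`: the smallest length of a path from `x` to `X i` in the
graph on `x, X₁, …, Xₙ` in which two vertices are adjacent when they are at distance at most `ε`;
it is `∞` if there is no such path. -/
def isomapDist {D n : ℕ} (ε : ℝ) (x : Ambient D) (X : Fin n → Ambient D) (i : Fin n) : ℝ≥0∞ :=
  ⨅ (m : ℕ) (s : Fin (m + 1) → Option (Fin n)) (_ : s 0 = none ∧ s (Fin.last m) = some i ∧
    ∀ j : Fin m, dist (vertex x X (s j.castSucc)) (vertex x X (s j.succ)) ≤ ε),
    ∑ j : Fin m, edist (vertex x X (s j.castSucc)) (vertex x X (s j.succ))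

/-- The bump function `Λ(t) = exp(-1 / (1 - t²))` for `|t| < 1`, and `0` otherwise. -/
def bump (t : ℝ) : ℝ := if |t| < 1 then Real.exp (-1 / (1 - t ^ 2)) else 0

/-- The kernels `K^{(ℓ)}`, `ℓ ≥ 1`, on the real line: `K^{(1)} = Λ / ∫ Λ` and
`K^{(ℓ+1)}(t) = 2^{1 + 1/ℓ} K^{(ℓ)}(2^{1/ℓ} t) - K^{(ℓ)}(t)`. The value at `ℓ = 0` is not used. -/
def kernel : ℕ → ℝ → ℝ
  | 0, _ => 0
  | 1, t => (∫ u : ℝ, bump u)⁻¹ * bump t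
  | (l + 2), t => 2 ^ (1 + 1 / ((l + 1 : ℕ) : ℝ)) *
      kernel (l + 1) (2 ^ (1 / ((l + 1 : ℕ) : ℝ)) * t) - kernel (l + 1) t

/-- The kernel estimator in the Isomap distance,
`(1 / (n h)) ∑ᵢ K^{(ℓ)}(d_ε(x, Xᵢ) / h)`, with `K^{(ℓ)}(∞) = 0`. -/
def isomapKernelEstimator {D n : ℕ} (ℓ : ℕ) (h ε : ℝ) (x : Ambient D) (X : Fin n → Ambient D) : ℝ :=
  1 / (n * h) * ∑ i : Fin n,
    if isomapDist ε x X i = ⊤ then 0 else kernel ℓ ((isomapDist ε x X i).toReal / h)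

/-- The one-dimensional estimator: the kernel estimator in the Isomap distance with bandwidth
`h = n^{-1/(2β+1)}` and scale `ε = (32 (p + 1) / fmin) * (log n / n)`. -/
def onedimEstimator {D n : ℕ} (ℓ : ℕ) (β p fmin : ℝ) (x : Ambient D) (X : Fin n → Ambient D) : ℝ :=
  isomapKernelEstimator ℓ ((n : ℝ) ^ (-1 / (2 * β + 1)))
    (32 * (p + 1) / fmin * (Real.log n / n)) x X

/-- The risk `E_{P^{⊗n}}[|T(X₁, …, Xₙ) - θ|^p]^{1/p}` of an estimator `T` of a real number `θ`. -/
def risk {D n : ℕ} (p : ℝ) (P : Measure (Ambient D)) (T : (Fin n → Ambient D) → ℝ) (θ : ℝ) :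
    ℝ≥0∞ :=
  (∫⁻ X, ENNReal.ofReal (|T X - θ| ^ p) ∂(Measure.pi fun _ : Fin n => P)) ^ (1 / p)

end ManifoldDensity

end

open MeasureTheory Set
open scoped ENNReal NNReal ContDiff

noncomputable section

namespace ManifoldDensity

open Filter Topology

/-! A curve has no intrinsic geometry: its exponential map is arc length. Let `c` be the unit-speed
curve in `M` with `c 0 = x`. Length measure near `x` is the image of Lebesgue measure under `c`
(`IsReachCurve.restrict_hausdorffMeasure`), and the Hölder condition on the density says that `t ↦ f
(c t)` is Hölder on the fixed interval `(-τ, τ)` (`IsReachCurve.holder_comp`). If arc length were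
observed, the problem would be kernel estimation on a line. The smoothness of the embedding plays no
role in this; only the reach matters.

The reach enters through Federer's inequality (`inner_le_of_reach`). It bounds the curvature by `1 /
τ`, so that chord and arc differ only at third order (`IsUnitCurve.le_chord`), and it forces `M`
near a point of an arc to consist of that arc alone (`IsUnitCurve.exists_eq_of_norm_lt`). These
facts replace ODE theory on the submanifold: unit-speed curves are unique, extend to all times, and
compute `expMap`.

Arc length is not observed, but the graph distance is an excellent substitute. A chain of hops of
length at most `ε` lifts to the curve with relative lengthening at most `ε² / τ²`. Conversely, if
every cell of length `ε / 4` near `x` contains an observation, some chain is no longer than the arc.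
So each kernel weight is within `O(ε²)` of its arc-length version
(`IsReachCurve.abs_weight_sub_arcKernel_le`). With `ε` of order `log n / n`, the resulting error `ε²
/ h` is below the target rate.

What remains is a standard decomposition (`InModel.abs_error_le`). The bias is of order `h ^ β` by
Taylor expansion and vanishing moments of the kernel (`abs_bias_le`). The fluctuation is of order
`(n h)^(-1/2)` in every `L^p`, by exponential moments (`lintegral_abs_sum_rpow_le`). The event of an
empty cell has polynomially small probability, and the factor `p + 1` in `ε` makes that power beat
the crude bound `O(1 / h)` on the error there (`bad_event_le`). The bandwidth balances bias and
fluctuation at `n^(-β / (2 β + 1))`. -/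

/-! ### Unit-speed parametrization of a one-dimensional submanifold near a point -/

/-- A solution of an autonomous scalar equation with smooth right-hand side is smooth. -/
lemma contDiffOn_of_hasDerivAt_comp {u v : ℝ → ℝ} {I s : Set ℝ} (hI : IsOpen I)
    (hv : ContDiffOn ℝ ∞ v s) (hu : ∀ t ∈ I, u t ∈ s) (hd : ∀ t ∈ I, HasDerivAt u (v (u t)) t) :
    ContDiffOn ℝ ∞ u I := by
  have key : ∀ n : ℕ, ContDiffOn ℝ n u I := by
    intro n
    induction n with
    | zero =>
      simpa [ContinuousOn] using fun t ht => (hd t ht).continuousAt.continuousWithinAt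
    | succ n ih =>
      have : ((n + 1 : ℕ) : WithTop ℕ∞) = (n : WithTop ℕ∞) + 1 := by norm_cast
      rw [this, contDiffOn_succ_iff_deriv_of_isOpen hI]
      refine ⟨fun t ht => (hd t ht).differentiableAt.differentiableWithinAt, by simp, ?_⟩
      refine ContDiffOn.congr (f := fun t => v (u t)) ?_ fun t ht => (hd t ht).deriv
      exact (hv.of_le (mod_cast le_top)).comp ih hu
  exact contDiffOn_infty.2 key

/-- `c` is a smooth unit-speed curve in `M` on the interval `(a, b)`. -/
structure IsUnitCurve {D : ℕ} (M : Set (Ambient D)) (c : ℝ → Ambient D) (a b : ℝ) : Prop where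
  smooth : ContDiffOn ℝ ∞ c (Ioo a b)
  mem : ∀ t ∈ Ioo a b, c t ∈ M
  speed : ∀ t ∈ Ioo a b, ‖deriv c t‖ = 1

/-- An immersed line near a point: quadratic tangency and a linear lower bound. -/
lemma exists_quadratic_bounds {E : Type*} [NormedAddCommGroup E] [NormedSpace ℝ E]
    {g : ℝ → E} (hg : ContDiffAt ℝ ∞ g 0) (h0 : deriv g 0 ≠ 0) :
    ∃ K > 0, ∃ r > 0, ∀ u : ℝ, |u| < r → ‖g u - g 0 - u • deriv g 0‖ ≤ K * u ^ 2 ∧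
      |u| * (‖deriv g 0‖ / 2) ≤ ‖g u - g 0‖ := by
  have hg1 : ContDiffAt ℝ 1 (deriv g) 0 := by
    have h : ContDiffAt ℝ (1 + 1) g 0 := hg.of_le (by norm_cast)
    exact h.derivWithin le_rfl
  obtain ⟨K, s, hs, hK⟩ := hg1.exists_lipschitzOnWith
  have hd : ∀ᶠ t in 𝓝 (0 : ℝ), DifferentiableAt ℝ g t := by
    have : ContDiffAt ℝ 1 g 0 := hg.of_le (mod_cast le_top)
    filter_upwards [this.eventually (by simp)] with t ht
    exact ht.differentiableAt (by simp)
  obtain ⟨r, hr, hrs⟩ := Metric.mem_nhds_iff.1 (inter_mem hs hd)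
  have hs0 : 0 < ‖deriv g 0‖ := norm_pos_iff.2 h0
  -- On this radius the quadratic remainder is at most half of the linear term. `K` may vanish, so
  -- `K + 1` keeps the divisor positive.
  refine ⟨K + 1, by positivity, min r (‖deriv g 0‖ / (2 * (K + 1))), by positivity, ?_⟩
  intro u hu
  have hur : |u| < r := hu.trans_le (min_le_left _ _)
  have hu2 : |u| * (K + 1) ≤ ‖deriv g 0‖ / 2 := by
    have := hu.le.trans (min_le_right _ _)
    rw [le_div_iff₀ (by positivity)] at this
    linarith
  have hmem : ∀ w ∈ uIcc 0 u, w ∈ s ∩ {t | DifferentiableAt ℝ g t} := by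
    intro w hw
    apply hrs
    have := abs_sub_left_of_mem_uIcc hw
    simp only [sub_zero] at this
    simpa [Metric.mem_ball, dist_eq_norm] using this.trans_lt hur
  have hmain : ‖g u - g 0 - u • deriv g 0‖ ≤ (K + 1) * u ^ 2 := by
    have h1 : ∀ w ∈ uIcc 0 u, HasDerivWithinAt (fun w => g w - w • deriv g 0)
        (deriv g w - (1 : ℝ) • deriv g 0) (uIcc 0 u) w := fun w hw =>
      ((hmem w hw).2.hasDerivAt.sub ((hasDerivAt_id w).smul_const _)).hasDerivWithinAt
    have h2 : ∀ w ∈ uIcc 0 u, ‖deriv g w - (1 : ℝ) • deriv g 0‖ ≤ K * |u| := by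
      intro w hw
      have h3 := hK.dist_le_mul _ (hmem w hw).1 _ (mem_of_mem_nhds hs)
      have := abs_sub_left_of_mem_uIcc hw
      simp only [sub_zero] at this
      rw [dist_eq_norm, dist_eq_norm, sub_zero, Real.norm_eq_abs] at h3
      rw [one_smul]
      exact h3.trans (by gcongr)
    have h4 := (convex_uIcc 0 u).norm_image_sub_le_of_norm_hasDerivWithin_le h1 h2
      left_mem_uIcc right_mem_uIcc
    simp only [zero_smul, sub_zero, Real.norm_eq_abs] at h4
    have h5 : g u - g 0 - u • deriv g 0 = g u - u • deriv g 0 - g 0 := by abel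
    rw [h5]
    refine h4.trans ?_
    rw [mul_assoc, abs_mul_abs_self]
    nlinarith [sq_nonneg u]
  refine ⟨hmain, ?_⟩
  have h6 : ‖u • deriv g 0‖ ≤ ‖g u - g 0‖ + ‖g u - g 0 - u • deriv g 0‖ := by
    have := norm_sub_le (g u - g 0) (g u - g 0 - u • deriv g 0)
    simpa using this
  rw [norm_smul, Real.norm_eq_abs] at h6
  have h7 : (K + 1) * u ^ 2 ≤ |u| * (‖deriv g 0‖ / 2) := by
    rw [← sq_abs]; nlinarith [abs_nonneg u]
  nlinarith

/-- Near each of its points a one-dimensional submanifold carries a unit-speed curve, to which it is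
tangent at second order. -/
lemma IsSmoothSubmanifold.exists_unitCurve {D : ℕ} {M : Set (Ambient D)}
    (hM : IsSmoothSubmanifold 1 M) {y : Ambient D} (hy : y ∈ M) :
    ∃ (c : ℝ → Ambient D) (a : ℝ), 0 < a ∧ IsUnitCurve M c (-a) a ∧ c 0 = y ∧
      ∃ C > 0, ∃ ρ > 0, ∀ m ∈ M, ‖m - y‖ < ρ → ∀ w, inner ℝ w (deriv c 0) = 0 →
        |inner ℝ w (m - y)| ≤ C * ‖w‖ * ‖m - y‖ ^ 2 := by
  obtain ⟨U, V, φ, ψ, hU, hyU, hV, hφ, hinj, himg, hψ, hψφ⟩ := hM y hy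
  obtain ⟨v₀, hv₀, hφv₀⟩ : y ∈ φ '' V := himg ▸ ⟨hy, hyU⟩
  set e : EuclideanSpace ℝ (Fin 1) := EuclideanSpace.single 0 1 with he
  have he0 : e ≠ 0 := by
    intro h; have := congrArg (fun v => v 0) h; simp [he] at this
  set g : ℝ → Ambient D := fun u => φ (v₀ + u • e) with hgdef
  have hline : ContDiff ℝ ∞ (fun u : ℝ => v₀ + u • e) := by fun_prop
  set W : Set ℝ := (fun u : ℝ => v₀ + u • e) ⁻¹' V with hW
  have hWo : IsOpen W := hV.preimage hline.continuous
  have hW0 : (0 : ℝ) ∈ W := by simp [hW, hv₀]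
  have hg : ContDiffOn ℝ ∞ g W := hφ.comp hline.contDiffOn (fun u hu => hu)
  have hgd : ∀ u ∈ W, HasDerivAt g (fderiv ℝ φ (v₀ + u • e) e) u := by
    intro u hu
    have h1 : HasFDerivAt φ (fderiv ℝ φ (v₀ + u • e)) (v₀ + u • e) :=
      ((hφ.contDiffAt (hV.mem_nhds hu)).differentiableAt (by simp)).hasFDerivAt
    have h2 : HasDerivAt (fun u : ℝ => v₀ + u • e) e u := by
      simpa using ((hasDerivAt_id u).smul_const e).const_add v₀
    exact h1.comp_hasDerivAt u h2
  have hgne : ∀ u ∈ W, deriv g u ≠ 0 := by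
    intro u hu h
    rw [(hgd u hu).deriv] at h
    exact he0 (hinj _ hu (by simpa using h))
  have hg0 : g 0 = y := by simp [hgdef, hφv₀]
  have hgM : ∀ u ∈ W, g u ∈ M := fun u hu => by
    have : φ (v₀ + u • e) ∈ φ '' V := mem_image_of_mem _ hu
    rw [himg] at this
    exact this.1
  have hdg : ContDiffOn ℝ ∞ (deriv g) W := by
    refine ((contDiffOn_infty_iff_deriv_of_isOpen hWo).1 hg).2
  -- Solving `u' = 1 / ‖g' (u)‖` makes `g ∘ u` run at unit speed.
  set v : ℝ → ℝ := fun u => ‖deriv g u‖⁻¹ with hv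
  have hvs : ContDiffOn ℝ ∞ v W :=
    (hdg.norm ℝ hgne).inv (fun u hu => norm_ne_zero_iff.2 (hgne u hu))
  obtain ⟨u, hu0, ε, hε, hu⟩ :=
    ((hvs.contDiffAt (hWo.mem_nhds hW0)).of_le
      (mod_cast le_top)).exists_forall_mem_closedBall_exists_eq_forall_mem_Ioo_hasDerivAt₀ 0
  have hcont : ContinuousAt u 0 := (hu 0 (by simp [hε])).continuousAt
  obtain ⟨a₁, ha₁, huW⟩ := Metric.mem_nhds_iff.1
    (hcont.preimage_mem_nhds (t := W) (by rw [hu0]; exact hWo.mem_nhds hW0))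
  set a := min a₁ ε with ha
  have hapos : 0 < a := lt_min ha₁ hε
  have huW' : ∀ t ∈ Ioo (-a) a, u t ∈ W := by
    intro t ht
    apply huW
    rw [Real.ball_eq_Ioo]
    constructor <;> [have := ht.1; have := ht.2] <;> have := min_le_left a₁ ε <;> linarith
  have hud : ∀ t ∈ Ioo (-a) a, HasDerivAt u (v (u t)) t := by
    intro t ht
    apply hu
    have := min_le_right a₁ ε
    constructor <;> [have := ht.1; have := ht.2] <;> linarith
  have hus : ContDiffOn ℝ ∞ u (Ioo (-a) a) := contDiffOn_of_hasDerivAt_comp isOpen_Ioo hvs huW' hud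
  have hcd : ∀ t ∈ Ioo (-a) a, HasDerivAt (fun t => g (u t)) (v (u t) • deriv g (u t)) t := by
    intro t ht
    have h1 := (hgd _ (huW' t ht))
    rw [← h1.deriv] at h1
    exact h1.scomp t (hud t ht)
  have h0mem : (0 : ℝ) ∈ Ioo (-a) a := by simp [hapos]
  refine ⟨fun t => g (u t), a, hapos, ⟨hg.comp hus huW', fun t ht => hgM _ (huW' t ht), ?_⟩,
    by simp [hu0, hg0], ?_⟩
  · intro t ht
    rw [(hcd t ht).deriv, norm_smul, hv]
    have := norm_ne_zero_iff.2 (hgne _ (huW' t ht))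
    simp [this]
  · obtain ⟨K, hK, r, hr, hquad⟩ :=
      exists_quadratic_bounds (hg.contDiffAt (hWo.mem_nhds hW0)) (hgne 0 hW0)
    set s := ‖deriv g 0‖ / 2 with hs
    have hspos : 0 < s := by have := norm_pos_iff.2 (hgne 0 hW0); positivity
    have hψy : ψ y = v₀ := by rw [← hφv₀, hψφ _ hv₀]
    -- Continuity of the inverse chart means that points of `M` near `y` have parameters near `v₀`:
    -- no other sheet of `M` accumulates at `y`.
    have hnear : ∀ᶠ m in 𝓝[M ∩ U] y, ψ m ∈ Metric.ball v₀ r := by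
      refine (hψ y ⟨hy, hyU⟩).preimage_mem_nhdsWithin ?_
      rw [hψy]; exact Metric.ball_mem_nhds _ hr
    rw [nhdsWithin_inter_of_mem' (mem_nhdsWithin_of_mem_nhds (hU.mem_nhds hyU)),
      eventually_nhdsWithin_iff] at hnear
    obtain ⟨ρ, hρ, hball⟩ := Metric.mem_nhds_iff.1 (inter_mem hnear (hU.mem_nhds hyU))
    refine ⟨K / s ^ 2, by positivity, ρ, hρ, ?_⟩
    intro m hm hmy w hw
    have hmb := hball (show m ∈ Metric.ball y ρ by rwa [mem_ball_iff_norm])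
    obtain ⟨z, hz, rfl⟩ : m ∈ φ '' V := himg ▸ ⟨hm, hmb.2⟩
    have hzb : z ∈ Metric.ball v₀ r := by
      have := hmb.1 hm
      rwa [hψφ _ hz] at this
    have hze : z = v₀ + (z 0 - v₀ 0) • e := by
      ext i; fin_cases i; simp [he]
    set q := z 0 - v₀ 0 with hq
    have hqr : |q| < r := by
      rw [mem_ball_iff_norm, hze] at hzb
      simpa [norm_smul, he] using hzb
    obtain ⟨h1, h2⟩ := hquad q hqr
    have hgq : g q = φ z := by rw [hgdef]; simp only; rw [← hze]
    rw [hgq, hg0] at h1 h2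
    have hw' : inner ℝ w (deriv g 0) = 0 := by
      have h3 := hcd 0 h0mem
      rw [h3.deriv, inner_smul_right, hu0] at hw
      refine (mul_eq_zero.1 hw).resolve_left ?_
      exact inv_ne_zero (norm_ne_zero_iff.2 (hgne 0 hW0))
    -- `w` is orthogonal to the velocity, so only the quadratic remainder of the chart contributes;
    -- `h2` then trades the parameter `q` for the distance `‖φ z - y‖`.
    have h4 : inner ℝ w (φ z - y) = inner ℝ w (φ z - y - q • deriv g 0) := by
      rw [inner_sub_right w (φ z - y), inner_smul_right, hw']; simp
    rw [h4]
    refine (abs_real_inner_le_norm _ _).trans ?_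
    have h5 : q ^ 2 * s ^ 2 ≤ ‖φ z - y‖ ^ 2 := by
      rw [← sq_abs q, ← mul_pow]
      exact pow_le_pow_left₀ (by positivity) h2 2
    have h6 : K * q ^ 2 ≤ K / s ^ 2 * ‖φ z - y‖ ^ 2 := by
      rw [div_mul_eq_mul_div, le_div_iff₀ (by positivity)]
      nlinarith
    calc ‖w‖ * ‖φ z - y - q • deriv g 0‖ ≤ ‖w‖ * (K / s ^ 2 * ‖φ z - y‖ ^ 2) := by
          gcongr; exact h1.trans h6
      _ = _ := by ring

section

variable {D : ℕ} {M : Set (Ambient D)}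

/-! ### Tangent lines and reach -/

lemma IsUnitCurve.contDiffAt {c : ℝ → Ambient D} {a b t : ℝ} (hc : IsUnitCurve M c a b)
    (ht : t ∈ Ioo a b) : ContDiffAt ℝ ∞ c t :=
  hc.smooth.contDiffAt (isOpen_Ioo.mem_nhds ht)

lemma IsUnitCurve.hasDerivAt {c : ℝ → Ambient D} {a b t : ℝ} (hc : IsUnitCurve M c a b)
    (ht : t ∈ Ioo a b) : HasDerivAt c (deriv c t) t :=
  ((hc.contDiffAt ht).differentiableAt (by simp)).hasDerivAt

lemma IsUnitCurve.deriv_mem_tangentSpace {c : ℝ → Ambient D} {a b t : ℝ}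
    (hc : IsUnitCurve M c a b) (ht : t ∈ Ioo a b) : deriv c t ∈ tangentSpace M (c t) := by
  refine Submodule.subset_span ⟨fun s => c (s + t), ?_, ?_, by simp, ?_⟩
  · have h := hc.contDiffAt ht
    have h1 : ContDiffAt ℝ ∞ (fun s : ℝ => s + t) 0 := by fun_prop
    exact ContDiffAt.comp (g := c) 0 (by simpa using h) h1
  · have : Tendsto (fun s : ℝ => s + t) (𝓝 0) (𝓝 t) := by
      simpa using (continuous_id.add continuous_const).tendsto (0 : ℝ) (f := fun s : ℝ => s + t)
    filter_upwards [this (isOpen_Ioo.mem_nhds ht)] with s hs using hc.mem _ hs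
  · rw [deriv_comp_add_const]; simp

/-- A vector orthogonal to `M` at second order is orthogonal to the tangent space. -/
lemma inner_eq_zero_of_mem_tangentSpace {y w : Ambient D} {C ρ : ℝ} (hρ : 0 < ρ)
    (h : ∀ m ∈ M, ‖m - y‖ < ρ → |inner ℝ w (m - y)| ≤ C * ‖m - y‖ ^ 2) {v : Ambient D}
    (hv : v ∈ tangentSpace M y) : inner ℝ w v = 0 := by
  induction hv using Submodule.span_induction with
  | mem v hv =>
    obtain ⟨γ, hγ, hγM, hγ0, rfl⟩ := hv
    have hd : HasDerivAt γ (deriv γ 0) 0 := (hγ.differentiableAt (by simp)).hasDerivAt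
    have hd' : HasDerivAt (fun t => γ t - y) (deriv γ 0) 0 := hd.sub_const y
    have h1 : HasDerivAt (fun t => inner ℝ w (γ t - y)) (inner ℝ w (deriv γ 0)) 0 := by
      simpa using (hasDerivAt_const (0 : ℝ) w).inner ℝ hd'
    have h2 : HasDerivAt (fun t => ‖γ t - y‖ ^ 2) 0 0 := by
      simpa [hγ0] using hd'.norm_sq
    have hnear : ∀ᶠ t in 𝓝 (0 : ℝ), ‖γ t - y‖ < ρ := by
      have := hd'.continuousAt.norm
      exact this.eventually_lt_const (by simpa [hγ0] using hρ)
    have hO : (fun t => inner ℝ w (γ t - y)) =O[𝓝 0] fun t => ‖γ t - y‖ ^ 2 := by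
      refine Asymptotics.IsBigO.of_bound C ?_
      filter_upwards [hγM, hnear] with t ht ht'
      simpa using h _ ht ht'
    -- A function dominated by `‖γ t - y‖ ^ 2` is `o(t)`, since that square has zero derivative at
    -- `0`.
    have h3 : HasDerivAt (fun t => inner ℝ w (γ t - y)) 0 0 := by
      rw [hasDerivAt_iff_isLittleO] at h2 ⊢
      simp only [hγ0, sub_self, norm_zero, smul_zero, sub_zero, inner_zero_right,
        ne_eq, OfNat.ofNat_ne_zero, not_false_eq_true, zero_pow] at h2 ⊢
      exact hO.trans_isLittleO h2
    exact h1.unique h3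
  | zero => simp
  | add a b _ _ ha hb => rw [inner_add_right, ha, hb, add_zero]
  | smul r a _ ha => rw [inner_smul_right, ha, mul_zero]

/-- A nonzero tangent vector spans the tangent space of a curve. -/
lemma IsSmoothSubmanifold.tangentSpace_eq_span (hM : IsSmoothSubmanifold 1 M) {y v : Ambient D}
    (hy : y ∈ M) (hv : v ∈ tangentSpace M y) (hv0 : v ≠ 0) :
    tangentSpace M y = Submodule.span ℝ {v} := by
  obtain ⟨c, a, ha, hc, hc0, C, hC, ρ, hρ, hq⟩ := hM.exists_unitCurve hy
  have hle : tangentSpace M y ≤ Submodule.span ℝ {deriv c 0} := by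
    intro u hu
    have hunit : ‖deriv c 0‖ = 1 := hc.speed 0 (by simp [ha])
    -- `w` is the part of `u` normal to the curve. Second-order tangency makes it orthogonal to `u`,
    -- hence to itself.
    set w := u - inner ℝ (deriv c 0) u • deriv c 0 with hw
    have hwc : inner ℝ w (deriv c 0) = 0 := by
      rw [hw, inner_sub_left, inner_smul_left, real_inner_self_eq_norm_sq, hunit,
        real_inner_comm u]
      simp
    have h0 : inner ℝ w u = 0 := inner_eq_zero_of_mem_tangentSpace (C := C * ‖w‖) hρ
      (fun m hm hmy => hq m hm hmy w hwc) hu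
    have h1 : inner ℝ w w = 0 := by
      nth_rewrite 2 [hw]
      rw [inner_sub_right, inner_smul_right, hwc, h0]; simp
    have h2 : w = 0 := inner_self_eq_zero.1 h1
    rw [Submodule.mem_span_singleton]
    exact ⟨inner ℝ (deriv c 0) u, (sub_eq_zero.1 (hw ▸ h2)).symm⟩
  refine le_antisymm (hle.trans ?_) (Submodule.span_le.2 (by simpa using hv))
  obtain ⟨r, hr⟩ := Submodule.mem_span_singleton.1 (hle hv)
  have hr0 : r ≠ 0 := by rintro rfl; exact hv0 (by simpa using hr.symm)
  rw [Submodule.span_le, singleton_subset_iff]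
  exact Submodule.mem_span_singleton.2 ⟨r⁻¹, by rw [← hr, smul_smul, inv_mul_cancel₀ hr0, one_smul]⟩

/-- The reach is a supremum that need not be attained, so uniqueness is claimed strictly below `τ`;
the endpoint is recovered by a limit in `inner_le_of_reach`. -/
lemma exists_nearest_unique_of_lt_reach {τ r : ℝ} (h : ENNReal.ofReal τ ≤ reach M) (hr0 : 0 ≤ r)
    (hr : r < τ) (z : Ambient D) (hz : Metric.infDist z M ≤ r) :
    ∃! y, y ∈ M ∧ Metric.infDist z M = dist z y := by
  have h1 : ENNReal.ofReal r < reach M :=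
    ((ENNReal.ofReal_lt_ofReal_iff (hr0.trans_lt hr)).2 hr).trans_le h
  simp only [reach, lt_iSup_iff] at h1
  obtain ⟨s, hs, hrs⟩ := h1
  refine hs z (hz.trans ?_)
  rw [ENNReal.ofReal, ENNReal.coe_lt_coe] at hrs
  exact Real.toNNReal_le_iff_le_coe.1 hrs.le

/-- Where nearest points are unique, nearest points can be pushed further along the normal ray. -/
lemma exists_nearest_extension (hK : IsCompact M) {y n : Ambient D} {r t₀ : ℝ}
    (hy : y ∈ M) (hn : ‖n‖ = 1) (ht₀ : 0 < t₀) (ht₀r : t₀ < r)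
    (huniq : ∀ z, Metric.infDist z M ≤ r → ∃! y, y ∈ M ∧ Metric.infDist z M = dist z y)
    (hnear : ∀ m ∈ M, t₀ ≤ dist (y + t₀ • n) m) :
    ∃ t₁, t₀ < t₁ ∧ t₁ ≤ r ∧ ∀ m ∈ M, t₁ ≤ dist (y + t₁ • n) m := by
  have hne : M.Nonempty := ⟨y, hy⟩
  set w := y + t₀ • n with hw
  have hwy : dist w y = t₀ := by simp [hw, dist_eq_norm, norm_smul, hn, abs_of_pos ht₀]
  have hdw : Metric.infDist w M = t₀ :=
    le_antisymm (hwy ▸ Metric.infDist_le_dist_of_mem hy) ((Metric.le_infDist hne).2 fun m hm => hnear m hm)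
  set η := min (r - t₀) t₀ with hη
  have hηpos : 0 < η := lt_min (sub_pos.2 ht₀r) ht₀
  have hηr : η ≤ r - t₀ := min_le_left _ _
  have hηt : η ≤ t₀ := min_le_right _ _
  have hball : ∀ z ∈ Metric.closedBall w η, Metric.infDist z M ≤ r := by
    intro z hz
    have := Metric.infDist_le_infDist_add_dist (s := M) (x := z) (y := w)
    rw [Metric.mem_closedBall] at hz
    linarith
  -- Take the point of a small ball around `w` that is farthest from `M`. It turns out to be the
  -- continuation of the normal ray by `η`.
  obtain ⟨u, hu, hmax⟩ := (isCompact_closedBall w η).exists_isMaxOn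
    ⟨w, Metric.mem_closedBall_self hηpos.le⟩ (Metric.continuous_infDist_pt M).continuousOn
  obtain ⟨ξ, ⟨hξM, hξ⟩, hξu⟩ := huniq u (hball u hu)
  have hdu : t₀ ≤ dist u ξ := by
    rw [← hξ, ← hdw]; exact hmax (Metric.mem_closedBall_self hηpos.le)
  set A := u - ξ with hA
  set B := u - w with hB
  have hAn : ‖A‖ = dist u ξ := (dist_eq_norm _ _).symm
  have hApos : 0 < ‖A‖ := by rw [hAn]; linarith
  have hBn : ‖B‖ ≤ η := by rw [hB, ← dist_eq_norm]; exact hu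
  -- First-order optimality at `u`: as the nearest point `ξ` is unique, the distance to `M` grows in
  -- the direction of `A`, so a maximizer over the ball must lie as far as possible in that
  -- direction.
  have hAB : ‖A‖ * η ≤ inner ℝ A B := by
    by_contra! hlt
    -- `u + q` is the point `w + (η / ‖A‖) • A` of the ball. If the claim failed, moving from `u`
    -- towards it would increase the distance to `M`; this is contradicted along nearest points `m
    -- k`, whose cluster point can only be `ξ`.
    set q := (η / ‖A‖) • A - B with hq
    have hqA : 0 < inner ℝ q A := by
      rw [hq, inner_sub_left, inner_smul_left, real_inner_self_eq_norm_sq, real_inner_comm]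
      simp only [conj_trivial]
      rw [real_inner_comm] at hlt
      have : η / ‖A‖ * ‖A‖ ^ 2 = ‖A‖ * η := by field_simp
      rw [this]
      rw [real_inner_comm] at hlt
      linarith
    set s : ℕ → ℝ := fun k => 1 / ((k : ℝ) + 1) with hs
    have hs0 : ∀ k, 0 < s k := fun k => by positivity
    have hs1 : ∀ k, s k ≤ 1 := fun k => by
      simp only [hs]; rw [div_le_one (by positivity)]
      linarith [(Nat.cast_nonneg k : (0:ℝ) ≤ k)]
    have hslim : Tendsto s atTop (𝓝 0) := tendsto_one_div_add_atTop_nhds_zero_nat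
    have hmemb : ∀ k, u + s k • q ∈ Metric.closedBall w η := by
      intro k
      have h1 : w + (η / ‖A‖) • A ∈ Metric.closedBall w η := by
        rw [mem_closedBall_iff_norm, add_sub_cancel_left, norm_smul, Real.norm_eq_abs,
          abs_of_pos (by positivity), div_mul_cancel₀ _ hApos.ne']
      have h2 := (convex_closedBall w η) hu h1 (sub_nonneg.2 (hs1 k)) (hs0 k).le (by ring)
      convert h2 using 1
      rw [hq, hB]
      module
    have hex : ∀ k, ∃ m ∈ M, Metric.infDist (u + s k • q) M = dist (u + s k • q) m := fun k => by
      obtain ⟨m, hm, -⟩ := huniq _ (hball _ (hmemb k))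
      exact ⟨m, hm.1, hm.2⟩
    choose m hmM hm using hex
    have hneg : ∀ k, inner ℝ q (u - m k) ≤ 0 := by
      intro k
      have h1 : dist (u + s k • q) (m k) ≤ ‖A‖ := by
        rw [← hm, hAn, ← hξ]; exact hmax (hmemb k)
      have h2 : ‖A‖ ≤ ‖u - m k‖ := by
        rw [hAn, ← hξ, ← dist_eq_norm]; exact Metric.infDist_le_dist_of_mem (hmM k)
      have h3 : ‖u + s k • q - m k‖ ^ 2
          = ‖u - m k‖ ^ 2 + 2 * (s k * inner ℝ q (u - m k)) + ‖s k • q‖ ^ 2 := by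
        have : u + s k • q - m k = (u - m k) + s k • q := by abel
        rw [this, norm_add_sq_real, inner_smul_right, real_inner_comm]
      rw [dist_eq_norm] at h1
      have h4 : ‖u + s k • q - m k‖ ^ 2 ≤ ‖u - m k‖ ^ 2 :=
        pow_le_pow_left₀ (norm_nonneg _) (h1.trans h2) 2
      by_contra! h5
      have := mul_pos (hs0 k) h5
      nlinarith [sq_nonneg ‖s k • q‖]
    obtain ⟨ζ, hζM, φ, hφ, hlim⟩ := hK.tendsto_subseq hmM
    have hslim' : Tendsto (fun k => u + s (φ k) • q) atTop (𝓝 u) := by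
      have := ((hslim.comp hφ.tendsto_atTop).smul_const q).const_add u
      simpa using this
    have hζ : Metric.infDist u M = dist u ζ := by
      refine tendsto_nhds_unique
        (((Metric.continuous_infDist_pt M).tendsto u).comp hslim') ?_
      have := hslim'.dist hlim
      refine this.congr fun k => ?_
      simp only [Function.comp]
      rw [hm]
    have hζξ : ζ = ξ := hξu ζ ⟨hζM, hζ⟩
    have : inner ℝ q (u - ζ) ≤ 0 := by
      have hl : Tendsto (fun k => inner ℝ q (u - m (φ k))) atTop (𝓝 (inner ℝ q (u - ζ))) :=
        tendsto_const_nhds.inner (tendsto_const_nhds.sub hlim)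
      exact le_of_tendsto hl (Eventually.of_forall fun k => hneg (φ k))
    rw [hζξ] at this
    linarith
  -- Equality case of Cauchy–Schwarz, since `‖B‖ ≤ η`.
  have hBA : B = (η / ‖A‖) • A := by
    have h1 : ‖B - (η / ‖A‖) • A‖ ^ 2 ≤ 0 := by
      rw [norm_sub_sq_real, inner_smul_right, norm_smul, Real.norm_eq_abs,
        abs_of_pos (show 0 < η / ‖A‖ by positivity), div_mul_cancel₀ _ hApos.ne',
        real_inner_comm]
      have h2 : η ≤ (inner ℝ A B) / ‖A‖ := by rw [le_div_iff₀ hApos]; linarith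
      have h3 : η / ‖A‖ * inner ℝ A B = η * (inner ℝ A B / ‖A‖) := by ring
      rw [h3]
      nlinarith [norm_nonneg B]
    have h4 : ‖B - (η / ‖A‖) • A‖ = 0 := by nlinarith [norm_nonneg (B - (η / ‖A‖) • A)]
    exact sub_eq_zero.1 (norm_eq_zero.1 h4)
  have hAle : ‖A‖ ≤ t₀ + η := by
    rw [hAn, ← hξ]
    have := Metric.infDist_le_infDist_add_dist (s := M) (x := u) (y := w)
    rw [Metric.mem_closedBall] at hu
    linarith
  have hwξ : w - ξ = (1 - η / ‖A‖) • A := by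
    have : w - ξ = A - B := by rw [hA, hB]; abel
    rw [this, hBA]; module
  have hwξd : dist w ξ = |‖A‖ - η| := by
    rw [dist_eq_norm, hwξ, norm_smul, Real.norm_eq_abs]
    have : ‖A‖ - η = (1 - η / ‖A‖) * ‖A‖ := by field_simp
    rw [this, abs_mul, abs_of_pos hApos]
  -- `w` lies on the segment from `u` to `ξ`, and `ξ` cannot be closer to `w` than `t₀`. With `hAle`
  -- this fixes `‖A‖`, so `ξ` is also nearest to `w`, and uniqueness gives `ξ = y`.
  have hge : t₀ ≤ |‖A‖ - η| := by rw [← hwξd]; exact hnear ξ hξM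
  have hAeq : ‖A‖ = t₀ + η := by
    rw [abs_of_nonneg (by linarith)] at hge
    linarith
  have hξy : ξ = y := by
    refine (huniq w (by linarith)).unique ⟨hξM, ?_⟩ ⟨hy, by rw [hdw, hwy]⟩
    rw [hdw, hwξd, abs_of_nonneg (by linarith)]
    linarith
  have hAt : A = (t₀ + η) • n := by
    have h1 : t₀ • n = (1 - η / ‖A‖) • A := by rw [← hwξ, hξy, hw]; abel
    have h2 : 1 - η / ‖A‖ = t₀ / (t₀ + η) := by
      rw [hAeq]; field_simp; ring
    rw [h2] at h1
    have h3 : A = ((t₀ + η) / t₀) • (t₀ / (t₀ + η)) • A := by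
      rw [smul_smul, div_mul_div_comm, mul_comm, div_self (by positivity), one_smul]
    rw [h3, ← h1, smul_smul, div_mul_cancel₀ _ ht₀.ne']
  refine ⟨t₀ + η, by linarith, by linarith, fun m hm => ?_⟩
  have hut : y + (t₀ + η) • n = u := by rw [← hAt, hA, hξy]; abel
  rw [hut, ← hAeq, hAn, ← hξ]
  exact Metric.infDist_le_dist_of_mem hm

/-- For a set of positive reach, a point stays the nearest one along a normal segment. -/
lemma le_dist_of_normal (hK : IsCompact M) {y n : Ambient D} {r s : ℝ}
    (hy : y ∈ M) (hn : ‖n‖ = 1) (hs : 0 < s) (hsr : s ≤ r)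
    (huniq : ∀ z, Metric.infDist z M ≤ r → ∃! y, y ∈ M ∧ Metric.infDist z M = dist z y)
    (hnear : ∀ m ∈ M, s ≤ dist (y + s • n) m) :
    ∀ m ∈ M, r ≤ dist (y + r • n) m := by
  set S : Set ℝ := {t | t ∈ Icc s r ∧ ∀ m ∈ M, t ≤ dist (y + t • n) m} with hS
  have hclosed : IsClosed S := by
    have : S = Icc s r ∩ ⋂ m ∈ M, {t : ℝ | t ≤ dist (y + t • n) m} := by
      ext t; simp [hS]
    rw [this]
    refine isClosed_Icc.inter (isClosed_biInter fun m _ => isClosed_le continuous_id (by fun_prop))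
  have hSc : IsCompact S := isCompact_Icc.of_isClosed_subset hclosed fun t ht => ht.1
  -- The largest admissible `t` must be `r`: otherwise `exists_nearest_extension` goes further.
  obtain ⟨t₀, ht₀, hmax⟩ := hSc.exists_isGreatest ⟨s, ⟨le_rfl, hsr⟩, hnear⟩
  rcases ht₀.1.2.lt_or_eq with hlt | heq
  · obtain ⟨t₁, h1, h2, h3⟩ := exists_nearest_extension hK hy hn (hs.trans_le ht₀.1.1) hlt huniq ht₀.2
    have := hmax ⟨⟨ht₀.1.1.trans h1.le, h2⟩, h3⟩
    linarith
  · exact heq ▸ ht₀.2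

/-- Federer's inequality for curves of reach at least `τ`. -/
lemma inner_le_of_reach (hM : IsSmoothSubmanifold 1 M) (hK : IsCompact M) {τ : ℝ} (hτ : 0 < τ)
    (hreach : ENNReal.ofReal τ ≤ reach M) {y m w : Ambient D} (hy : y ∈ M) (hm : m ∈ M)
    (hw : ∀ v ∈ tangentSpace M y, inner ℝ w v = 0) :
    2 * τ * inner ℝ w (m - y) ≤ ‖w‖ * ‖m - y‖ ^ 2 := by
  rcases eq_or_ne w 0 with rfl | hw0
  · simp
  have hwpos : 0 < ‖w‖ := norm_pos_iff.2 hw0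
  set n := ‖w‖⁻¹ • w with hn
  have hn1 : ‖n‖ = 1 := by
    rw [hn, norm_smul, norm_inv, norm_norm, inv_mul_cancel₀ hwpos.ne']
  obtain ⟨c, a, ha, hc, hc0, C, hC, ρ, hρ, hq⟩ := hM.exists_unitCurve hy
  have hnc : inner ℝ n (deriv c 0) = 0 := by
    have := hc.deriv_mem_tangentSpace (t := 0) (by simp [ha])
    rw [hc0] at this
    rw [hn, inner_smul_left, hw _ this, mul_zero]
  have hexp : ∀ (t : ℝ) (z : Ambient D),
      dist (y + t • n) z ^ 2 = t ^ 2 - 2 * (t * inner ℝ n (z - y)) + ‖z - y‖ ^ 2 := by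
    intro t z
    have : y + t • n - z = t • n - (z - y) := by abel
    rw [dist_eq_norm, this, norm_sub_sq_real, norm_smul, hn1, inner_smul_left]
    simp
  have hr : ∀ r, 0 < r → r < τ → 2 * r * inner ℝ n (m - y) ≤ ‖m - y‖ ^ 2 := by
    intro r hr0 hrτ
    -- Starting radius for pushing out the normal ray. With `s ≤ 1 / (2 C)` the tangent ball avoids
    -- `M` near `y` by second-order tangency; with `s ≤ ρ / 2` it cannot reach points of `M` farther
    -- than `ρ`.
    set s := min r (min (1 / (2 * C)) (ρ / 2)) with hs
    have hs0 : 0 < s := by positivity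
    have hsC : s * (2 * C) ≤ 1 := by
      have : s ≤ 1 / (2 * C) := (min_le_right _ _).trans (min_le_left _ _)
      rwa [le_div_iff₀ (by positivity)] at this
    have hsρ : s ≤ ρ / 2 := (min_le_right _ _).trans (min_le_right _ _)
    have hnear : ∀ z ∈ M, s ≤ dist (y + s • n) z := by
      intro z hz
      rcases lt_or_ge ‖z - y‖ ρ with hzy | hzy
      · have h1 := (le_abs_self _).trans (hq z hz hzy n hnc)
        rw [hn1, mul_one] at h1
        refine le_of_sq_le_sq ?_ dist_nonneg
        rw [hexp]
        have h2 : 2 * (s * inner ℝ n (z - y)) ≤ ‖z - y‖ ^ 2 := by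
          calc 2 * (s * inner ℝ n (z - y)) ≤ 2 * (s * (C * ‖z - y‖ ^ 2)) := by gcongr
            _ = s * (2 * C) * ‖z - y‖ ^ 2 := by ring
            _ ≤ 1 * ‖z - y‖ ^ 2 := by gcongr
            _ = _ := one_mul _
        linarith
      · have h1 : dist z y ≤ dist (y + s • n) z + dist (y + s • n) y := dist_triangle_left _ _ _
        have h2 : dist (y + s • n) y = s := by
          simp [dist_eq_norm, norm_smul, hn1, abs_of_pos hs0]
        rw [dist_eq_norm z] at h1
        linarith
    have h1 := le_dist_of_normal hK hy hn1 hs0 (min_le_left _ _)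
      (exists_nearest_unique_of_lt_reach hreach hr0.le hrτ) hnear m hm
    have h2 : r ^ 2 ≤ dist (y + r • n) m ^ 2 := pow_le_pow_left₀ hr0.le h1 2
    rw [hexp] at h2
    linarith
  have hlim : 2 * τ * inner ℝ n (m - y) ≤ ‖m - y‖ ^ 2 := by
    have ht : Tendsto (fun r : ℝ => 2 * r * inner ℝ n (m - y)) (𝓝[<] τ)
        (𝓝 (2 * τ * inner ℝ n (m - y))) :=
      ((by fun_prop : Continuous fun r : ℝ => 2 * r * inner ℝ n (m - y)).tendsto τ).mono_left
        nhdsWithin_le_nhds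
    refine le_of_tendsto ht ?_
    filter_upwards [Ioo_mem_nhdsLT hτ] with r hr' using hr r hr'.1 hr'.2
  have h3 : inner ℝ w (m - y) = ‖w‖ * inner ℝ n (m - y) := by
    rw [hn, inner_smul_left]; simp [hwpos.ne']
  rw [h3]
  calc 2 * τ * (‖w‖ * inner ℝ n (m - y)) = ‖w‖ * (2 * τ * inner ℝ n (m - y)) := by ring
    _ ≤ _ := by gcongr

end

section

variable {D : ℕ} {M : Set (Ambient D)}

/-! ### Unit-speed curves in a set of positive reach -/

/-- `M` is a compact smooth curve (possibly with several components) of reach at least `τ > 0`. -/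
structure IsReachCurve (M : Set (Ambient D)) (τ : ℝ) : Prop where
  submanifold : IsSmoothSubmanifold 1 M
  compact : IsCompact M
  pos : 0 < τ
  reach_ge : ENNReal.ofReal τ ≤ reach M

namespace IsUnitCurve

variable {c : ℝ → Ambient D} {a b s t τ : ℝ}

lemma mono {a' b' : ℝ} (hc : IsUnitCurve M c a b) (ha : a ≤ a') (hb : b' ≤ b) :
    IsUnitCurve M c a' b' where
  smooth := hc.smooth.mono (Ioo_subset_Ioo ha hb)
  mem t ht := hc.mem t (Ioo_subset_Ioo ha hb ht)
  speed t ht := hc.speed t (Ioo_subset_Ioo ha hb ht)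

lemma shift (hc : IsUnitCurve M c a b) (r : ℝ) :
    IsUnitCurve M (fun t => c (t + r)) (a - r) (b - r) where
  smooth := hc.smooth.comp (by fun_prop)
    (fun t ht => ⟨by linarith [ht.1], by linarith [ht.2]⟩)
  mem t ht := hc.mem _ ⟨by linarith [ht.1], by linarith [ht.2]⟩
  speed t ht := by
    rw [deriv_comp_add_const]; exact hc.speed _ ⟨by linarith [ht.1], by linarith [ht.2]⟩

lemma reverse (hc : IsUnitCurve M c a b) : IsUnitCurve M (fun t => c (-t)) (-b) (-a) where
  smooth := hc.smooth.comp (by fun_prop)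
    (fun t ht => ⟨by linarith [ht.2], by linarith [ht.1]⟩)
  mem t ht := hc.mem _ ⟨by linarith [ht.2], by linarith [ht.1]⟩
  speed t ht := by
    rw [deriv_comp_neg, norm_neg]; exact hc.speed _ ⟨by linarith [ht.2], by linarith [ht.1]⟩

lemma contDiffOn_deriv (hc : IsUnitCurve M c a b) : ContDiffOn ℝ ∞ (deriv c) (Ioo a b) :=
  ((contDiffOn_infty_iff_deriv_of_isOpen isOpen_Ioo).1 hc.smooth).2

lemma hasDerivAt_deriv (hc : IsUnitCurve M c a b) (ht : t ∈ Ioo a b) :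
    HasDerivAt (deriv c) (deriv (deriv c) t) t :=
  ((hc.contDiffOn_deriv.contDiffAt (isOpen_Ioo.mem_nhds ht)).differentiableAt
    (by simp)).hasDerivAt

/-- Differentiate `‖c'‖² = 1`. This makes the acceleration normal to `M`, as needed both for
Federer's inequality and for the geodesic equation. -/
lemma inner_deriv_deriv (hc : IsUnitCurve M c a b) (ht : t ∈ Ioo a b) :
    inner ℝ (deriv (deriv c) t) (deriv c t) = 0 := by
  have h1 := (hc.hasDerivAt_deriv ht).norm_sq
  have h2 : HasDerivAt (fun s => ‖deriv c s‖ ^ 2) 0 t := by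
    refine (hasDerivAt_const t (1 : ℝ)).congr_of_eventuallyEq ?_
    filter_upwards [isOpen_Ioo.mem_nhds ht] with s hs
    rw [hc.speed s hs]; simp
  have := h1.unique h2
  rw [real_inner_comm]; linarith

lemma tangentSpace_eq (hM : IsSmoothSubmanifold 1 M) (hc : IsUnitCurve M c a b)
    (ht : t ∈ Ioo a b) : tangentSpace M (c t) = Submodule.span ℝ {deriv c t} :=
  hM.tangentSpace_eq_span (hc.mem t ht) (hc.deriv_mem_tangentSpace ht)
    (norm_ne_zero_iff.1 (by rw [hc.speed t ht]; simp))

lemma dist_le (hc : IsUnitCurve M c a b) (hs : s ∈ Ioo a b) (ht : t ∈ Ioo a b) :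
    ‖c t - c s‖ ≤ |t - s| := by
  have := (convex_Ioo a b).norm_image_sub_le_of_norm_hasDerivWithin_le
    (fun u hu => (hc.hasDerivAt hu).hasDerivWithinAt) (fun u hu => (hc.speed u hu).le) hs ht
  simpa using this

/-- The curvature is at most the inverse of the reach. -/
lemma norm_deriv_deriv_le (hM : IsReachCurve M τ) (hc : IsUnitCurve M c a b) (ht : t ∈ Ioo a b) :
    ‖deriv (deriv c) t‖ ≤ 1 / τ := by
  by_contra! hlt
  set w := deriv (deriv c) t with hw
  have hτ := hM.pos
  have hwpos : 0 < ‖w‖ := lt_trans (by positivity) hlt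
  have hwn : ∀ v ∈ tangentSpace M (c t), inner ℝ w v = 0 := by
    intro v hv
    rw [hc.tangentSpace_eq hM.submanifold ht] at hv
    obtain ⟨r, rfl⟩ := Submodule.mem_span_singleton.1 hv
    rw [inner_smul_right, hc.inner_deriv_deriv ht, mul_zero]
  -- Federer's inequality along the curve says `g ≥ 0`, while `g` and `g'` vanish at `t` and `g'' t
  -- = 2 ‖w‖ (1 - τ ‖w‖) < 0`. So `g` also has a local maximum at `t`, vanishes nearby, and
  -- contradicts its own second derivative.
  set g : ℝ → ℝ := fun s => ‖w‖ * ‖c s - c t‖ ^ 2 - 2 * τ * inner ℝ w (c s - c t) with hg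
  set g' : ℝ → ℝ := fun s =>
    ‖w‖ * (2 * inner ℝ (c s - c t) (deriv c s)) - 2 * τ * inner ℝ w (deriv c s) with hg'
  have hgd : ∀ s ∈ Ioo a b, HasDerivAt g (g' s) s := by
    intro s hs
    have h1 := (hc.hasDerivAt hs).sub_const (c t)
    have h2 := (hasDerivAt_const s w).inner ℝ h1
    simp only [inner_zero_left, add_zero] at h2
    exact (h1.norm_sq.const_mul ‖w‖).sub (h2.const_mul (2 * τ))
  have hgdd : HasDerivAt g' (‖w‖ * 2 - 2 * τ * ‖w‖ ^ 2) t := by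
    have h1 := (hc.hasDerivAt ht).sub_const (c t)
    have h3 := hc.hasDerivAt_deriv ht
    have h4 := h1.inner ℝ h3
    have h2 := (hasDerivAt_const t w).inner ℝ h3
    have h5 := ((h4.const_mul 2).const_mul ‖w‖).sub (h2.const_mul (2 * τ))
    refine h5.congr_deriv ?_
    rw [sub_self, inner_zero_left, inner_zero_left, zero_add, add_zero,
      real_inner_self_eq_norm_sq, hc.speed t ht, ← hw, real_inner_self_eq_norm_sq]
    ring
  have hev : deriv g =ᶠ[𝓝 t] g' := by
    filter_upwards [isOpen_Ioo.mem_nhds ht] with s hs using (hgd s hs).deriv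
  have hneg : ‖w‖ * 2 - 2 * τ * ‖w‖ ^ 2 < 0 := by
    rw [div_lt_iff₀ hτ] at hlt
    nlinarith
  have hdd : deriv (deriv g) t = ‖w‖ * 2 - 2 * τ * ‖w‖ ^ 2 := by
    rw [hev.deriv_eq, hgdd.deriv]
  have hd0 : deriv g t = 0 := by
    rw [(hgd t ht).deriv, hg']
    simp [hwn _ (hc.deriv_mem_tangentSpace ht)]
  have hmax := isLocalMax_of_deriv_deriv_neg (hdd ▸ hneg) hd0 (hgd t ht).continuousAt
  have hgt : g t = 0 := by simp [hg]
  have hz : g =ᶠ[𝓝 t] fun _ => 0 := by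
    filter_upwards [hmax, isOpen_Ioo.mem_nhds ht] with s hs hs'
    refine le_antisymm (hgt ▸ hs) ?_
    have := inner_le_of_reach hM.submanifold hM.compact hτ hM.reach_ge (hc.mem t ht)
      (hc.mem s hs') hwn
    simp only [hg]; linarith
  have : deriv (deriv g) t = 0 := by
    rw [hz.deriv.deriv_eq]; simp
  rw [hdd] at this
  linarith

lemma norm_deriv_sub_le (hM : IsReachCurve M τ) (hc : IsUnitCurve M c a b) (hs : s ∈ Ioo a b)
    (ht : t ∈ Ioo a b) : ‖deriv c t - deriv c s‖ ≤ |t - s| / τ := by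
  have := (convex_Ioo a b).norm_image_sub_le_of_norm_hasDerivWithin_le
    (fun u hu => (hc.hasDerivAt_deriv hu).hasDerivWithinAt)
    (fun u hu => hc.norm_deriv_deriv_le hM hu) hs ht
  rwa [Real.norm_eq_abs, one_div_mul_eq_div] at this

/-- Comparison of chords and arcs. -/
lemma le_chord (hM : IsReachCurve M τ) (hc : IsUnitCurve M c a b) (hs : s ∈ Ioo a b)
    (ht : t ∈ Ioo a b) : |t - s| * (1 - (t - s) ^ 2 / (6 * τ ^ 2)) ≤ ‖c t - c s‖ := by
  wlog hst : s ≤ t generalizing s t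
  · have := this ht hs (le_of_not_ge hst)
    rwa [abs_sub_comm, norm_sub_rev, ← neg_sub t s, neg_sq] at this
  have hτ := hM.pos
  have hsub : Icc s t ⊆ Ioo a b := Icc_subset_Ioo hs.1 ht.2
  -- The chord is at least its projection on the initial velocity. For unit vectors the inner
  -- product is `1 - ‖c' u - c' s‖² / 2 ≥ 1 - (u - s)² / (2 τ²)`; its integral produces the constant
  -- `6`.
  set G : ℝ → ℝ := fun u => inner ℝ (c u - c s) (deriv c s) - (u - s) + (u - s) ^ 3 / (6 * τ ^ 2)
    with hG
  have hGd : ∀ u ∈ Icc s t, HasDerivAt G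
      (inner ℝ (deriv c u) (deriv c s) - 1 + (u - s) ^ 2 / (2 * τ ^ 2)) u := by
    intro u hu
    have h1 := ((hc.hasDerivAt (hsub hu)).sub_const (c s)).inner ℝ (hasDerivAt_const u (deriv c s))
    have h2 := (hasDerivAt_id u).sub_const s
    have h3 := (h1.sub h2).add ((h2.pow 3).div_const (6 * τ ^ 2))
    refine h3.congr_deriv ?_
    simp
    field_simp
    ring
  have hmono : MonotoneOn G (Icc s t) := by
    refine monotoneOn_of_deriv_nonneg (convex_Icc s t)
      (fun u hu => (hGd u hu).continuousAt.continuousWithinAt)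
      (fun u hu => (hGd u (interior_subset hu)).differentiableAt.differentiableWithinAt) ?_
    intro u hu
    have hu' := interior_subset hu
    rw [(hGd u hu').deriv]
    have h1 := hc.norm_deriv_sub_le hM hs (hsub hu')
    have h2 := norm_sub_sq_real (deriv c u) (deriv c s)
    rw [hc.speed u (hsub hu'), hc.speed s hs] at h2
    have h3 : ‖deriv c u - deriv c s‖ ^ 2 ≤ (u - s) ^ 2 / τ ^ 2 := by
      rw [← sq_abs (u - s), ← div_pow]; exact pow_le_pow_left₀ (norm_nonneg _) h1 2
    have h4 : (u - s) ^ 2 / (2 * τ ^ 2) = (u - s) ^ 2 / τ ^ 2 / 2 := by field_simp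
    rw [h4]; linarith
  have h1 := hmono (left_mem_Icc.2 hst) (right_mem_Icc.2 hst) hst
  simp only [hG, sub_self, inner_zero_left] at h1
  have h2 := real_inner_le_norm (c t - c s) (deriv c s)
  rw [hc.speed s hs, mul_one] at h2
  rw [abs_of_nonneg (sub_nonneg.2 hst)]
  have h3 : (t - s) * (1 - (t - s) ^ 2 / (6 * τ ^ 2)) = (t - s) - (t - s) ^ 3 / (6 * τ ^ 2) := by
    ring
  rw [h3]
  norm_num at h1
  linarith

/-- For arcs of length at most `τ` the factor in `le_chord` is at least `5 / 6`. -/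
lemma abs_sub_le_of_abs_le (hM : IsReachCurve M τ) (hc : IsUnitCurve M c a b) (hs : s ∈ Ioo a b)
    (ht : t ∈ Ioo a b) (hst : |t - s| ≤ τ) : |t - s| ≤ 6 / 5 * ‖c t - c s‖ := by
  have h1 := hc.le_chord hM hs ht
  have hτ := hM.pos
  have h2 : (t - s) ^ 2 / (6 * τ ^ 2) ≤ 1 / 6 := by
    rw [div_le_div_iff₀ (by positivity) (by norm_num), ← sq_abs]
    nlinarith [abs_nonneg (t - s)]
  nlinarith [abs_nonneg (t - s)]

/-- Near the base point of a unit-speed curve, `M` consists of that curve only. -/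
lemma exists_eq_of_norm_lt (hM : IsReachCurve M τ) {r t₀ : ℝ} (hc : IsUnitCurve M c a b)
    (h0 : 0 < r) (hrτ : r ≤ τ) (ha : a < t₀ - r) (hb : t₀ + r < b) {m : Ambient D} (hm : m ∈ M)
    (hmc : ‖m - c t₀‖ < 5 / 12 * r) :
    ∃ s, |s - t₀| < r ∧ c s = m ∧ |s - t₀| ≤ 6 / 5 * ‖m - c t₀‖ := by
  have hsub : Icc (t₀ - r) (t₀ + r) ⊆ Ioo a b := Icc_subset_Ioo ha hb
  have ht₀ : t₀ ∈ Icc (t₀ - r) (t₀ + r) := ⟨by linarith, by linarith⟩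
  obtain ⟨s, hs, hmin⟩ := isCompact_Icc.exists_isMinOn ⟨t₀, ht₀⟩
    (f := fun u => ‖m - c u‖) (s := Icc (t₀ - r) (t₀ + r))
    ((continuousOn_const.sub (hc.smooth.continuousOn.mono hsub)).norm)
  have hsle : ‖m - c s‖ ≤ ‖m - c t₀‖ := hmin ht₀
  have hsτ : |s - t₀| ≤ r := abs_le.2 ⟨by linarith [hs.1], by linarith [hs.2]⟩
  have hs1 := hc.abs_sub_le_of_abs_le hM (hsub ht₀) (hsub hs) (hsτ.trans hrτ)
  have hs2 : ‖c s - c t₀‖ ≤ ‖m - c t₀‖ + ‖m - c s‖ := by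
    have := norm_sub_le (m - c t₀) (m - c s)
    simpa using this
  -- This fixes the constant `5 / 12`: `6 / 5 * (2 * (5 / 12)) = 1`. The minimizer is interior, so
  -- `m - c s` is normal to the curve.
  have hsr : |s - t₀| < r := by linarith
  have hnhds : Icc (t₀ - r) (t₀ + r) ∈ 𝓝 s := by
    rw [abs_lt] at hsr
    exact Icc_mem_nhds (by linarith) (by linarith)
  have hloc : IsLocalMin (fun u => ‖m - c u‖ ^ 2) s := by
    filter_upwards [hnhds] with u hu
    exact pow_le_pow_left₀ (norm_nonneg _) (hmin hu) 2
  have hder := ((hc.hasDerivAt (hsub hs)).const_sub m).norm_sq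
  have h0' := hloc.hasDerivAt_eq_zero hder
  have hperp : ∀ v ∈ tangentSpace M (c s), inner ℝ (m - c s) v = 0 := by
    intro v hv
    rw [hc.tangentSpace_eq hM.submanifold (hsub hs)] at hv
    obtain ⟨q, rfl⟩ := Submodule.mem_span_singleton.1 hv
    rw [inner_neg_right] at h0'
    rw [inner_smul_right]
    have : inner ℝ (m - c s) (deriv c s) = 0 := by linarith
    rw [this, mul_zero]
  -- With `w = m - c s` this reads `2 τ ‖w‖² ≤ ‖w‖³`, impossible for `0 < ‖w‖ < 2 τ`.
  have hF := inner_le_of_reach hM.submanifold hM.compact hM.pos hM.reach_ge (hc.mem s (hsub hs))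
    hm hperp
  rw [real_inner_self_eq_norm_sq] at hF
  have hz : ‖m - c s‖ = 0 := by
    by_contra hne
    have hpos : 0 < ‖m - c s‖ := lt_of_le_of_ne (norm_nonneg _) (Ne.symm hne)
    have hlt : ‖m - c s‖ < 2 * τ := by linarith
    have : 0 < ‖m - c s‖ ^ 2 := by positivity
    nlinarith
  have heq : c s = m := (sub_eq_zero.1 (norm_eq_zero.1 hz)).symm
  refine ⟨s, hsr, heq, ?_⟩
  rw [← heq]; exact hs1

end IsUnitCurve

/-- Unit-speed curves exist in all tangent directions, on intervals of uniform length. -/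
lemma IsReachCurve.exists_uniform_unitCurve {τ : ℝ} (hM : IsReachCurve M τ) :
    ∃ δ > 0, ∀ z ∈ M, ∀ v ∈ tangentSpace M z, ‖v‖ = 1 →
      ∃ c, IsUnitCurve M c (-δ) δ ∧ c 0 = z ∧ deriv c 0 = v := by
  suffices h : ∃ δ > 0, ∀ z ∈ M ∩ M, ∀ v ∈ tangentSpace M z, ‖v‖ = 1 →
      ∃ c, IsUnitCurve M c (-δ) δ ∧ c 0 = z ∧ deriv c 0 = v by
    simpa only [inter_self] using h
  refine hM.compact.induction_on (p := fun s => ∃ δ > 0, ∀ z ∈ M ∩ s, ∀ v ∈ tangentSpace M z,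
    ‖v‖ = 1 → ∃ c, IsUnitCurve M c (-δ) δ ∧ c 0 = z ∧ deriv c 0 = v) ⟨1, one_pos, by simp⟩ ?_ ?_ ?_
  · rintro s t hst ⟨δ, hδ, h⟩
    exact ⟨δ, hδ, fun z hz => h z ⟨hz.1, hst hz.2⟩⟩
  · rintro s t ⟨δ₁, hδ₁, h₁⟩ ⟨δ₂, hδ₂, h₂⟩
    refine ⟨min δ₁ δ₂, lt_min hδ₁ hδ₂, ?_⟩
    rintro z ⟨hzM, hz | hz⟩ v hv hv1
    · obtain ⟨c, hc, h⟩ := h₁ z ⟨hzM, hz⟩ v hv hv1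
      exact ⟨c, hc.mono (neg_le_neg (min_le_left _ _)) (min_le_left _ _), h⟩
    · obtain ⟨c, hc, h⟩ := h₂ z ⟨hzM, hz⟩ v hv hv1
      exact ⟨c, hc.mono (neg_le_neg (min_le_right _ _)) (min_le_right _ _), h⟩
  · intro y hy
    obtain ⟨c, a, ha, hc, hc0, -⟩ := hM.submanifold.exists_unitCurve hy
    have hτ := hM.pos
    set r := min (a / 2) τ with hr
    have hrpos : 0 < r := by positivity
    have hra : r ≤ a / 2 := min_le_left _ _
    -- Every point of this neighbourhood is `c s` with `|s| < a / 2`, so half of the interval is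
    -- left on both sides after recentring at `s`.
    refine ⟨Metric.ball y (5 / 12 * r),
      mem_nhdsWithin_of_mem_nhds (Metric.ball_mem_nhds _ (by positivity)), a / 2, by positivity, ?_⟩
    rintro z ⟨hzM, hz⟩ v hv hv1
    rw [mem_ball_iff_norm, ← hc0] at hz
    obtain ⟨s, hs, rfl, -⟩ := hc.exists_eq_of_norm_lt hM hrpos (min_le_right _ _)
      (by linarith) (by linarith) hzM hz
    rw [sub_zero, abs_lt] at hs
    have hsI : s ∈ Ioo (-a) a := ⟨by linarith, by linarith⟩
    rw [hc.tangentSpace_eq hM.submanifold hsI] at hv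
    obtain ⟨q, rfl⟩ := Submodule.mem_span_singleton.1 hv
    rw [norm_smul, hc.speed s hsI, mul_one, Real.norm_eq_abs] at hv1
    have hshift : IsUnitCurve M (fun t => c (t + s)) (-(a / 2)) (a / 2) :=
      (hc.shift s).mono (by linarith) (by linarith)
    have hd : deriv (fun t => c (t + s)) 0 = deriv c s := by
      rw [deriv_comp_add_const]; simp
    rcases eq_or_eq_neg_of_abs_eq hv1 with rfl | rfl
    · exact ⟨_, hshift, by simp, by rw [hd, one_smul]⟩
    · refine ⟨fun t => c (-t + s), by simpa using hshift.reverse, by simp, ?_⟩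
      have := deriv_comp_neg (fun t => c (t + s)) 0
      simp only [neg_zero] at this
      rw [this, hd]; simp

end

section

variable {D : ℕ} {M : Set (Ambient D)}

/-! ### Geodesics and the exponential map -/

namespace IsUnitCurve

variable {c c₁ c₂ e : ℝ → Ambient D} {a b δ r t t₀ τ : ℝ}

/-- A unit-speed curve starting like `e` keeps moving along `e` with the velocity of `e`. -/
lemma exists_eq_and_deriv_eq (hM : IsReachCurve M τ) (hc : IsUnitCurve M c a b)
    (he : IsUnitCurve M e (-δ) δ) (hr : 0 < r) (hrδ : r < δ) (hrτ : r ≤ τ / 2) (ht₀ : t₀ ∈ Ioo a b)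
    (ht : t ∈ Ioo a b) (htr : |t - t₀| ≤ r / 3) (h0 : e 0 = c t₀) (hd : deriv e 0 = deriv c t₀) :
    ∃ s, |s| < r ∧ e s = c t ∧ deriv e s = deriv c t := by
  have hτ := hM.pos
  have hdist := hc.dist_le ht₀ ht
  obtain ⟨s, hs, hes, hs'⟩ := he.exists_eq_of_norm_lt hM (t₀ := 0) hr (by linarith) (by linarith)
    (by linarith) (hc.mem t ht) (by rw [h0]; linarith)
  rw [sub_zero] at hs hs'
  rw [h0] at hs'
  have hsI : s ∈ Ioo (-δ) δ := by rw [abs_lt] at hs; exact ⟨by linarith, by linarith⟩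
  have h0I : (0 : ℝ) ∈ Ioo (-δ) δ := ⟨by linarith, by linarith⟩
  refine ⟨s, hs, hes, ?_⟩
  have hmem := hc.deriv_mem_tangentSpace ht
  rw [← hes, he.tangentSpace_eq hM.submanifold hsI] at hmem
  obtain ⟨q, hq⟩ := Submodule.mem_span_singleton.1 hmem
  have hq1 : |q| = 1 := by
    have := congrArg norm hq
    rwa [norm_smul, he.speed s hsI, hc.speed t ht, mul_one, Real.norm_eq_abs] at this
  rcases eq_or_eq_neg_of_abs_eq hq1 with rfl | rfl
  · rw [← hq, one_smul]
  -- The opposite sign would turn the velocity by `2`, whereas the curvature bound allows less over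
  -- these times.
  · exfalso
    have h1 := he.norm_deriv_sub_le hM h0I hsI
    have h2 := hc.norm_deriv_sub_le hM ht₀ ht
    rw [hd, sub_zero] at h1
    have h3 : (2 : ℝ) = ‖(deriv e s - deriv c t₀) - (deriv c t - deriv c t₀)‖ := by
      rw [← hq, sub_sub_sub_cancel_right, neg_one_smul, sub_neg_eq_add, ← two_smul ℝ, norm_smul,
        he.speed s hsI]
      norm_num
    have h4 := norm_sub_le (deriv e s - deriv c t₀) (deriv c t - deriv c t₀)
    have h5 : |s| / τ + |t - t₀| / τ < 2 := by
      rw [← add_div, div_lt_iff₀ hτ]; linarith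
    linarith

/-- Both curves run along one reference curve `e`, on which velocity is a Lipschitz function of
position: curvature at most `1 / τ`, arc at most `6 / 5` times chord. Grönwall's inequality for `c₁
- c₂` concludes. -/
lemma exists_eq_right (hM : IsReachCurve M τ) (h₁ : IsUnitCurve M c₁ a b)
    (h₂ : IsUnitCurve M c₂ a b) (ht₀ : t₀ ∈ Ioo a b) (h0 : c₁ t₀ = c₂ t₀)
    (hd : deriv c₁ t₀ = deriv c₂ t₀) : ∃ r > 0, ∀ t ∈ Icc t₀ (t₀ + r), c₁ t = c₂ t := by
  have hτ := hM.pos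
  obtain ⟨δ, hδ, hex⟩ := hM.exists_uniform_unitCurve
  obtain ⟨e, he, he0, hed⟩ := hex _ (h₁.mem t₀ ht₀) _ (h₁.deriv_mem_tangentSpace ht₀)
    (h₁.speed t₀ ht₀)
  set r₀ := min (δ / 2) (τ / 2) with hr₀
  have hr₀pos : 0 < r₀ := by positivity
  have hr₀δ : r₀ < δ := (min_le_left _ _).trans_lt (by linarith)
  have hb : 0 < b - t₀ := sub_pos.2 ht₀.2
  set r := min ((b - t₀) / 2) (r₀ / 3) with hr
  have hrpos : 0 < r := by positivity
  have hIcc : ∀ t ∈ Icc t₀ (t₀ + r), t ∈ Ioo a b ∧ |t - t₀| ≤ r₀ / 3 := by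
    intro t ht
    have h1 : r ≤ (b - t₀) / 2 := min_le_left _ _
    have h2 : r ≤ r₀ / 3 := min_le_right _ _
    exact ⟨⟨by linarith [ht.1, ht₀.1], by linarith [ht.2]⟩,
      abs_le.2 ⟨by linarith [ht.1], by linarith [ht.2]⟩⟩
  refine ⟨r, hrpos, fun t ht => sub_eq_zero.1 ?_⟩
  refine eq_zero_of_abs_deriv_le_mul_abs_self_of_eq_zero_right (f := fun t => c₁ t - c₂ t)
    (f' := fun t => deriv c₁ t - deriv c₂ t) (K := 6 / 5 / τ) (a := t₀) (b := t₀ + r)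
    ?_ ?_ (by simp [h0]) ?_ t ht
  · intro u hu
    exact ((h₁.hasDerivAt (hIcc u hu).1).sub
      (h₂.hasDerivAt (hIcc u hu).1)).continuousAt.continuousWithinAt
  · intro u hu
    have hu' := Ico_subset_Icc_self hu
    exact ((h₁.hasDerivAt (hIcc u hu').1).sub (h₂.hasDerivAt (hIcc u hu').1)).hasDerivWithinAt
  · intro u hu
    obtain ⟨huI, hur⟩ := hIcc u (Ico_subset_Icc_self hu)
    obtain ⟨s₁, hs₁, hes₁, hds₁⟩ := h₁.exists_eq_and_deriv_eq hM he hr₀pos hr₀δ (min_le_right _ _)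
      ht₀ huI hur he0 hed
    obtain ⟨s₂, hs₂, hes₂, hds₂⟩ := h₂.exists_eq_and_deriv_eq hM he hr₀pos hr₀δ (min_le_right _ _)
      ht₀ huI hur (he0.trans h0) (hed.trans hd)
    have hI : ∀ s, |s| < r₀ → s ∈ Ioo (-δ) δ := fun s hs => by
      rw [abs_lt] at hs; exact ⟨by linarith, by linarith⟩
    have hsub : |s₁ - s₂| ≤ τ := by
      have h1 := abs_sub s₁ s₂
      have h2 : r₀ ≤ τ / 2 := min_le_right _ _
      linarith
    have h3 := he.norm_deriv_sub_le hM (hI _ hs₂) (hI _ hs₁)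
    have h4 := he.abs_sub_le_of_abs_le hM (hI _ hs₂) (hI _ hs₁) hsub
    rw [← hes₁, ← hes₂, ← hds₁, ← hds₂]
    refine h3.trans ?_
    rw [div_mul_eq_mul_div]
    gcongr

/-- Unit-speed curves are determined by their initial position and velocity. -/
lemma eqOn (hM : IsReachCurve M τ) (h₁ : IsUnitCurve M c₁ a b)
    (h₂ : IsUnitCurve M c₂ a b) (ht₀ : t₀ ∈ Ioo a b) (h0 : c₁ t₀ = c₂ t₀)
    (hd : deriv c₁ t₀ = deriv c₂ t₀) : EqOn c₁ c₂ (Ioo a b) := by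
  have hloc : ∀ t ∈ Ioo a b, c₁ t = c₂ t → deriv c₁ t = deriv c₂ t → c₁ =ᶠ[𝓝 t] c₂ := by
    intro t ht hct hdt
    obtain ⟨r₁, hr₁, h1⟩ := h₁.exists_eq_right hM h₂ ht hct hdt
    obtain ⟨r₂, hr₂, h2⟩ := h₁.reverse.exists_eq_right hM h₂.reverse (t₀ := -t)
      ⟨by linarith [ht.2], by linarith [ht.1]⟩ (by simpa using hct)
      (by rw [deriv_comp_neg, deriv_comp_neg]; simpa using hdt)
    filter_upwards [Ioo_mem_nhds (show t - r₂ < t by linarith) (show t < t + r₁ by linarith)]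
      with s hs
    rcases le_total t s with hts | hst
    · exact h1 s ⟨hts, hs.2.le⟩
    · simpa using h2 (-s) ⟨by linarith, by linarith [hs.1]⟩
  -- The times at which the germs agree form an open set. It is closed in the interval because
  -- positions and velocities pass to the limit and `hloc` restarts there.
  set u : Set ℝ := {t | c₁ =ᶠ[𝓝 t] c₂} with hu
  have huo : IsOpen u := by
    rw [isOpen_iff_eventually]
    intro t ht
    exact eventually_eventually_nhds.2 ht
  have hsub := isPreconnected_Ioo.subset_of_closure_inter_subset (s := Ioo a b) huo
    ⟨t₀, ht₀, hloc t₀ ht₀ h0 hd⟩ ?_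
  · exact fun t ht => (hsub ht).eq_of_nhds
  · rintro t ⟨htc, ht⟩
    have := mem_closure_iff_nhdsWithin_neBot.1 htc
    have key : ∀ f g : ℝ → Ambient D, ContinuousAt f t → ContinuousAt g t →
        (∀ s ∈ u, f s = g s) → f t = g t := by
      intro f g hf hg hfg
      refine tendsto_nhds_unique (hf.mono_left (nhdsWithin_le_nhds (s := u))) ?_
      refine (hg.mono_left (nhdsWithin_le_nhds (s := u))).congr' ?_
      filter_upwards [self_mem_nhdsWithin] with s hs using (hfg s hs).symm
    refine hloc t ht (key _ _ (h₁.hasDerivAt ht).continuousAt (h₂.hasDerivAt ht).continuousAt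
      fun s hs => hs.eq_of_nhds) ?_
    exact key _ _ (h₁.hasDerivAt_deriv ht).continuousAt (h₂.hasDerivAt_deriv ht).continuousAt
      fun s hs => hs.deriv_eq

/-- Uniform extension of a unit-speed curve to the right. -/
lemma exists_extension (hM : IsReachCurve M τ) (hδ : 0 < δ)
    (hex : ∀ z ∈ M, ∀ v ∈ tangentSpace M z, ‖v‖ = 1 →
      ∃ c, IsUnitCurve M c (-δ) δ ∧ c 0 = z ∧ deriv c 0 = v)
    (hc : IsUnitCurve M c a b) (h0 : 0 ∈ Ioo a b) (hb : δ ≤ b) :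
    ∃ c', IsUnitCurve M c' a (b + δ / 2) ∧ c' 0 = c 0 ∧ deriv c' 0 = deriv c 0 := by
  -- A curve of half-length `δ` started `δ / 2` before the end overshoots it by `δ / 2`; uniqueness
  -- makes the two agree on the overlap.
  set t₁ := b - δ / 2 with ht₁
  have ht₁I : t₁ ∈ Ioo a b := ⟨by linarith [h0.1], by linarith⟩
  obtain ⟨e, he, he0, hed⟩ := hex _ (hc.mem _ ht₁I) _ (hc.deriv_mem_tangentSpace ht₁I)
    (hc.speed _ ht₁I)
  set α := max a (t₁ - δ) with hα
  have hαa : a ≤ α := le_max_left _ _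
  have hαt : α < t₁ := max_lt ht₁I.1 (by linarith)
  have he' : IsUnitCurve M (fun t => e (t + -t₁)) α (b + δ / 2) :=
    (he.shift (-t₁)).mono (by have := le_max_right a (t₁ - δ); linarith) (by linarith)
  have heq : EqOn c (fun t => e (t + -t₁)) (Ioo α b) := by
    refine (hc.mono hαa le_rfl).eqOn hM (he'.mono le_rfl (by linarith)) ⟨hαt, ht₁I.2⟩
      (by simp [he0]) ?_
    rw [deriv_comp_add_const]; simp [hed]
  set c' : ℝ → Ambient D := fun t => if t < t₁ then c t else e (t + -t₁) with hc'
  have hL : ∀ t ∈ Ioo a t₁, c' =ᶠ[𝓝 t] c := fun t ht => by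
    filter_upwards [Iio_mem_nhds ht.2] with s hs
    exact if_pos hs
  have hR : ∀ t ∈ Ioo α (b + δ / 2), c' =ᶠ[𝓝 t] fun t => e (t + -t₁) := fun t ht => by
    filter_upwards [isOpen_Ioo.mem_nhds ht] with s hs
    by_cases h : s < t₁
    · simp only [hc', if_pos h]; exact heq ⟨hs.1, by linarith⟩
    · simp only [hc', if_neg h]
  have hcases : ∀ t ∈ Ioo a (b + δ / 2), t ∈ Ioo a t₁ ∨ t ∈ Ioo α (b + δ / 2) := by
    intro t ht
    rcases lt_or_ge t t₁ with h | h
    · exact Or.inl ⟨ht.1, h⟩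
    · exact Or.inr ⟨hαt.trans_le h, ht.2⟩
  have h0t : (0 : ℝ) ∈ Ioo a t₁ := ⟨h0.1, by linarith⟩
  refine ⟨c', ⟨?_, ?_, ?_⟩, (hL 0 h0t).eq_of_nhds, (hL 0 h0t).deriv_eq⟩
  · intro t ht
    rcases hcases t ht with h | h
    · exact ((hc.contDiffAt ⟨h.1, by linarith [h.2]⟩).congr_of_eventuallyEq
        (hL t h)).contDiffWithinAt
    · exact ((he'.contDiffAt h).congr_of_eventuallyEq (hR t h)).contDiffWithinAt
  · intro t ht
    rcases hcases t ht with h | h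
    · rw [(hL t h).eq_of_nhds]; exact hc.mem _ ⟨h.1, by linarith [h.2]⟩
    · rw [(hR t h).eq_of_nhds]; exact he'.mem _ h
  · intro t ht
    rcases hcases t ht with h | h
    · rw [(hL t h).deriv_eq]; exact hc.speed _ ⟨h.1, by linarith [h.2]⟩
    · rw [(hR t h).deriv_eq]; exact he'.speed _ h

end IsUnitCurve

/-- Through every point of `M` passes a unit-speed curve defined for all times. -/
lemma IsReachCurve.exists_global_unitCurve {τ : ℝ} (hM : IsReachCurve M τ) {x : Ambient D}
    (hx : x ∈ M) : ∃ c : ℝ → Ambient D, (∀ T, IsUnitCurve M c (-T) T) ∧ c 0 = x := by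
  obtain ⟨δ, hδ, hex⟩ := hM.exists_uniform_unitCurve
  obtain ⟨v, hv, hv1⟩ : ∃ v ∈ tangentSpace M x, ‖v‖ = 1 := by
    obtain ⟨c, a, ha, hc, rfl, -⟩ := hM.submanifold.exists_unitCurve hx
    have h0 : (0 : ℝ) ∈ Ioo (-a) a := by simp [ha]
    exact ⟨_, hc.deriv_mem_tangentSpace h0, hc.speed 0 h0⟩
  -- Each step gains `δ / 2` on the right, then on the left by time reversal. The initial velocity
  -- is retained so that the curves agree with each other.
  have hstep : ∀ k : ℕ, ∃ c, IsUnitCurve M c (-(δ / 2 + (k + 1) * (δ / 2)))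
      (δ / 2 + (k + 1) * (δ / 2)) ∧ c 0 = x ∧ deriv c 0 = v := by
    intro k
    induction k with
    | zero =>
      obtain ⟨c, hc, h⟩ := hex x hx v hv hv1
      exact ⟨c, hc.mono (by norm_num) (by norm_num), h⟩
    | succ k ih =>
      obtain ⟨c, hc, hc0, hcd⟩ := ih
      set b := δ / 2 + (k + 1) * (δ / 2) with hb
      have hδb : δ ≤ b := by
        have : (0 : ℝ) ≤ k * (δ / 2) := by positivity
        rw [hb]; linarith
      have hb0 : (0 : ℝ) ∈ Ioo (-b) b := ⟨by linarith, by linarith⟩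
      obtain ⟨c₁, hc₁, hc₁0, hc₁d⟩ := hc.exists_extension hM hδ hex hb0 hδb
      obtain ⟨c₂, hc₂, hc₂0, hc₂d⟩ := hc₁.reverse.exists_extension hM hδ hex
        ⟨by linarith, by linarith⟩ (by linarith)
      have h1 := hc₂.reverse
      rw [neg_neg, neg_neg] at h1
      refine ⟨fun t => c₂ (-t), h1.mono ?_ ?_, by simp [hc₂0, hc₁0, hc0], ?_⟩
      · push_cast; linarith
      · push_cast; linarith
      · rw [deriv_comp_neg, neg_zero, hc₂d, deriv_comp_neg, neg_neg, neg_zero, hc₁d, hcd]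
  have hall : ∀ T : ℝ, ∃ c, IsUnitCurve M c (-T) T ∧ c 0 = x ∧ deriv c 0 = v := by
    intro T
    obtain ⟨k, hk⟩ := exists_nat_ge (T / (δ / 2))
    obtain ⟨c, hc, h⟩ := hstep k
    rw [div_le_iff₀ (by positivity)] at hk
    have : T ≤ δ / 2 + (k + 1) * (δ / 2) := by linarith
    exact ⟨c, hc.mono (by linarith) this, h⟩
  choose F hF hF0 hFd using hall
  have hagree : ∀ T S t : ℝ, |t| < T → T ≤ S → F T t = F S t := by
    intro T S t ht hTS
    have hT : 0 < T := (abs_nonneg t).trans_lt ht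
    exact (hF T).eqOn hM ((hF S).mono (by linarith) hTS) (t₀ := 0) ⟨by linarith, hT⟩
      (by rw [hF0, hF0]) (by rw [hFd, hFd]) (abs_lt.1 ht)
  set c : ℝ → Ambient D := fun t => F (|t| + 1) t with hc
  have hev : ∀ t, c =ᶠ[𝓝 t] F (|t| + 2) := by
    intro t
    have : ∀ᶠ s in 𝓝 t, |s| < |t| + 1 :=
      continuous_abs.continuousAt.eventually_lt_const (by linarith)
    filter_upwards [this] with s hs
    exact hagree _ _ s (by linarith) (by linarith)
  have hmem : ∀ t : ℝ, t ∈ Ioo (-(|t| + 2)) (|t| + 2) := fun t => abs_lt.1 (by linarith)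
  refine ⟨c, fun T => ⟨fun t _ => ?_, fun t _ => ?_, fun t _ => ?_⟩, ?_⟩
  · exact (((hF _).contDiffAt (hmem t)).congr_of_eventuallyEq (hev t)).contDiffWithinAt
  · rw [(hev t).eq_of_nhds]; exact (hF _).mem _ (hmem t)
  · rw [(hev t).deriv_eq]; exact (hF _).speed _ (hmem t)
  · simp [hc, hF0]

end

section

variable {D : ℕ} {M : Set (Ambient D)}

lemma deriv_mem_tangentSpace_of_contDiff {γ : ℝ → Ambient D} (hγ : ContDiff ℝ ∞ γ)
    (hM : ∀ t, γ t ∈ M) (t : ℝ) : deriv γ t ∈ tangentSpace M (γ t) := by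
  refine Submodule.subset_span ⟨fun s => γ (s + t), ?_, Eventually.of_forall fun s => hM _,
    by simp, by rw [deriv_comp_add_const]; simp⟩
  exact (hγ.comp (by fun_prop : ContDiff ℝ ∞ fun s : ℝ => s + t)).contDiffAt

/-- The acceleration is orthogonal to the velocity. Constant speed allows the geodesic chosen in
`expMap` to be rescaled to a unit-speed curve. -/
lemma IsGeodesic.norm_deriv_eq {γ : ℝ → Ambient D} (hγ : IsGeodesic M γ) (t : ℝ) :
    ‖deriv γ t‖ = ‖deriv γ 0‖ := by
  have hd : ContDiff ℝ ∞ (deriv γ) := (contDiff_infty_iff_deriv.1 hγ.smooth).2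
  have h1 : ∀ s, HasDerivAt (fun s => ‖deriv γ s‖ ^ 2) 0 s := by
    intro s
    have h := ((hd.differentiable (by simp)) s).hasDerivAt.norm_sq
    have h2 := hγ.normal s _ (deriv_mem_tangentSpace_of_contDiff hγ.smooth hγ.mem s)
    rw [real_inner_comm] at h2
    rwa [h2, mul_zero] at h
  have h2 := is_const_of_deriv_eq_zero (fun s => (h1 s).differentiableAt) (fun s => (h1 s).deriv) t 0
  exact (pow_left_inj₀ (norm_nonneg _) (norm_nonneg _) two_ne_zero).1 h2

variable {c : ℝ → Ambient D} {τ : ℝ}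

lemma contDiff_of_forall_isUnitCurve (hc : ∀ T, IsUnitCurve M c (-T) T) : ContDiff ℝ ∞ c :=
  contDiff_iff_contDiffAt.2 fun t => (hc (|t| + 1)).contDiffAt (abs_lt.1 (by linarith))

/-- The exponential map of a curve is its arc-length parametrization. -/
lemma IsReachCurve.expMap_eq (hM : IsReachCurve M τ) (hc : ∀ T, IsUnitCurve M c (-T) T) (t : ℝ)
    (v : tangentSpace M (c 0)) (hv : (v : Ambient D) = t • deriv c 0) :
    expMap M (c 0) v = c t := by
  have hI : ∀ s : ℝ, s ∈ Ioo (-(|s| + 1)) (|s| + 1) := fun s => abs_lt.1 (by linarith)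
  have hcs := contDiff_of_forall_isUnitCurve hc
  have hex : ∃ γ : ℝ → Ambient D, IsGeodesic M γ ∧ γ 0 = c 0 ∧ deriv γ 0 = (v : Ambient D) := by
    have hd1 : deriv (fun s => c (t * s)) = fun s => t • deriv c (t * s) := by
      ext1 s; exact deriv_comp_mul_left t c s
    refine ⟨fun s => c (t * s), ⟨hcs.comp (by fun_prop), fun s => (hc _).mem _ (hI _), ?_⟩,
      by simp, by rw [hd1, hv]; simp⟩
    intro s w hw
    rw [(hc _).tangentSpace_eq hM.submanifold (hI (t * s))] at hw
    obtain ⟨q, rfl⟩ := Submodule.mem_span_singleton.1 hw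
    have hd2 : deriv (fun s => t • deriv c (t * s)) s = t • t • deriv (deriv c) (t * s) := by
      rw [deriv_fun_const_smul_field, deriv_comp_mul_left t (deriv c) s]
    rw [hd1, hd2, inner_smul_left, inner_smul_left, inner_smul_right,
      (hc _).inner_deriv_deriv (hI (t * s))]
    simp
  rw [expMap, dif_pos hex]
  obtain ⟨hγ, hγ0, hγd⟩ := hex.choose_spec
  set γ := hex.choose
  have hspeed : ∀ s, ‖deriv γ s‖ = |t| := by
    intro s
    rw [hγ.norm_deriv_eq, hγd, hv, norm_smul, (hc 1).speed 0 (by simp), mul_one, Real.norm_eq_abs]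
  rcases eq_or_ne t 0 with rfl | ht
  · rw [← hγ0]
    refine is_const_of_deriv_eq_zero (hγ.smooth.differentiable (by simp)) (fun s => ?_) 1 0
    simpa using hspeed s
  -- Whichever geodesic the definition picked, its rescaling has unit speed and the initial data of
  -- `c`, hence equals `c`.
  · have hγ' : ∀ T, IsUnitCurve M (fun s => γ (t⁻¹ * s)) (-T) T := by
      intro T
      refine ⟨(hγ.smooth.comp (by fun_prop)).contDiffOn, fun s _ => hγ.mem _, fun s _ => ?_⟩
      rw [deriv_comp_mul_left t⁻¹ γ s, norm_smul, hspeed, norm_inv, Real.norm_eq_abs,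
        inv_mul_cancel₀ (abs_ne_zero.2 ht)]
    have := (hγ' (|t| + 1)).eqOn hM (hc (|t| + 1)) (t₀ := 0)
      ⟨by linarith [abs_nonneg t], by linarith [abs_nonneg t]⟩ (by simp [hγ0])
      (by rw [deriv_comp_mul_left t⁻¹ γ 0, mul_zero, hγd, hv, smul_smul, inv_mul_cancel₀ ht,
            one_smul]) (hI t)
    simpa [inv_mul_cancel₀ ht] using this

lemma IsReachCurve.coe_eq_inner_smul (hM : IsReachCurve M τ) (hc : ∀ T, IsUnitCurve M c (-T) T)
    (v : tangentSpace M (c 0)) :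
    (v : Ambient D) = (inner ℝ (deriv c 0) (v : Ambient D)) • deriv c 0 := by
  have hv : (v : Ambient D) ∈ Submodule.span ℝ {deriv c 0} :=
    (hc 1).tangentSpace_eq hM.submanifold (t := 0) (by simp) ▸ v.2
  obtain ⟨q, hq⟩ := Submodule.mem_span_singleton.1 hv
  rw [← hq, inner_smul_right, real_inner_self_eq_norm_sq, (hc 1).speed 0 (by simp)]
  simp

/-- Two times in this interval differ by less than `2 τ`, so `(t - s)² / (6 τ²) < 4 / 6` and the
chord cannot vanish. -/
lemma IsReachCurve.injOn (hM : IsReachCurve M τ) (hc : ∀ T, IsUnitCurve M c (-T) T) :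
    InjOn c (Ioo (-τ) τ) := by
  intro s hs t ht hst
  have h := (hc τ).le_chord hM hs ht
  have hτ := hM.pos
  rw [hst, sub_self, norm_zero] at h
  by_contra hne
  have h1 : 0 < |t - s| := abs_pos.2 (sub_ne_zero.2 (Ne.symm hne))
  have h2 : (t - s) ^ 2 / (6 * τ ^ 2) < 1 := by
    rw [div_lt_one (by positivity)]
    nlinarith [hs.1, hs.2, ht.1, ht.2, sq_nonneg (t - s), abs_lt.1 (show |t - s| < 2 * τ from
      abs_lt.2 ⟨by linarith [hs.1, hs.2, ht.1, ht.2], by linarith [hs.1, hs.2, ht.1, ht.2]⟩)]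
  nlinarith

/-- In the linear coordinate `L` on the tangent line, `expMap` is `c ∘ L`. The bound makes the
Hölder condition available on an interval that depends on `τ` alone. -/
lemma IsReachCurve.le_injRadius (hM : IsReachCurve M τ) (hc : ∀ T, IsUnitCurve M c (-T) T) :
    ENNReal.ofReal τ ≤ injRadius M (c 0) := by
  have hcs := contDiff_of_forall_isUnitCurve hc
  have hτ := hM.pos
  set L : tangentSpace M (c 0) →L[ℝ] ℝ :=
    (innerSL ℝ (deriv c 0)).comp (tangentSpace M (c 0)).subtypeL with hL
  have hLv : ∀ v : tangentSpace M (c 0), (v : Ambient D) = L v • deriv c 0 := hM.coe_eq_inner_smul hc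
  have hexp : expMap M (c 0) = fun v => c (L v) := by
    ext1 v; exact hM.expMap_eq hc _ v (hLv v)
  have hLn : ∀ v : tangentSpace M (c 0), |L v| = ‖v‖ := by
    intro v
    have := congrArg norm (hLv v)
    rw [norm_smul, (hc 1).speed 0 (by simp), mul_one] at this
    exact this.symm
  refine le_iSup₂_of_le (f := fun (r : ℝ≥0) _ => (r : ℝ≥0∞)) τ.toNNReal ⟨?_, ?_, ?_⟩ le_rfl
  · rw [hexp]; exact (hcs.comp L.contDiff).contDiffOn
  · intro v hv w hw h
    have hmem : ∀ v ∈ Metric.ball (0 : tangentSpace M (c 0)) τ.toNNReal, L v ∈ Ioo (-τ) τ := by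
      intro v hv
      rw [mem_ball_zero_iff, Real.coe_toNNReal _ hτ.le] at hv
      exact abs_lt.1 (by rwa [hLn])
    rw [hexp] at h
    have h1 := hM.injOn hc (hmem v hv) (hmem w hw) h
    ext1
    rw [hLv v, hLv w, h1]
  · intro v _
    have hI : L v ∈ Ioo (-(|L v| + 1)) (|L v| + 1) := abs_lt.1 (by linarith)
    have hd : HasFDerivAt (fun v => c (L v)) (L.smulRight (deriv c (L v))) v := by
      have h1 := ((hc (|L v| + 1)).hasDerivAt hI).hasFDerivAt.comp v L.hasFDerivAt
      refine h1.congr_fderiv ?_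
      ext u; simp
    rw [hexp, hd.fderiv, injective_iff_map_eq_zero]
    intro u hu
    have h2 : L u • deriv c (L v) = 0 := hu
    have h3 : deriv c (L v) ≠ 0 := norm_ne_zero_iff.1 (by rw [(hc _).speed _ hI]; simp)
    have h4 := (smul_eq_zero.1 h2).resolve_right h3
    ext1
    rw [hLv u, h4]; simp

/-- Hölder regularity on `M`, read along the arc-length parametrization. -/
lemma IsReachCurve.holder_comp (hM : IsReachCurve M τ) (hc : ∀ T, IsUnitCurve M c (-T) T)
    {β R : ℝ} {f : Ambient D → ℝ} (hβ : 0 < β) (hf : HolderBound M β R f) :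
    ContDiffOn ℝ (⌈β - 1⌉₊ : ℕ) (fun t => f (c t)) (Ioo (-τ) τ) ∧
    ∀ s ∈ Ioo (-τ) τ, ∀ t ∈ Ioo (-τ) τ,
      |iteratedDeriv ⌈β - 1⌉₊ (fun t => f (c t)) s - iteratedDeriv ⌈β - 1⌉₊ (fun t => f (c t)) t| ≤
        R * |s - t| ^ (β - (⌈β - 1⌉₊ : ℝ)) := by
  have h0 : (0 : ℝ) ∈ Ioo (-(1 : ℝ)) 1 := by simp
  set k := ⌈β - 1⌉₊ with hk
  obtain ⟨hsm, hhol⟩ := hf hβ (c 0) ((hc 1).mem 0 h0)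
  set e : tangentSpace M (c 0) := ⟨deriv c 0, (hc 1).deriv_mem_tangentSpace h0⟩ with he
  have hen : ‖e‖ = 1 := (hc 1).speed 0 h0
  set L : ℝ →L[ℝ] tangentSpace M (c 0) := ContinuousLinearMap.toSpanSingleton ℝ e with hL
  have hLt : ∀ t, L t = t • e := fun t => rfl
  set F : tangentSpace M (c 0) → ℝ := fun v => f (expMap M (c 0) v) with hF
  have hcomp : (fun t => f (c t)) = F ∘ L := by
    ext1 t
    simp only [hF, Function.comp]
    rw [hM.expMap_eq hc t (L t) (by rw [hLt]; rfl)]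
  have hopen : IsOpen (injBall M (c 0)) := by
    have : Continuous fun v : tangentSpace M (c 0) => ((‖v‖₊ : ℝ≥0) : ℝ≥0∞) := by fun_prop
    exact isOpen_lt this continuous_const
  have hmaps : ∀ t ∈ Ioo (-τ) τ, L t ∈ injBall M (c 0) := by
    intro t ht
    refine lt_of_lt_of_le ?_ (hM.le_injRadius hc)
    rw [ENNReal.ofReal, ENNReal.coe_lt_coe, ← NNReal.coe_lt_coe, Real.coe_toNNReal _ hM.pos.le,
      coe_nnnorm, hLt, norm_smul, hen, mul_one]
    exact abs_lt.2 ht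
  have hit : ∀ t ∈ Ioo (-τ) τ,
      iteratedDeriv k (F ∘ L) t = iteratedFDeriv ℝ k F (L t) (fun _ => e) := by
    intro t ht
    have hpre : IsOpen (L ⁻¹' injBall M (c 0)) := hopen.preimage L.continuous
    have h1 := L.iteratedFDerivWithin_comp_right hsm hopen.uniqueDiffOn hpre.uniqueDiffOn
      (hmaps t ht) (i := k) le_rfl
    rw [iteratedFDerivWithin_of_isOpen k hpre (hmaps t ht),
      iteratedFDerivWithin_of_isOpen k hopen (hmaps t ht)] at h1
    rw [iteratedDeriv_eq_iteratedFDeriv, h1]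
    simp only [ContinuousMultilinearMap.compContinuousLinearMap_apply, hLt, one_smul, hF]
  rw [hcomp]
  refine ⟨hsm.comp L.contDiff.contDiffOn hmaps, fun s hs t ht => ?_⟩
  rw [hit s hs, hit t ht, ← sub_apply]
  refine (ContinuousMultilinearMap.le_opNorm
    (iteratedFDeriv ℝ k F (L s) - iteratedFDeriv ℝ k F (L t)) (fun _ => e)).trans ?_
  simp only [hen, Finset.prod_const_one, mul_one]
  have h2 := hhol (L s) (hmaps s hs) (L t) (hmaps t ht)
  have h3 : ‖L s - L t‖ = |s - t| := by
    rw [hLt, hLt, ← sub_smul, norm_smul, hen, mul_one, Real.norm_eq_abs]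
  rwa [h3] at h2

end

section

variable {D : ℕ} {M : Set (Ambient D)} {c : ℝ → Ambient D} {τ : ℝ}

/-! ### Length measure along a unit-speed curve -/

lemma IsReachCurve.hausdorffMeasure_image_le (hc : ∀ T, IsUnitCurve M c (-T) T) (A : Set ℝ) :
    μH[1] (c '' A) ≤ volume A := by
  have hlip : LipschitzOnWith 1 c A := by
    refine LipschitzOnWith.of_dist_le_mul fun s _ t _ => ?_
    rw [dist_eq_norm, dist_eq_norm, NNReal.coe_one, one_mul, Real.norm_eq_abs]
    refine (hc (|s| + |t| + 1)).dist_le (abs_lt.1 ?_) (abs_lt.1 ?_) <;>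
      linarith [abs_nonneg s, abs_nonneg t]
  simpa [hausdorffMeasure_real] using hlip.hausdorffMeasure_image_le (d := 1) zero_le_one

/-- On short arcs, the parametrization almost preserves length. -/
lemma IsReachCurve.mul_volume_le_of_short (hM : IsReachCurve M τ)
    (hc : ∀ T, IsUnitCurve M c (-T) T) {η : ℝ} {a : ℝ≥0} (ha : 0 < a)
    (hη : (a : ℝ) ≤ 1 - η ^ 2 / (6 * τ ^ 2)) {A : Set ℝ} (hA : A ⊆ Ioo (-τ) τ)
    (hAη : ∀ s ∈ A, ∀ t ∈ A, |s - t| ≤ η) : (a : ℝ≥0∞) * volume A ≤ μH[1] (c '' A) := by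
  have hτ := hM.pos
  set g := Function.invFunOn c A with hg
  have hgc : ∀ t ∈ A, g (c t) = t := fun t ht =>
    ((hM.injOn hc).mono hA).leftInvOn_invFunOn ht
  have hlip : LipschitzOnWith a⁻¹ g (c '' A) := by
    refine LipschitzOnWith.of_dist_le_mul ?_
    rintro _ ⟨s, hs, rfl⟩ _ ⟨t, ht, rfl⟩
    rw [hgc s hs, hgc t ht, dist_eq_norm, dist_eq_norm, Real.norm_eq_abs, NNReal.coe_inv,
      inv_mul_eq_div, le_div_iff₀ (by exact_mod_cast ha)]
    refine le_trans ?_ ((hc τ).le_chord hM (hA ht) (hA hs))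
    gcongr
    refine hη.trans ?_
    gcongr 1 - ?_ / (6 * τ ^ 2)
    rw [← sq_abs]
    exact pow_le_pow_left₀ (abs_nonneg _) (hAη s hs t ht) 2
  have himg : g '' (c '' A) = A := by
    rw [image_image]
    exact (image_congr hgc).trans (image_id' A)
  have h1 := hlip.hausdorffMeasure_image_le (d := 1) zero_le_one
  rw [himg, hausdorffMeasure_real, ENNReal.rpow_one, ENNReal.coe_inv ha.ne', mul_comm,
    ← div_eq_mul_inv, ENNReal.le_div_iff_mul_le (by simp [ha.ne']) (by simp)] at h1
  rwa [mul_comm]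

/-- The upper bound holds because `c` is 1-Lipschitz. For the lower bound, on pieces of diameter at
most `η` the inverse has Lipschitz constant `1 / a'`; adding up pieces and letting `a'` tend to `1`
gives equality. -/
lemma IsReachCurve.hausdorffMeasure_image (hM : IsReachCurve M τ)
    (hc : ∀ T, IsUnitCurve M c (-T) T) {A : Set ℝ} (hA : A ⊆ Ioo (-τ) τ) (hAm : MeasurableSet A) :
    μH[1] (c '' A) = volume A := by
  have hτ := hM.pos
  have hcont : Continuous c := (contDiff_of_forall_isUnitCurve hc).continuous
  refine le_antisymm (hausdorffMeasure_image_le hc A) ?_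
  refine ENNReal.le_of_forall_lt_one_mul_le fun a' ha' => ?_
  lift a' to ℝ≥0 using (ha'.trans ENNReal.one_lt_top).ne
  rcases eq_or_ne a' 0 with rfl | ha0
  · simp
  have ha1 : a' < 1 := by exact_mod_cast ha'
  obtain ⟨η, hη0, hη⟩ : ∃ η > 0, (a' : ℝ) ≤ 1 - η ^ 2 / (6 * τ ^ 2) := by
    have h1 : (0 : ℝ) < 1 - a' := sub_pos.2 (by exact_mod_cast ha1)
    refine ⟨τ * √(1 - a'), by positivity, ?_⟩
    rw [mul_pow, Real.sq_sqrt h1.le]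
    have : τ ^ 2 * (1 - (a' : ℝ)) / (6 * τ ^ 2) = (1 - a') / 6 := by field_simp
    rw [this]; linarith
  -- Dyadic subdivision: a window of length `2 ^ (k + 1) * η` is halved, and the two images are
  -- disjoint by injectivity.
  have key : ∀ k : ℕ, ∀ (u : ℝ) (B : Set ℝ), MeasurableSet B → B ⊆ Ioo (-τ) τ →
      B ⊆ Ico u (u + 2 ^ k * η) → (a' : ℝ≥0∞) * volume B ≤ μH[1] (c '' B) := by
    intro k
    induction k with
    | zero =>
      intro u B _ hB hBu
      refine hM.mul_volume_le_of_short hc (pos_iff_ne_zero.2 ha0) hη hB fun s hs t ht => ?_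
      have h1 := hBu hs
      have h2 := hBu ht
      rw [pow_zero, one_mul] at h1 h2
      exact abs_le.2 ⟨by linarith [h1.1, h2.2], by linarith [h1.2, h2.1]⟩
    | succ k ih =>
      intro u B hBm hB hBu
      set v := u + 2 ^ k * η with hv
      have h1 := ih u (B ∩ Iio v) (hBm.inter measurableSet_Iio) (inter_subset_left.trans hB)
        fun t ht => ⟨(hBu ht.1).1, ht.2⟩
      have h2 := ih v (B ∩ Ici v) (hBm.inter measurableSet_Ici) (inter_subset_left.trans hB)
        fun t ht => ⟨ht.2, by
          have := (hBu ht.1).2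
          rw [pow_succ] at this
          linarith⟩
      have hB' : B = B ∩ Iio v ∪ B ∩ Ici v := by
        rw [← inter_union_distrib_left, Iio_union_Ici, inter_univ]
      have hdisj : Disjoint (B ∩ Iio v) (B ∩ Ici v) :=
        (Iio_disjoint_Ici le_rfl).mono inter_subset_right inter_subset_right
      have hdisj' : Disjoint (c '' (B ∩ Iio v)) (c '' (B ∩ Ici v)) := by
        rw [disjoint_iff_inter_eq_empty, ← (hM.injOn hc).image_inter (inter_subset_left.trans hB)
          (inter_subset_left.trans hB), disjoint_iff_inter_eq_empty.1 hdisj, image_empty]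
      have hm : MeasurableSet (c '' (B ∩ Ici v)) :=
        (hBm.inter measurableSet_Ici).image_of_continuousOn_injOn hcont.continuousOn
          ((hM.injOn hc).mono (inter_subset_left.trans hB))
      rw [hB', image_union, measure_union hdisj' hm,
        measure_union hdisj (hBm.inter measurableSet_Ici), mul_add]
      exact add_le_add h1 h2
  obtain ⟨k, hk⟩ := pow_unbounded_of_one_lt (2 * τ / η) (one_lt_two : (1 : ℝ) < 2)
  rw [div_lt_iff₀ hη0] at hk
  exact key k (-τ) A hAm hA fun t ht => ⟨(hA ht).1.le, by linarith [(hA ht).2]⟩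

/-- Length measure on an arc is the image of Lebesgue measure under arc-length parametrization. -/
lemma IsReachCurve.restrict_hausdorffMeasure (hM : IsReachCurve M τ)
    (hc : ∀ T, IsUnitCurve M c (-T) T) :
    (μH[1]).restrict (c '' Ioo (-τ) τ) = (volume.restrict (Ioo (-τ) τ)).map c := by
  have hcont : Continuous c := (contDiff_of_forall_isUnitCurve hc).continuous
  ext B hB
  rw [Measure.restrict_apply hB, Measure.map_apply hcont.measurable hB,
    Measure.restrict_apply (hcont.measurable hB), inter_comm, ← image_inter_preimage,
    hM.hausdorffMeasure_image hc inter_subset_left (measurableSet_Ioo.inter (hcont.measurable hB)),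
    inter_comm]

end

/-! ### The kernels -/

lemma bump_eq (t : ℝ) : bump t = expNegInvGlue (1 - t ^ 2) := by
  have h : |t| < 1 ↔ 0 < 1 - t ^ 2 := by rw [sub_pos, sq_lt_one_iff_abs_lt_one]
  unfold bump expNegInvGlue
  by_cases ht : |t| < 1
  · rw [if_pos ht, if_neg (not_le.2 (h.1 ht)), neg_div, one_div]
  · rw [if_neg ht, if_pos (not_lt.1 (mt h.2 ht))]

lemma contDiff_bump : ContDiff ℝ ∞ bump := by
  have : bump = fun t => expNegInvGlue (1 - t ^ 2) := funext bump_eq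
  rw [this]
  exact expNegInvGlue.contDiff.comp (by fun_prop)

lemma bump_eq_zero {t : ℝ} (ht : 1 ≤ |t|) : bump t = 0 := if_neg (not_lt.2 ht)

lemma hasCompactSupport_of_abs {g : ℝ → ℝ} (hg : ∀ t, 1 ≤ |t| → g t = 0) : HasCompactSupport g := by
  refine HasCompactSupport.intro (isCompact_Icc (a := (-1 : ℝ)) (b := 1)) fun t ht => hg t ?_
  by_contra! h
  exact ht ⟨(abs_lt.1 h).1.le, (abs_lt.1 h).2.le⟩

lemma integral_bump_pos : 0 < ∫ u : ℝ, bump u := by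
  refine contDiff_bump.continuous.integral_pos_of_hasCompactSupport_nonneg_nonzero
    (hasCompactSupport_of_abs fun t => bump_eq_zero) (fun t => ?_) (x := 0) ?_
  · rw [bump_eq]; exact expNegInvGlue.nonneg _
  · rw [bump_eq]; exact (expNegInvGlue.pos_of_pos (by norm_num)).ne'

lemma kernel_add_two (l : ℕ) (t : ℝ) :
    kernel (l + 2) t = 2 * (2 : ℝ) ^ (1 / ((l + 1 : ℕ) : ℝ)) *
      kernel (l + 1) ((2 : ℝ) ^ (1 / ((l + 1 : ℕ) : ℝ)) * t) - kernel (l + 1) t := by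
  rw [kernel, Real.rpow_add two_pos, Real.rpow_one]

lemma one_le_scale (l : ℕ) : 1 ≤ (2 : ℝ) ^ (1 / ((l + 1 : ℕ) : ℝ)) :=
  Real.one_le_rpow one_le_two (by positivity)

lemma contDiff_kernel (l : ℕ) : ContDiff ℝ ∞ (kernel (l + 1)) := by
  induction l with
  | zero =>
    have : kernel (0 + 1) = fun t => (∫ u : ℝ, bump u)⁻¹ * bump t := by ext t; rw [zero_add, kernel]
    rw [this]
    exact contDiff_const.mul contDiff_bump
  | succ l ih =>
    rw [show kernel (l + 1 + 1) = _ from funext (kernel_add_two l)]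
    exact (contDiff_const.mul (ih.comp (by fun_prop))).sub ih

lemma kernel_neg (l : ℕ) (t : ℝ) : kernel (l + 1) (-t) = kernel (l + 1) t := by
  induction l generalizing t with
  | zero => rw [zero_add, kernel, kernel, bump_eq, bump_eq, neg_sq]
  | succ l ih => rw [kernel_add_two, kernel_add_two, mul_neg, ih, ih]

lemma kernel_eq_zero (l : ℕ) {t : ℝ} (ht : 1 ≤ |t|) : kernel (l + 1) t = 0 := by
  induction l generalizing t with
  | zero => rw [zero_add, kernel, bump_eq_zero ht, mul_zero]
  | succ l ih =>
    rw [kernel_add_two, ih ht, ih, mul_zero, sub_zero]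
    rw [abs_mul, abs_of_nonneg (zero_le_one.trans (one_le_scale l))]
    exact one_le_mul_of_one_le_of_one_le (one_le_scale l) ht

lemma integrable_pow_mul_kernel (j l : ℕ) : Integrable fun t => t ^ j * kernel (l + 1) t :=
  ((continuous_pow j).mul (contDiff_kernel l).continuous).integrable_of_hasCompactSupport
    (hasCompactSupport_of_abs fun t ht => by rw [Pi.mul_apply, kernel_eq_zero l ht, mul_zero])

/-- Rescaling multiplies the `j`-th moment by `2 * 2^(-j / (l + 1)) - 1`. The factor is `1` for `j =
0` and `0` for `j = l + 1`: each recursion step keeps the mass, keeps vanishing moments, and kills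
one more. -/
lemma integral_pow_mul_kernel_succ (j l : ℕ) :
    ∫ t, t ^ j * kernel (l + 2) t =
      (2 * (((2 : ℝ) ^ (1 / ((l + 1 : ℕ) : ℝ))) ^ j)⁻¹ - 1) * ∫ t, t ^ j * kernel (l + 1) t := by
  set B := (2 : ℝ) ^ (1 / ((l + 1 : ℕ) : ℝ)) with hB
  have hBpos : 0 < B := zero_lt_one.trans_le (one_le_scale l)
  have h1 : ∀ t, t ^ j * kernel (l + 2) t =
      2 * B * (B ^ j)⁻¹ * ((B * t) ^ j * kernel (l + 1) (B * t)) - t ^ j * kernel (l + 1) t := by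
    intro t
    rw [kernel_add_two, ← hB, mul_pow]
    field_simp
  have h2 := (integrable_pow_mul_kernel j l).comp_mul_left' hBpos.ne'
  simp_rw [h1]
  rw [integral_sub (h2.const_mul _) (integrable_pow_mul_kernel j l), integral_const_mul,
    Measure.integral_comp_mul_left (fun u => u ^ j * kernel (l + 1) u) B,
    abs_of_pos (inv_pos.2 hBpos), smul_eq_mul]
  field_simp

lemma integral_kernel (l : ℕ) : ∫ t, kernel (l + 1) t = 1 := by
  induction l with
  | zero =>
    have : ∀ t, kernel (0 + 1) t = (∫ u : ℝ, bump u)⁻¹ * bump t := fun t => by rw [zero_add, kernel]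
    simp_rw [this]
    rw [integral_const_mul, inv_mul_cancel₀ integral_bump_pos.ne']
  | succ l ih =>
    have := integral_pow_mul_kernel_succ 0 l
    simp only [pow_zero, one_mul, inv_one, mul_one] at this
    rw [this, ih]; norm_num

/-- The kernel `K^{(ℓ)}` has vanishing moments of orders `1, …, ℓ - 1`. -/
lemma integral_pow_mul_kernel (l : ℕ) {j : ℕ} (hj : 1 ≤ j) (hjl : j ≤ l) :
    ∫ t, t ^ j * kernel (l + 1) t = 0 := by
  induction l with
  | zero => omega
  | succ l ih =>
    rw [integral_pow_mul_kernel_succ]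
    rcases hjl.lt_or_eq with h | rfl
    · rw [ih (by omega), mul_zero]
    · rw [← Real.rpow_natCast, ← Real.rpow_mul zero_le_two, one_div,
        inv_mul_cancel₀ (by positivity), Real.rpow_one]
      norm_num

lemma exists_kernel_bounds (l : ℕ) : ∃ B > 0, (∀ t, |kernel (l + 1) t| ≤ B) ∧
    ∀ s t, |kernel (l + 1) s - kernel (l + 1) t| ≤ B * |s - t| := by
  have hcs := hasCompactSupport_of_abs fun t ht => kernel_eq_zero l (t := t) ht
  obtain ⟨B₁, hB₁⟩ := (contDiff_kernel l).continuous.bounded_above_of_compact_support hcs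
  obtain ⟨B₂, hB₂⟩ := (contDiff_kernel l).lipschitzWith_of_hasCompactSupport hcs (by simp)
  refine ⟨max (max B₁ B₂) 1, by positivity, fun t => ?_, fun s t => ?_⟩
  · exact (hB₁ t).trans ((le_max_left _ _).trans (le_max_left _ _))
  · have := hB₂.dist_le_mul s t
    rw [Real.dist_eq, Real.dist_eq] at this
    refine this.trans ?_
    gcongr
    exact (le_max_right _ _).trans (le_max_left _ _)

/-! ### Measurability of the estimator -/

lemma measurable_vertex {D n : ℕ} (x : Ambient D) (o : Option (Fin n)) :
    Measurable fun X : Fin n → Ambient D => vertex x X o := by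
  cases o with
  | none => exact measurable_const
  | some i => exact measurable_pi_apply i

/-- A countable infimum over paths; each contributes a finite sum of distances on the measurable set
where its hops are admissible, and `⊤` elsewhere. -/
lemma measurable_isomapDist {D n : ℕ} (ε : ℝ) (x : Ambient D) (i : Fin n) :
    Measurable fun X : Fin n → Ambient D => isomapDist ε x X i := by
  classical
  refine Measurable.iInf fun m => Measurable.iInf fun s => ?_
  set S : Set (Fin n → Ambient D) := {X | s 0 = none ∧ s (Fin.last m) = some i ∧
    ∀ j : Fin m, dist (vertex x X (s j.castSucc)) (vertex x X (s j.succ)) ≤ ε} with hS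
  have hSm : MeasurableSet S := by
    have : S = {X | s 0 = none} ∩ ({X | s (Fin.last m) = some i} ∩
        ⋂ j : Fin m, {X | dist (vertex x X (s j.castSucc)) (vertex x X (s j.succ)) ≤ ε}) := by
      ext X; simp [hS]
    rw [this]
    refine (MeasurableSet.const _).inter ((MeasurableSet.const _).inter ?_)
    exact MeasurableSet.iInter fun j => measurableSet_le
      ((measurable_vertex x _).dist (measurable_vertex x _)) measurable_const
  have hsum : Measurable fun X : Fin n → Ambient D =>
      ∑ j : Fin m, edist (vertex x X (s j.castSucc)) (vertex x X (s j.succ)) :=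
    Finset.measurable_fun_sum _ fun j _ => (measurable_vertex x _).edist (measurable_vertex x _)
  have heq : (fun X : Fin n → Ambient D => ⨅ (_ : s 0 = none ∧ s (Fin.last m) = some i ∧
      ∀ j : Fin m, dist (vertex x X (s j.castSucc)) (vertex x X (s j.succ)) ≤ ε),
      ∑ j : Fin m, edist (vertex x X (s j.castSucc)) (vertex x X (s j.succ))) =
      fun X => if X ∈ S then
        ∑ j : Fin m, edist (vertex x X (s j.castSucc)) (vertex x X (s j.succ)) else ⊤ :=
    funext fun X => iInf_eq_if _
  rw [heq]
  exact Measurable.ite hSm hsum measurable_const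

lemma measurable_isomapKernelEstimator {D n : ℕ} (l : ℕ) (h ε : ℝ) (x : Ambient D) :
    Measurable fun X : Fin n → Ambient D => isomapKernelEstimator (l + 1) h ε x X := by
  refine measurable_const.mul (Finset.measurable_fun_sum _ fun i _ => ?_)
  have hd := measurable_isomapDist ε x i
  refine Measurable.ite (hd (measurableSet_singleton ⊤)) measurable_const ?_
  exact (contDiff_kernel l).continuous.measurable.comp (hd.ennreal_toReal.div_const h)

section

variable {D n : ℕ} {M : Set (Ambient D)} {c : ℝ → Ambient D} {τ ε h η : ℝ}
  {X : Fin n → Ambient D}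

/-! ### Isomap distances along a curve -/

/-- A chain of short steps in `M` moves along the curve by little more than its length. -/
lemma IsReachCurve.exists_param_of_chain (hM : IsReachCurve M τ)
    (hc : ∀ T, IsUnitCurve M c (-T) T) (hετ : ε ≤ τ / 8) {u : ℕ → Ambient D}
    (hu0 : u 0 = c 0) (m : ℕ) (hu : ∀ k ≤ m, u k ∈ M) (hd : ∀ k < m, dist (u k) (u (k + 1)) ≤ ε) :
    ∃ t, c t = u m ∧ |t| ≤ (1 + ε ^ 2 / τ ^ 2) * ∑ k ∈ Finset.range m, dist (u k) (u (k + 1)) := by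
  have hτ := hM.pos
  induction m with
  | zero => exact ⟨0, hu0.symm, by simp⟩
  | succ m ih =>
    obtain ⟨t, hct, ht⟩ := ih (fun k hk => hu k (by omega)) fun k hk => hd k (by omega)
    have hedge := hd m (by omega)
    have hnorm : ‖u (m + 1) - c t‖ = dist (u m) (u (m + 1)) := by
      rw [hct, dist_comm, dist_eq_norm]
    -- A hop of length at most `τ / 8` stays within `5 / 12 * (τ / 2)`, so it lands on the arc
    -- around the current time.
    obtain ⟨s, hs, hcs, hst⟩ := (hc (|t| + τ)).exists_eq_of_norm_lt hM (r := τ / 2) (t₀ := t)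
      (by linarith) (by linarith) (by linarith [neg_abs_le t]) (by linarith [le_abs_self t])
      (hu (m + 1) le_rfl) (by rw [hnorm]; linarith)
    have hI : ∀ v, |v - t| < τ → v ∈ Ioo (-(|t| + τ)) (|t| + τ) := fun v hv => by
      rw [abs_lt] at hv
      exact ⟨by linarith [neg_abs_le t], by linarith [le_abs_self t]⟩
    have hchord := (hc (|t| + τ)).le_chord hM (hI t (by simpa using hτ)) (hI s (by linarith))
    rw [hcs, hnorm] at hchord
    rw [hnorm] at hst
    set E := dist (u m) (u (m + 1)) with hE
    have hE0 : 0 ≤ E := dist_nonneg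
    set y := ε ^ 2 / τ ^ 2 with hy
    have hy0 : 0 ≤ y := by positivity
    have hε0 : 0 ≤ ε := hE0.trans hedge
    have hy1 : y ≤ 1 := by
      rw [hy, div_le_one (by positivity)]
      exact pow_le_pow_left₀ hε0 (by linarith) 2
    -- The constant is `(6 / 5)² / 6`. The inverse of `1 - 6 / 25 * y` is then at most `1 + y` for
    -- `y ≤ 1`.
    have hq : (s - t) ^ 2 / (6 * τ ^ 2) ≤ 6 / 25 * y := by
      have h1 : (s - t) ^ 2 ≤ (6 / 5 * ε) ^ 2 := by
        rw [← sq_abs]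
        exact pow_le_pow_left₀ (abs_nonneg _) (hst.trans (by linarith)) 2
      calc (s - t) ^ 2 / (6 * τ ^ 2) ≤ (6 / 5 * ε) ^ 2 / (6 * τ ^ 2) := by gcongr
        _ = 6 / 25 * y := by rw [hy]; field_simp; ring
    have hstE : |s - t| ≤ (1 + y) * E := by
      have h1 : |s - t| * (1 - 6 / 25 * y) ≤ E := by
        refine le_trans ?_ hchord
        gcongr
      have h2 : 1 ≤ (1 + y) * (1 - 6 / 25 * y) := by nlinarith
      calc |s - t| ≤ |s - t| * ((1 + y) * (1 - 6 / 25 * y)) := le_mul_of_one_le_right (abs_nonneg _) h2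
        _ = (1 + y) * (|s - t| * (1 - 6 / 25 * y)) := by ring
        _ ≤ (1 + y) * E := by gcongr
    refine ⟨s, hcs, ?_⟩
    rw [Finset.sum_range_succ, mul_add]
    have : |s| ≤ |t| + |s - t| := by
      have := abs_add_le t (s - t)
      simpa using this
    linarith

lemma vertex_mem (hX : ∀ i, X i ∈ M) (h0 : c 0 ∈ M) (o : Option (Fin n)) :
    vertex (c 0) X o ∈ M := by
  cases o with
  | none => exact h0
  | some i => exact hX i

lemma IsReachCurve.exists_param_of_path (hM : IsReachCurve M τ)
    (hc : ∀ T, IsUnitCurve M c (-T) T) (hετ : ε ≤ τ / 8) (hX : ∀ i, X i ∈ M) {i : Fin n} {m : ℕ}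
    {s : Fin (m + 1) → Option (Fin n)} (hs0 : s 0 = none) (hsm : s (Fin.last m) = some i)
    (hs : ∀ j : Fin m, dist (vertex (c 0) X (s j.castSucc)) (vertex (c 0) X (s j.succ)) ≤ ε) :
    ∃ t, c t = X i ∧ ENNReal.ofReal |t| ≤ ENNReal.ofReal (1 + ε ^ 2 / τ ^ 2) *
      ∑ j : Fin m, edist (vertex (c 0) X (s j.castSucc)) (vertex (c 0) X (s j.succ)) := by
  -- `Fin.ofNat` wraps modulo `m + 1`, which is harmless as only indices up to `m` are used.
  set u : ℕ → Ambient D := fun k => vertex (c 0) X (s (Fin.ofNat (m + 1) k)) with hu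
  have hofNat : ∀ (k : ℕ) (hk : k < m + 1), Fin.ofNat (m + 1) k = ⟨k, hk⟩ := fun k hk => by
    ext; simp [Nat.mod_eq_of_lt hk]
  have hcast : ∀ j : Fin m, u j = vertex (c 0) X (s j.castSucc) := fun j => by
    rw [hu]; simp only; rw [hofNat _ (by omega)]; rfl
  have hsucc : ∀ j : Fin m, u (j + 1) = vertex (c 0) X (s j.succ) := fun j => by
    rw [hu]; simp only; rw [hofNat _ (by omega)]; rfl
  have hlast : u m = X i := by
    rw [hu]; simp only; rw [hofNat _ (by omega)]
    rw [show (⟨m, by omega⟩ : Fin (m + 1)) = Fin.last m from rfl, hsm]; rfl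
  obtain ⟨t, ht, hle⟩ := hM.exists_param_of_chain hc hετ (u := u)
    (by rw [hu]; simp only; rw [hofNat _ (by omega)]
        rw [show (⟨0, by omega⟩ : Fin (m + 1)) = 0 from rfl, hs0]; rfl) m
    (fun k _ => vertex_mem hX ((hc 1).mem 0 (by simp)) _)
    (fun k hk => by
      have := hs ⟨k, hk⟩
      rwa [← hcast, ← hsucc] at this)
  refine ⟨t, ht.trans hlast, ?_⟩
  have hsum : ∑ j : Fin m, edist (vertex (c 0) X (s j.castSucc)) (vertex (c 0) X (s j.succ)) =
      ENNReal.ofReal (∑ k ∈ Finset.range m, dist (u k) (u (k + 1))) := by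
    rw [← Fin.sum_univ_eq_sum_range (fun k => dist (u k) (u (k + 1))),
      ENNReal.ofReal_sum_of_nonneg fun _ _ => dist_nonneg]
    refine Finset.sum_congr rfl fun j _ => ?_
    rw [hcast, hsucc, edist_dist]
  rw [hsum, ← ENNReal.ofReal_mul (by positivity)]
  exact ENNReal.ofReal_le_ofReal hle

/-- Arc length is at most `1 + ε² / τ²` times the Isomap distance. -/
lemma IsReachCurve.ofReal_abs_le_isomapDist (hM : IsReachCurve M τ)
    (hc : ∀ T, IsUnitCurve M c (-T) T) (hετ : ε ≤ τ / 8) (hX : ∀ i, X i ∈ M) {i : Fin n} {t : ℝ}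
    (ht : t ∈ Ioo (-τ) τ) (hti : c t = X i) :
    ENNReal.ofReal |t| ≤ ENNReal.ofReal (1 + ε ^ 2 / τ ^ 2) * isomapDist ε (c 0) X i := by
  have h0 : ENNReal.ofReal (1 + ε ^ 2 / τ ^ 2) ≠ 0 := by
    rw [Ne, ENNReal.ofReal_eq_zero, not_le]; positivity
  rw [← ENNReal.div_le_iff' h0 ENNReal.ofReal_ne_top]
  refine le_iInf fun m => le_iInf fun s => le_iInf fun hs => ?_
  rw [ENNReal.div_le_iff' h0 ENNReal.ofReal_ne_top]
  obtain ⟨t', ht', hle⟩ := hM.exists_param_of_path hc hετ hX hs.1 hs.2.1 hs.2.2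
  refine le_trans (ENNReal.ofReal_le_ofReal ?_) hle
  -- The lifted path may have wound around a closed component. If it ends inside the injectivity
  -- interval then `t' = t`; otherwise `|t| < τ ≤ |t'|`.
  by_cases h : |t'| < τ
  · rw [hM.injOn hc ht (abs_lt.1 h) (hti.trans ht'.symm)]
  · exact (abs_lt.2 ht).le.trans (not_lt.1 h)

/-- An observation at graph distance less than `h` is reached along the curve within arc length `2
h`, as `1 + ε² / τ² ≤ 2`. Other components and folds of `M` passing close to `x` are thus never
counted. -/
lemma IsReachCurve.exists_param_of_isomapDist_lt (hM : IsReachCurve M τ)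
    (hc : ∀ T, IsUnitCurve M c (-T) T) (hε : 0 ≤ ε) (hετ : ε ≤ τ / 8) (hX : ∀ i, X i ∈ M) {i : Fin n}
    (hi : isomapDist ε (c 0) X i < ENNReal.ofReal h) : ∃ t, c t = X i ∧ |t| ≤ 2 * h := by
  have hτ := hM.pos
  simp only [isomapDist, iInf_lt_iff] at hi
  obtain ⟨m, s, hs, hlt⟩ := hi
  obtain ⟨t, ht, hle⟩ := hM.exists_param_of_path hc hετ hX hs.1 hs.2.1 hs.2.2
  refine ⟨t, ht, ?_⟩
  have hh : 0 ≤ h := by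
    by_contra! hneg
    rw [ENNReal.ofReal_of_nonpos hneg.le] at hlt
    exact not_lt_bot hlt
  have h1 : ENNReal.ofReal (1 + ε ^ 2 / τ ^ 2) ≤ ENNReal.ofReal 2 := by
    refine ENNReal.ofReal_le_ofReal ?_
    have : ε ^ 2 / τ ^ 2 ≤ 1 := by
      rw [div_le_one (by positivity)]
      exact pow_le_pow_left₀ hε (by linarith) 2
    linarith
  have h2 := hle.trans (mul_le_mul' h1 hlt.le)
  rw [← ENNReal.ofReal_mul zero_le_two] at h2
  exact (ENNReal.ofReal_le_ofReal_iff (by positivity)).1 h2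

/-- There is a path of length at most `r` from the base point to the vertex `o` in the
neighbourhood graph. -/
def IsChained (ε : ℝ) (x : Ambient D) (X : Fin n → Ambient D) (o : Option (Fin n)) (r : ℝ) : Prop :=
  ∃ (m : ℕ) (s : Fin (m + 1) → Option (Fin n)), s 0 = none ∧ s (Fin.last m) = o ∧
    (∀ j : Fin m, dist (vertex x X (s j.castSucc)) (vertex x X (s j.succ)) ≤ ε) ∧
    ∑ j : Fin m, dist (vertex x X (s j.castSucc)) (vertex x X (s j.succ)) ≤ r

lemma isChained_none (ε : ℝ) (x : Ambient D) (X : Fin n → Ambient D) : IsChained ε x X none 0 :=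
  ⟨0, fun _ => none, rfl, rfl, fun j => j.elim0, by simp⟩

lemma IsChained.step {x : Ambient D} {o o' : Option (Fin n)} {r r' : ℝ}
    (ho : IsChained ε x X o r) (hd : dist (vertex x X o) (vertex x X o') ≤ ε)
    (hr : r + dist (vertex x X o) (vertex x X o') ≤ r') : IsChained ε x X o' r' := by
  obtain ⟨m, s, hs0, hsm, hs, hsum⟩ := ho
  refine ⟨m + 1, Fin.snoc (α := fun _ => Option (Fin n)) s o', ?_, by simp, ?_, ?_⟩
  · have : (0 : Fin (m + 1 + 1)) = Fin.castSucc 0 := rfl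
    rw [this, Fin.snoc_castSucc, hs0]
  · intro j
    induction j using Fin.lastCases with
    | last => simpa [hsm] using hd
    | cast j =>
      rw [Fin.succ_castSucc, Fin.snoc_castSucc, Fin.snoc_castSucc]
      exact hs j
  · rw [Fin.sum_univ_castSucc]
    simp only [Fin.succ_castSucc, Fin.snoc_castSucc, Fin.succ_last, Fin.snoc_last, hsm]
    linarith

lemma IsChained.isomapDist_le {x : Ambient D} {i : Fin n} {r : ℝ}
    (h : IsChained ε x X (some i) r) : isomapDist ε x X i ≤ ENNReal.ofReal r := by
  obtain ⟨m, s, hs0, hsm, hs, hsum⟩ := h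
  refine le_trans ?_ (ENNReal.ofReal_le_ofReal hsum)
  rw [ENNReal.ofReal_sum_of_nonneg fun _ _ => dist_nonneg]
  simp_rw [← edist_dist]
  unfold isomapDist
  exact iInf_le_of_le m (iInf_le_of_le s (iInf_le _ ⟨hs0, hsm, hs⟩))

/-- If all cells of a grid contain data points, the graph follows the curve. -/
lemma isChained_of_grid (hc : ∀ T, IsUnitCurve M c (-T) T) (hη : 0 < η) (hηε : 2 * η ≤ ε) {H : ℝ}
    (hgrid : ∀ j : ℕ, (j + 1) * η ≤ H → ∃ i, ∃ t ∈ Ioc (j * η) ((j + 1) * η), c t = X i)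
    (k : ℕ) : ∀ (i : Fin n) (t : ℝ), 0 ≤ t → t ≤ H → t ≤ k * η → c t = X i →
      IsChained ε (c 0) X (some i) t := by
  have hdist : ∀ s t, dist (c s) (c t) ≤ |s - t| := by
    intro s t
    rw [dist_eq_norm]
    refine (hc (|s| + |t| + 1)).dist_le (abs_lt.1 ?_) (abs_lt.1 ?_) <;>
      linarith [abs_nonneg s, abs_nonneg t]
  induction k with
  | zero =>
    intro i t h0 _ hk hti
    have ht : t = 0 := le_antisymm (by simpa using hk) h0
    have hd : dist (vertex (c 0) X none) (vertex (c 0) X (some i)) = 0 := by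
      simp [vertex, ← hti, ht]
    exact (isChained_none ε (c 0) X).step (by rw [hd]; linarith) (by rw [hd]; linarith)
  | succ k ih =>
    intro i t h0 hH hk hti
    push_cast at hk
    by_cases hle : t ≤ k * η
    · exact ih i t h0 hH hle hti
    rw [not_le] at hle
    rcases Nat.eq_zero_or_pos k with rfl | hkpos
    · have hd : dist (vertex (c 0) X none) (vertex (c 0) X (some i)) ≤ t := by
        have := hdist 0 t
        simpa [vertex, ← hti, abs_of_nonneg h0] using this
      simp only [CharP.cast_eq_zero, zero_add, one_mul] at hk
      exact (isChained_none ε (c 0) X).step (by linarith) (by linarith)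
    · obtain ⟨j, rfl⟩ : ∃ j, k = j + 1 := ⟨k - 1, by omega⟩
      push_cast at hk hle ih
      -- Hop back to an observation in the preceding cell: the gap is less than `2 η ≤ ε`, and since
      -- the times increase along the chain the chords add up to at most `t`.
      obtain ⟨i', t', ht', hti'⟩ := hgrid j (by linarith)
      have hj : (0 : ℝ) ≤ j * η := by positivity
      have hch := ih i' t' (by linarith [ht'.1]) (by linarith [ht'.2]) ht'.2 hti'
      have hd : dist (vertex (c 0) X (some i')) (vertex (c 0) X (some i)) ≤ t - t' := by
        have := hdist t' t
        rw [abs_of_nonpos (by linarith [ht'.2])] at this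
        simp only [vertex, ← hti, ← hti']
        linarith
      exact hch.step (by linarith [ht'.1]) (by linarith)

/-- The ideal kernel weight of `y`: the kernel evaluated at the arc-length coordinate of `y`. -/
def arcKernel (l : ℕ) (h τ : ℝ) (c : ℝ → Ambient D) : Ambient D → ℝ :=
  Function.extend ((Ioo (-τ) τ).domRestrict c) (fun t => kernel (l + 1) (t / h)) 0

lemma arcKernel_apply (l : ℕ) (hinj : InjOn c (Ioo (-τ) τ)) {t : ℝ} (ht : t ∈ Ioo (-τ) τ) :
    arcKernel l h τ c (c t) = kernel (l + 1) (t / h) :=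
  (injOn_iff_injective.1 hinj).extend_apply (fun t : Ioo (-τ) τ => kernel (l + 1) ((t : ℝ) / h)) 0
    ⟨t, ht⟩

lemma arcKernel_of_notMem (l : ℕ) {y : Ambient D} (hy : y ∉ c '' Ioo (-τ) τ) :
    arcKernel l h τ c y = 0 := by
  refine Function.extend_apply' _ _ _ ?_
  rintro ⟨t, rfl⟩
  exact hy ⟨t, t.2, rfl⟩

/-- The kernel weight in the Isomap distance is close to the ideal one if the grid cells on both
sides of the base point contain data. -/
lemma IsReachCurve.abs_weight_sub_arcKernel_le (hM : IsReachCurve M τ)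
    (hc : ∀ T, IsUnitCurve M c (-T) T) (hη : 0 < η) (hηε : 2 * η ≤ ε) (hετ : ε ≤ τ / 8)
    (hh : 0 < h) (hhτ : 2 * h < τ) (hX : ∀ i, X i ∈ M)
    (hgrid : ∀ j : ℕ, (j + 1) * η ≤ 2 * h → ∃ i, ∃ t ∈ Ioc (j * η) ((j + 1) * η), c t = X i)
    (hgrid' : ∀ j : ℕ, (j + 1) * η ≤ 2 * h → ∃ i, ∃ t ∈ Ioc (j * η) ((j + 1) * η), c (-t) = X i)
    (l : ℕ) {B : ℝ} (hB : 0 ≤ B)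
    (hBlip : ∀ s t, |kernel (l + 1) s - kernel (l + 1) t| ≤ B * |s - t|) (i : Fin n) :
    |(if isomapDist ε (c 0) X i = ⊤ then 0 else kernel (l + 1) ((isomapDist ε (c 0) X i).toReal / h))
      - arcKernel l h τ c (X i)| ≤ 2 * B * (ε ^ 2 / τ ^ 2) := by
  have hτ := hM.pos
  have hε : 0 ≤ ε := by linarith
  set d := isomapDist ε (c 0) X i with hd
  have hbound : 0 ≤ 2 * B * (ε ^ 2 / τ ^ 2) := by positivity
  -- Within arc length `2 h` the grid gives a chain and the two distances are compared. Beyond it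
  -- both weights vanish, as graph distance below `h` would imply arc length at most `2 h`.
  by_cases hin : ∃ t, |t| ≤ 2 * h ∧ c t = X i
  · obtain ⟨t, ht, hti⟩ := hin
    have htI : t ∈ Ioo (-τ) τ := abs_lt.1 (ht.trans_lt hhτ)
    have hup : d ≤ ENNReal.ofReal |t| := by
      rcases le_total 0 t with h0 | h0
      · obtain ⟨k, hk⟩ := exists_nat_ge (t / η)
        rw [div_le_iff₀ hη] at hk
        rw [abs_of_nonneg h0] at ht ⊢
        exact (isChained_of_grid hc hη hηε hgrid k i t h0 ht hk hti).isomapDist_le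
      · obtain ⟨k, hk⟩ := exists_nat_ge (-t / η)
        rw [div_le_iff₀ hη] at hk
        rw [abs_of_nonpos h0] at ht ⊢
        have hc' : ∀ T, IsUnitCurve M (fun t => c (-t)) (-T) T := fun T => by
          simpa using (hc T).reverse
        have := isChained_of_grid hc' hη hηε hgrid' k i (-t) (by linarith) ht hk (by simpa using hti)
        simp only [neg_zero] at this
        exact this.isomapDist_le
    have hne : d ≠ ⊤ := ne_top_of_le_ne_top ENNReal.ofReal_ne_top hup
    rw [if_neg hne, ← hti, arcKernel_apply l (hM.injOn hc) htI]
    have hup' : d.toReal ≤ |t| := by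
      have := ENNReal.toReal_mono ENNReal.ofReal_ne_top hup
      rwa [ENNReal.toReal_ofReal (abs_nonneg t)] at this
    have hlow : |t| ≤ (1 + ε ^ 2 / τ ^ 2) * d.toReal := by
      have := ENNReal.toReal_mono (ENNReal.mul_ne_top ENNReal.ofReal_ne_top hne)
        (hM.ofReal_abs_le_isomapDist hc hετ hX htI hti)
      rwa [ENNReal.toReal_ofReal (abs_nonneg t), ENNReal.toReal_mul,
        ENNReal.toReal_ofReal (by positivity)] at this
    have hK : kernel (l + 1) (t / h) = kernel (l + 1) (|t| / h) := by
      rcases le_total 0 t with h0 | h0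
      · rw [abs_of_nonneg h0]
      · rw [abs_of_nonpos h0, neg_div, kernel_neg]
    rw [hK]
    refine (hBlip _ _).trans ?_
    rw [← sub_div, abs_div, abs_of_pos hh, abs_sub_comm, abs_of_nonneg (by linarith)]
    have hy : 0 ≤ ε ^ 2 / τ ^ 2 := by positivity
    have h1 : (|t| - d.toReal) / h ≤ 2 * (ε ^ 2 / τ ^ 2) := by
      rw [div_le_iff₀ hh]
      nlinarith
    calc B * ((|t| - d.toReal) / h) ≤ B * (2 * (ε ^ 2 / τ ^ 2)) := by gcongr
      _ = _ := by ring
  · have hzero : arcKernel l h τ c (X i) = 0 := by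
      by_cases hmem : X i ∈ c '' Ioo (-τ) τ
      · obtain ⟨t, ht, hti⟩ := hmem
        rw [← hti, arcKernel_apply l (hM.injOn hc) ht]
        refine kernel_eq_zero l ?_
        have : 2 * h < |t| := by
          by_contra! hle
          exact hin ⟨t, hle, hti⟩
        rw [abs_div, abs_of_pos hh, le_div_iff₀ hh]
        linarith
      · exact arcKernel_of_notMem l hmem
    have hzero' : (if d = ⊤ then 0 else kernel (l + 1) (d.toReal / h)) = 0 := by
      split_ifs with hne
      · rfl
      · refine kernel_eq_zero l ?_
        rw [abs_of_nonneg (by positivity), le_div_iff₀ hh, one_mul]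
        by_contra! hlt
        have : d < ENNReal.ofReal h := by
          rw [← ENNReal.ofReal_toReal hne]
          exact (ENNReal.ofReal_lt_ofReal_iff hh).2 hlt
        obtain ⟨t, hti, ht⟩ := hM.exists_param_of_isomapDist_lt hc hε hετ hX this
        exact hin ⟨t, ht, hti⟩
    rw [hzero, hzero', sub_zero, abs_zero]
    exact hbound

end

/-! ### Bias -/

lemma natCeil_sub_one_lt {β : ℝ} (hβ : 0 < β) : ((⌈β - 1⌉₊ : ℕ) : ℝ) < β := by
  rcases le_or_gt 1 β with h | h
  · have := Nat.ceil_lt_add_one (sub_nonneg.2 h)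
    linarith
  · rw [Nat.ceil_eq_zero.2 (by linarith)]
    simpa using hβ

/-- Taylor expansion of a function with Hölder continuous `k`-th derivative. -/
lemma abs_sub_taylor_le {g : ℝ → ℝ} {k : ℕ} {β R τ t : ℝ} (hkβ : (k : ℝ) < β) (hR : 0 ≤ R)
    (hg : ContDiffOn ℝ k g (Ioo (-τ) τ))
    (hhol : ∀ s ∈ Ioo (-τ) τ, ∀ t ∈ Ioo (-τ) τ,
      |iteratedDeriv k g s - iteratedDeriv k g t| ≤ R * |s - t| ^ (β - (k : ℝ)))
    (ht : t ∈ Ioo (-τ) τ) :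
    |g t - ∑ j ∈ Finset.range (k + 1), iteratedDeriv j g 0 / (j.factorial : ℝ) * t ^ j| ≤
      R * |t| ^ β := by
  have hτ : 0 < τ := by linarith [ht.1, ht.2]
  have h0 : (0 : ℝ) ∈ Ioo (-τ) τ := by simp [hτ]
  rcases eq_or_ne t 0 with rfl | htne
  · have : ∑ j ∈ Finset.range (k + 1), iteratedDeriv j g 0 / (j.factorial : ℝ) * (0 : ℝ) ^ j = g 0 := by
      rw [Finset.sum_range_succ', Finset.sum_eq_zero fun j _ => by simp]
      simp
    rw [this, sub_self, abs_zero]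
    positivity
  have htpos : 0 < |t| := abs_pos.2 htne
  cases k with
  | zero =>
    have := hhol t ht 0 h0
    simpa using this
  | succ m =>
    have hsub : uIcc 0 t ⊆ Ioo (-τ) τ := fun s hs => by
      rcases le_total 0 t with h | h
      · rw [uIcc_of_le h] at hs; exact ⟨by linarith [hs.1], by linarith [hs.2, ht.2]⟩
      · rw [uIcc_of_ge h] at hs; exact ⟨by linarith [hs.1, ht.1], by linarith [hs.2]⟩
    obtain ⟨ξ, hξ, hrem⟩ := taylor_mean_remainder_lagrange_iteratedDeriv (f := g) (n := m)
      (Ne.symm htne) (by exact_mod_cast hg.mono hsub)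
    have hξ' : ξ ∈ uIcc 0 t := Ioo_subset_Icc_self hξ
    have hcoef : taylorWithinEval g m (uIcc 0 t) 0 t =
        ∑ j ∈ Finset.range (m + 1), iteratedDeriv j g 0 / (j.factorial : ℝ) * t ^ j := by
      rw [taylor_within_apply]
      refine Finset.sum_congr rfl fun j hj => ?_
      have hjm : j ≤ m + 1 := by have := Finset.mem_range.1 hj; omega
      rw [iteratedDerivWithin_eq_iteratedDeriv (uniqueDiffOn_uIcc (Ne.symm htne))
        ((hg.contDiffAt (isOpen_Ioo.mem_nhds h0)).of_le (by exact_mod_cast hjm)) left_mem_uIcc,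
        sub_zero, smul_eq_mul]
      ring
    -- The Lagrange remainder minus the last Taylor term involves only an increment of the top
    -- derivative, to which the Hölder bound applies.
    have heq : g t - ∑ j ∈ Finset.range (m + 1 + 1), iteratedDeriv j g 0 / (j.factorial : ℝ) * t ^ j
        = (iteratedDeriv (m + 1) g ξ - iteratedDeriv (m + 1) g 0) * t ^ (m + 1) /
          ((m + 1).factorial : ℝ) := by
      rw [Finset.sum_range_succ, ← hcoef, ← sub_sub, hrem, sub_zero]
      ring
    rw [heq, abs_div, abs_mul, abs_pow, Nat.abs_cast]
    have h1 := hhol ξ (hsub hξ') 0 h0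
    rw [sub_zero] at h1
    have h2 : |ξ| ≤ |t| := by
      have := abs_sub_left_of_mem_uIcc hξ'
      simpa using this
    have h3 : |ξ| ^ (β - ((m + 1 : ℕ) : ℝ)) ≤ |t| ^ (β - ((m + 1 : ℕ) : ℝ)) :=
      Real.rpow_le_rpow (abs_nonneg _) h2 (by linarith)
    have h4 : |t| ^ (β - ((m + 1 : ℕ) : ℝ)) * |t| ^ (m + 1) = |t| ^ β := by
      rw [← Real.rpow_natCast, ← Real.rpow_add htpos]; congr 1; ring
    calc |iteratedDeriv (m + 1) g ξ - iteratedDeriv (m + 1) g 0| * |t| ^ (m + 1) /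
          ((m + 1).factorial : ℝ)
        ≤ |iteratedDeriv (m + 1) g ξ - iteratedDeriv (m + 1) g 0| * |t| ^ (m + 1) :=
          div_le_self (by positivity) (by exact_mod_cast Nat.succ_le_of_lt (Nat.factorial_pos _))
      _ ≤ R * |t| ^ (β - ((m + 1 : ℕ) : ℝ)) * |t| ^ (m + 1) := by
          gcongr
          exact h1.trans (by gcongr)
      _ = R * |t| ^ β := by rw [mul_assoc, h4]

lemma integral_pow_mul_kernel_div (j l : ℕ) {h : ℝ} (hh : 0 < h) :
    ∫ t, t ^ j * kernel (l + 1) (t / h) = h ^ (j + 1) * ∫ t, t ^ j * kernel (l + 1) t := by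
  have h1 : ∀ t, t ^ j * kernel (l + 1) (t / h) =
      h ^ j * ((t / h) ^ j * kernel (l + 1) (t / h)) := fun t => by
    rw [div_pow]; field_simp
  simp_rw [h1]
  rw [integral_const_mul, Measure.integral_comp_div (fun u => u ^ j * kernel (l + 1) u) h,
    abs_of_pos hh, smul_eq_mul]
  ring

lemma kernel_div_eq_zero (l : ℕ) {h t : ℝ} (hh : 0 < h) (ht : t ∉ Icc (-h) h) :
    kernel (l + 1) (t / h) = 0 := by
  refine kernel_eq_zero l ?_
  rw [abs_div, abs_of_pos hh, le_div_iff₀ hh, one_mul]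
  by_contra! hlt
  exact ht ⟨(abs_lt.1 hlt).1.le, (abs_lt.1 hlt).2.le⟩

/-- A bound for integrals against the rescaled kernel. -/
lemma abs_integral_kernel_mul_le (l : ℕ) {h τ B A : ℝ} (hh : 0 < h)
    (hB : ∀ t, |kernel (l + 1) t| ≤ B) {r : ℝ → ℝ} (hA : 0 ≤ A)
    (hr : ∀ t ∈ Ioo (-τ) τ, |t| ≤ h → |r t| ≤ A) :
    |∫ t in Ioo (-τ) τ, r t * kernel (l + 1) (t / h)| ≤ 2 * h * (A * B) := by
  have hB0 : 0 ≤ B := (abs_nonneg _).trans (hB 0)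
  have h1 : ∫ t in Ioo (-τ) τ, r t * kernel (l + 1) (t / h) =
      ∫ t in Icc (-h) h, (Ioo (-τ) τ).indicator (fun t => r t * kernel (l + 1) (t / h)) t := by
    rw [← integral_indicator measurableSet_Ioo]
    refine (setIntegral_eq_integral_of_forall_compl_eq_zero fun t ht => ?_).symm
    rw [indicator_apply, kernel_div_eq_zero l hh ht, mul_zero, ite_self]
  rw [h1]
  have h2 := norm_setIntegral_le_of_norm_le_const (μ := volume) (s := Icc (-h) h) (C := A * B)
    (f := (Ioo (-τ) τ).indicator fun t => r t * kernel (l + 1) (t / h)) (by simp) ?_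
  · rw [Real.norm_eq_abs] at h2
    refine h2.trans (le_of_eq ?_)
    rw [Measure.real, Real.volume_Icc, ENNReal.toReal_ofReal (by linarith)]
    ring
  · intro t ht
    rw [indicator_apply]
    split_ifs with htI
    · rw [Real.norm_eq_abs, abs_mul]
      exact mul_le_mul (hr t htI (abs_le.2 ht)) (hB _) (abs_nonneg _) hA
    · simp; positivity

/-- The kernel estimator has bias of order `h ^ β` for `β`-Hölder densities. -/
lemma abs_bias_le (l : ℕ) {β R F τ h B : ℝ} (hβl : β ≤ l + 1) (hβ0 : 0 ≤ β) (hR : 0 ≤ R)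
    (hh : 0 < h) (hhτ : h < τ) (hB : ∀ t, |kernel (l + 1) t| ≤ B) {g : ℝ → ℝ} (hgm : Measurable g)
    (hgF : ∀ t ∈ Ioo (-τ) τ, |g t| ≤ F)
    (hg : 0 < β → ContDiffOn ℝ (⌈β - 1⌉₊ : ℕ) g (Ioo (-τ) τ) ∧
      ∀ s ∈ Ioo (-τ) τ, ∀ t ∈ Ioo (-τ) τ,
        |iteratedDeriv ⌈β - 1⌉₊ g s - iteratedDeriv ⌈β - 1⌉₊ g t| ≤
          R * |s - t| ^ (β - (⌈β - 1⌉₊ : ℝ))) :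
    |1 / h * (∫ t in Ioo (-τ) τ, g t * kernel (l + 1) (t / h)) - g 0| ≤
      (2 * B * R + (2 * B + 1) * F) * h ^ β := by
  have hτ : 0 < τ := hh.trans hhτ
  have h0 : (0 : ℝ) ∈ Ioo (-τ) τ := by simp [hτ]
  have hB0 : 0 ≤ B := (abs_nonneg _).trans (hB 0)
  have hF0 : 0 ≤ F := (abs_nonneg _).trans (hgF 0 h0)
  -- For `β = 0` there is no smoothness and `h ^ β = 1`; the boundedness of `g` gives the term `(2 B
  -- + 1) F`.
  rcases hβ0.eq_or_lt with rfl | hβ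
  · rw [Real.rpow_zero, mul_one]
    have h1 := abs_integral_kernel_mul_le l hh hB hF0 (r := g) (τ := τ) fun t ht _ => hgF t ht
    have h2 : |1 / h * ∫ t in Ioo (-τ) τ, g t * kernel (l + 1) (t / h)| ≤ 2 * (F * B) := by
      rw [abs_mul, abs_of_pos (by positivity : 0 < 1 / h), one_div_mul_eq_div, div_le_iff₀ hh]
      linarith
    have h3 := abs_sub (1 / h * ∫ t in Ioo (-τ) τ, g t * kernel (l + 1) (t / h)) (g 0)
    have h4 := hgF 0 h0
    nlinarith [mul_nonneg hB0 hR]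
  set k := ⌈β - 1⌉₊ with hk
  have hkl : k ≤ l := Nat.ceil_le.2 (by linarith)
  obtain ⟨hg1, hg2⟩ := hg hβ
  set p : ℝ → ℝ := fun t => ∑ j ∈ Finset.range (k + 1),
    iteratedDeriv j g 0 / (j.factorial : ℝ) * t ^ j with hp
  have htaylor : ∀ t ∈ Ioo (-τ) τ, |g t - p t| ≤ R * |t| ^ β := fun t ht =>
    abs_sub_taylor_le (natCeil_sub_one_lt hβ) hR hg1 hg2 ht
  have hKc : Continuous fun t => kernel (l + 1) (t / h) :=
    (contDiff_kernel l).continuous.comp (by fun_prop)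
  have hpc : Continuous p := by fun_prop
  have hintp : IntegrableOn (fun t => p t * kernel (l + 1) (t / h)) (Ioo (-τ) τ) :=
    ((hpc.mul hKc).continuousOn.integrableOn_Icc (a := -τ) (b := τ)).mono_set Ioo_subset_Icc_self
  have hintg : IntegrableOn (fun t => g t * kernel (l + 1) (t / h)) (Ioo (-τ) τ) := by
    refine Measure.integrableOn_of_bounded (M := F * B) (by simp)
      (hgm.mul hKc.measurable).aestronglyMeasurable ?_
    filter_upwards [ae_restrict_mem measurableSet_Ioo] with t ht
    rw [Real.norm_eq_abs, abs_mul]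
    exact mul_le_mul (hgF t ht) (hB _) (abs_nonneg _) hF0
  -- As `k ≤ l`, the moments of orders `1` to `k` vanish and the Taylor polynomial is integrated
  -- exactly.
  have hpint : ∫ t in Ioo (-τ) τ, p t * kernel (l + 1) (t / h) = h * g 0 := by
    rw [setIntegral_eq_integral_of_forall_compl_eq_zero]
    · simp only [hp, Finset.sum_mul, mul_assoc]
      rw [integral_finsetSum]
      · simp_rw [integral_const_mul]
        rw [Finset.sum_range_succ', Finset.sum_eq_zero]
        · have := integral_pow_mul_kernel_div 0 l hh
          simp only [pow_zero, one_mul, zero_add, pow_one, integral_kernel, mul_one] at this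
          simp [this, mul_comm]
        · intro j hj
          have hj' := Finset.mem_range.1 hj
          rw [integral_pow_mul_kernel_div (j + 1) l hh,
            integral_pow_mul_kernel l (by omega) (by omega), mul_zero, mul_zero]
      · intro j _
        refine Integrable.const_mul ?_ _
        refine ((continuous_pow j).mul hKc).integrable_of_hasCompactSupport
          (HasCompactSupport.intro (isCompact_Icc (a := -h) (b := h)) fun t ht => ?_)
        simp only [Pi.mul_apply]
        rw [kernel_div_eq_zero l hh ht, mul_zero]
    · intro t ht
      rw [kernel_div_eq_zero l hh fun h' => ht ⟨by linarith [h'.1], by linarith [h'.2]⟩, mul_zero]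
  have hsplit : ∫ t in Ioo (-τ) τ, g t * kernel (l + 1) (t / h) =
      h * g 0 + ∫ t in Ioo (-τ) τ, (g t - p t) * kernel (l + 1) (t / h) := by
    simp_rw [sub_mul]
    rw [integral_sub hintg hintp, hpint]
    ring
  have hr : |∫ t in Ioo (-τ) τ, (g t - p t) * kernel (l + 1) (t / h)| ≤ 2 * h * (R * h ^ β * B) := by
    refine abs_integral_kernel_mul_le l hh hB (by positivity) fun t ht hth => ?_
    refine (htaylor t ht).trans ?_
    gcongr
  have heq : 1 / h * (h * g 0 + ∫ t in Ioo (-τ) τ, (g t - p t) * kernel (l + 1) (t / h)) - g 0 =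
      (∫ t in Ioo (-τ) τ, (g t - p t) * kernel (l + 1) (t / h)) / h := by
    field_simp; ring
  rw [hsplit, heq, abs_div, abs_of_pos hh, div_le_iff₀ hh]
  refine hr.trans ?_
  have : 0 ≤ (2 * B + 1) * F * h ^ β * h := by positivity
  nlinarith

section

variable {D n : ℕ} {c : ℝ → Ambient D} {x : Ambient D} {α β τ L fmin fmax R : ℝ}
  {P : Measure (Ambient D)} {f : Ambient D → ℝ}

/-! ### The law of one observation near the base point -/

lemma InModel.isReachCurve (hP : InModel x α β τ L fmin fmax R P f) (hτ : 0 < τ) :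
    IsReachCurve P.support τ :=
  ⟨hP.support.submanifold, hP.support.compact, hτ, hP.support.reach_ge⟩

lemma image_subset_of_forall_isUnitCurve {M : Set (Ambient D)}
    (hc : ∀ T, IsUnitCurve M c (-T) T) (A : Set ℝ) : c '' A ⊆ M := by
  rintro _ ⟨t, -, rfl⟩
  exact (hc (|t| + 1)).mem t (abs_lt.1 (by linarith))

lemma InModel.mul_volume_le (hP : InModel x α β τ L fmin fmax R P f) (hτ : 0 < τ)
    (hc : ∀ T, IsUnitCurve P.support c (-T) T) {A : Set ℝ} (hA : A ⊆ Ioo (-τ) τ)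
    (hAm : MeasurableSet A) : ENNReal.ofReal fmin * volume A ≤ P (c '' A) := by
  have hM := hP.isReachCurve hτ
  have hm : MeasurableSet (c '' A) := hAm.image_of_continuousOn_injOn
    (contDiff_of_forall_isUnitCurve hc).continuous.continuousOn ((hM.injOn hc).mono hA)
  have hsub := image_subset_of_forall_isUnitCurve hc A
  have h1 : P (c '' A) = ∫⁻ y in c '' A, ENNReal.ofReal (f y)
      ∂((Measure.hausdorffMeasure 1).restrict P.support) := by
    conv_lhs => rw [hP.density]
    rw [withDensity_apply _ hm]
  rw [h1, Measure.restrict_restrict hm, inter_eq_left.2 hsub, ← hM.hausdorffMeasure_image hc hA hAm,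
    ← setLIntegral_const]
  exact setLIntegral_mono' hm fun y hy => ENNReal.ofReal_le_ofReal (hP.lower y (hsub hy))

/-- Integration over an arc, in the arc-length coordinate. -/
lemma InModel.integral_eq (hP : InModel x α β τ L fmin fmax R P f) (hτ : 0 < τ) (hfmin : 0 < fmin)
    (hc : ∀ T, IsUnitCurve P.support c (-T) T) {G : Ambient D → ℝ} (hG : Measurable G)
    (hG0 : ∀ y ∉ c '' Ioo (-τ) τ, G y = 0) :
    ∫ y, G y ∂P = ∫ t in Ioo (-τ) τ, f (c t) * G (c t) := by
  have hM := hP.isReachCurve hτ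
  have hcont := (contDiff_of_forall_isUnitCurve hc).continuous
  have hm : MeasurableSet (c '' Ioo (-τ) τ) := measurableSet_Ioo.image_of_continuousOn_injOn
    hcont.continuousOn (hM.injOn hc)
  have hsub := image_subset_of_forall_isUnitCurve hc (Ioo (-τ) τ)
  have hrestr : P.restrict (c '' Ioo (-τ) τ) =
      ((volume.restrict (Ioo (-τ) τ)).map c).withDensity fun y => ENNReal.ofReal (f y) := by
    conv_lhs => rw [hP.density]
    rw [restrict_withDensity hm, Measure.restrict_restrict hm, inter_eq_left.2 hsub,
      hM.restrict_hausdorffMeasure hc]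
  rw [← setIntegral_eq_integral_of_forall_compl_eq_zero hG0, hrestr,
    integral_withDensity_eq_integral_toReal_smul hP.measurable.ennreal_ofReal
      (Eventually.of_forall fun _ => ENNReal.ofReal_lt_top),
    integral_map hcont.aemeasurable]
  · refine setIntegral_congr_fun measurableSet_Ioo fun t ht => ?_
    have := hP.lower (c t) (hsub ⟨t, ht, rfl⟩)
    simp only [smul_eq_mul]
    rw [ENNReal.toReal_ofReal (by linarith)]
  · exact (hP.measurable.ennreal_ofReal.ennreal_toReal.smul hG).aestronglyMeasurable

/-- A continuous injective image of an interval is a measurable embedding, so the weight extended by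
zero remains measurable on the ambient space. -/
lemma measurable_arcKernel (l : ℕ) (h : ℝ) (hc : Continuous c) (hinj : InjOn c (Ioo (-τ) τ)) :
    Measurable (arcKernel l h τ c) :=
  (hc.continuousOn.measurableEmbedding measurableSet_Ioo hinj).measurable_extend
    ((contDiff_kernel l).continuous.measurable.comp (measurable_subtype_coe.div_const h))
    measurable_const

lemma abs_arcKernel_le (l : ℕ) {h B : ℝ} (hinj : InjOn c (Ioo (-τ) τ))
    (hB : ∀ t, |kernel (l + 1) t| ≤ B) (y : Ambient D) : |arcKernel l h τ c y| ≤ B := by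
  by_cases hy : y ∈ c '' Ioo (-τ) τ
  · obtain ⟨t, ht, rfl⟩ := hy
    rw [arcKernel_apply l hinj ht]; exact hB _
  · rw [arcKernel_of_notMem l hy, abs_zero]; exact (abs_nonneg _).trans (hB 0)

/-- Bias of the ideal estimator. -/
lemma InModel.abs_bias_le (hP : InModel x α β τ L fmin fmax R P f) (hτ : 0 < τ) (hfmin : 0 < fmin)
    (hc : ∀ T, IsUnitCurve P.support c (-T) T) (hβ : 0 ≤ β) (hR : 0 ≤ R) (l : ℕ)
    (hβl : β ≤ l + 1) {h B : ℝ} (hh : 0 < h) (hhτ : h < τ) (hB : ∀ t, |kernel (l + 1) t| ≤ B) :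
    |1 / h * (∫ y, arcKernel l h τ c y ∂P) - f (c 0)| ≤
      (2 * B * R + (2 * B + 1) * fmax) * h ^ β := by
  have hM := hP.isReachCurve hτ
  have hcont := (contDiff_of_forall_isUnitCurve hc).continuous
  have hmem : ∀ t, c t ∈ P.support := fun t => (hc (|t| + 1)).mem t (abs_lt.1 (by linarith))
  rw [hP.integral_eq hτ hfmin hc (measurable_arcKernel l h hcont (hM.injOn hc))
    fun y hy => arcKernel_of_notMem l hy,
    setIntegral_congr_fun measurableSet_Ioo fun t ht =>
      show f (c t) * arcKernel l h τ c (c t) = f (c t) * kernel (l + 1) (t / h) by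
        rw [arcKernel_apply l (hM.injOn hc) ht]]
  refine ManifoldDensity.abs_bias_le l (g := fun t => f (c t)) hβl hβ hR hh hhτ hB
    (hP.measurable.comp hcont.measurable) (fun t _ => ?_) fun h0 => hM.holder_comp hc h0 hP.holder
  have h1 := hP.lower _ (hmem t)
  rw [abs_of_nonneg (by linarith)]
  exact hP.upper _ (hmem t)

/-- Second moment of the ideal kernel weight. -/
lemma InModel.integral_arcKernel_sq_le (hP : InModel x α β τ L fmin fmax R P f) (hτ : 0 < τ)
    (hfmin : 0 < fmin) (hc : ∀ T, IsUnitCurve P.support c (-T) T) (l : ℕ)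
    {h B : ℝ} (hh : 0 < h) (hB : ∀ t, |kernel (l + 1) t| ≤ B) :
    ∫ y, arcKernel l h τ c y ^ 2 ∂P ≤ 2 * fmax * B ^ 2 * h := by
  have hM := hP.isReachCurve hτ
  have hcont := (contDiff_of_forall_isUnitCurve hc).continuous
  have hmem : ∀ t, c t ∈ P.support := fun t => (hc (|t| + 1)).mem t (abs_lt.1 (by linarith))
  have hB0 : 0 ≤ B := (abs_nonneg _).trans (hB 0)
  have hfm : 0 ≤ fmax := hfmin.le.trans ((hP.lower _ (hmem 0)).trans (hP.upper _ (hmem 0)))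
  rw [hP.integral_eq hτ hfmin hc ((measurable_arcKernel l h hcont (hM.injOn hc)).pow_const 2)
    fun y hy => by rw [arcKernel_of_notMem l hy]; simp,
    setIntegral_congr_fun measurableSet_Ioo fun t ht =>
      show f (c t) * arcKernel l h τ c (c t) ^ 2 =
        f (c t) * kernel (l + 1) (t / h) * kernel (l + 1) (t / h) by
        rw [arcKernel_apply l (hM.injOn hc) ht]; ring]
  have h1 := abs_integral_kernel_mul_le l (τ := τ) hh hB (A := fmax * B) (by positivity)
    (r := fun t => f (c t) * kernel (l + 1) (t / h)) fun t _ _ => by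
      rw [abs_mul]
      have h1 := hP.lower _ (hmem t)
      rw [abs_of_nonneg (show 0 ≤ f (c t) by linarith)]
      exact mul_le_mul (hP.upper _ (hmem t)) (hB _) (abs_nonneg _) hfm
  refine (le_abs_self _).trans (h1.trans (le_of_eq ?_))
  ring

/-! ### Moments of sums of independent variables -/

lemma exp_le_one_add_add_sq {u : ℝ} (hu : |u| ≤ 1) : Real.exp u ≤ 1 + u + u ^ 2 := by
  have := (abs_le.1 (Real.abs_exp_sub_one_sub_id_le hu)).2
  linarith

/-- An exponential moment bound for normalized sums of bounded centred independent variables. -/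
lemma lintegral_exp_sum_le {E : Type*} [MeasurableSpace E] (P : Measure E) [IsProbabilityMeasure P]
    {Y : E → ℝ} (hY : Measurable Y) {b v lam : ℝ} (hb : ∀ y, |Y y| ≤ b) (hlam : |lam| * b ≤ 1)
    (hmean : ∫ y, Y y ∂P = 0) (hvar : ∫ y, Y y ^ 2 ∂P ≤ v) (n : ℕ) :
    ∫⁻ X : Fin n → E, ENNReal.ofReal (Real.exp (lam * ∑ i, Y (X i))) ∂(Measure.pi fun _ => P) ≤
      ENNReal.ofReal (Real.exp (n * (lam ^ 2 * v))) := by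
  have hlY : ∀ y, |lam * Y y| ≤ 1 := fun y => by
    rw [abs_mul]; exact (mul_le_mul_of_nonneg_left (hb y) (abs_nonneg _)).trans hlam
  have hint : Integrable (fun y => Real.exp (lam * Y y)) P := by
    refine Integrable.of_bound (hY.const_mul lam).exp.aestronglyMeasurable (Real.exp 1)
      (Eventually.of_forall fun y => ?_)
    rw [Real.norm_eq_abs, Real.abs_exp, Real.exp_le_exp]
    exact (le_abs_self _).trans (hlY y)
  have hintY : Integrable Y P := Integrable.of_bound hY.aestronglyMeasurable b
    (Eventually.of_forall hb)
  have hintY2 : Integrable (fun y => Y y ^ 2) P := by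
    refine Integrable.of_bound (hY.pow_const 2).aestronglyMeasurable (b ^ 2)
      (Eventually.of_forall fun y => ?_)
    rw [Real.norm_eq_abs, abs_pow]
    exact pow_le_pow_left₀ (abs_nonneg _) (hb y) 2
  have hint1 : Integrable (fun y => 1 + lam * Y y) P :=
    (integrable_const 1).add (hintY.const_mul lam)
  -- Expand to second order, which is legitimate as `|lam * Y| ≤ 1`; centring removes the linear
  -- term.
  have hone : ∫ y, Real.exp (lam * Y y) ∂P ≤ Real.exp (lam ^ 2 * v) := by
    calc ∫ y, Real.exp (lam * Y y) ∂P
        ≤ ∫ y, (1 + lam * Y y + lam ^ 2 * Y y ^ 2) ∂P := by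
          refine integral_mono hint (hint1.add (hintY2.const_mul _)) fun y => ?_
          have := exp_le_one_add_add_sq (hlY y)
          rwa [mul_pow] at this
      _ = 1 + lam ^ 2 * ∫ y, Y y ^ 2 ∂P := by
          rw [integral_add hint1 (hintY2.const_mul _),
            integral_add (integrable_const 1) (hintY.const_mul lam), integral_const_mul,
            integral_const_mul, hmean]
          simp
      _ ≤ 1 + lam ^ 2 * v := by gcongr
      _ ≤ Real.exp (lam ^ 2 * v) := by rw [add_comm]; exact Real.add_one_le_exp _
  have hprod : ∀ X : Fin n → E, Real.exp (lam * ∑ i, Y (X i)) = ∏ i, Real.exp (lam * Y (X i)) :=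
    fun X => by rw [Finset.mul_sum, Real.exp_sum]
  simp_rw [hprod]
  rw [← ofReal_integral_eq_lintegral_ofReal]
  · refine ENNReal.ofReal_le_ofReal ?_
    rw [integral_fintype_prod_eq_pow (fun y => Real.exp (lam * Y y)), Fintype.card_fin]
    calc (∫ y, Real.exp (lam * Y y) ∂P) ^ n ≤ Real.exp (lam ^ 2 * v) ^ n :=
          pow_le_pow_left₀ (integral_nonneg fun y => (Real.exp_pos _).le) hone n
      _ = _ := by rw [← Real.exp_nat_mul]
  · exact Integrable.fintype_prod (f := fun _ y => Real.exp (lam * Y y)) fun _ => hint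
  · exact Eventually.of_forall fun X => Finset.prod_nonneg fun i _ => (Real.exp_pos _).le

/-- Converts exponential moments into moments of order `p`: for `u ≥ 1`, compare with the term of
degree `⌈p⌉` of the exponential series. -/
lemma exists_rpow_le_exp (p : ℝ) (hp : 1 ≤ p) : ∃ A > 0, ∀ u : ℝ, 0 ≤ u → u ^ p ≤ A * Real.exp u := by
  refine ⟨(⌈p⌉₊.factorial : ℝ) + 1, by positivity, fun u hu => ?_⟩
  have hexp := Real.one_le_exp hu
  rcases le_total u 1 with h1 | h1
  · have : u ^ p ≤ 1 := Real.rpow_le_one hu h1 (by linarith)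
    have h2 : (1 : ℝ) ≤ (⌈p⌉₊.factorial : ℝ) + 1 := by
      linarith [(Nat.cast_nonneg ⌈p⌉₊.factorial : (0 : ℝ) ≤ _)]
    nlinarith
  · have h2 : u ^ p ≤ u ^ (⌈p⌉₊ : ℝ) := Real.rpow_le_rpow_of_exponent_le h1 (Nat.le_ceil p)
    rw [Real.rpow_natCast] at h2
    have h3 := Real.pow_div_factorial_le_exp u hu ⌈p⌉₊
    rw [div_le_iff₀ (by positivity)] at h3
    nlinarith [Real.exp_pos u]

/-- Moments of normalized sums of bounded centred independent variables. -/
lemma lintegral_abs_sum_rpow_le {E : Type*} [MeasurableSpace E] (P : Measure E)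
    [IsProbabilityMeasure P] {Y : E → ℝ} (hY : Measurable Y) {b v lam p A : ℝ}
    (hb : ∀ y, |Y y| ≤ b) (hlam0 : 0 < lam) (hlam : lam * b ≤ 1) (hmean : ∫ y, Y y ∂P = 0)
    (hvar : ∫ y, Y y ^ 2 ∂P ≤ v) (n : ℕ) (hA0 : 0 < A)
    (hA : ∀ u : ℝ, 0 ≤ u → u ^ p ≤ A * Real.exp u) :
    ∫⁻ X : Fin n → E, ENNReal.ofReal (|lam * ∑ i, Y (X i)| ^ p) ∂(Measure.pi fun _ => P) ≤
      ENNReal.ofReal (2 * A * Real.exp (n * (lam ^ 2 * v))) := by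
  have h1 := lintegral_exp_sum_le P hY (lam := lam) hb (by rwa [abs_of_pos hlam0]) hmean hvar n
  have h2 := lintegral_exp_sum_le P hY (lam := -lam) hb (by rwa [abs_neg, abs_of_pos hlam0]) hmean
    hvar n
  rw [neg_sq] at h2
  have hm : ∀ a : ℝ, Measurable fun X : Fin n → E =>
      ENNReal.ofReal (Real.exp (a * ∑ i, Y (X i))) := fun a =>
    ((Finset.measurable_fun_sum _ fun i _ => hY.comp (measurable_pi_apply i)).const_mul
      a).exp.ennreal_ofReal
  calc ∫⁻ X : Fin n → E, ENNReal.ofReal (|lam * ∑ i, Y (X i)| ^ p) ∂(Measure.pi fun _ => P)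
      ≤ ∫⁻ X : Fin n → E, ENNReal.ofReal A * (ENNReal.ofReal (Real.exp (lam * ∑ i, Y (X i))) +
          ENNReal.ofReal (Real.exp (-lam * ∑ i, Y (X i)))) ∂(Measure.pi fun _ => P) := by
        refine lintegral_mono fun X => ?_
        rw [← ENNReal.ofReal_add (Real.exp_pos _).le (Real.exp_pos _).le,
          ← ENNReal.ofReal_mul hA0.le]
        refine ENNReal.ofReal_le_ofReal ((hA _ (abs_nonneg _)).trans ?_)
        gcongr
        rw [neg_mul]
        rcases abs_choice (lam * ∑ i, Y (X i)) with h | h <;> rw [h]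
        · linarith [Real.exp_pos (-(lam * ∑ i, Y (X i)))]
        · linarith [Real.exp_pos (lam * ∑ i, Y (X i))]
    _ = ENNReal.ofReal A * (∫⁻ X : Fin n → E, ENNReal.ofReal (Real.exp (lam * ∑ i, Y (X i)))
          ∂(Measure.pi fun _ => P) + ∫⁻ X : Fin n → E,
          ENNReal.ofReal (Real.exp (-lam * ∑ i, Y (X i))) ∂(Measure.pi fun _ => P)) := by
        rw [lintegral_const_mul' _ _ ENNReal.ofReal_ne_top, lintegral_add_left (hm lam)]
    _ ≤ ENNReal.ofReal A * (ENNReal.ofReal (Real.exp (n * (lam ^ 2 * v))) +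
          ENNReal.ofReal (Real.exp (n * (lam ^ 2 * v)))) := by gcongr
    _ = _ := by
        rw [← ENNReal.ofReal_add (Real.exp_pos _).le (Real.exp_pos _).le,
          ← ENNReal.ofReal_mul hA0.le]
        congr 1; ring

end

section

/-! ### Empty grid cells -/

/-- Independence and `(1 - q)^n ≤ exp (-n q)`. -/
lemma pi_forall_notMem_le {E : Type*} [MeasurableSpace E] (P : Measure E) [IsProbabilityMeasure P]
    {S : Set E} (hS : MeasurableSet S) {q : ℝ} (hq : ENNReal.ofReal q ≤ P S) (n : ℕ) :
    (Measure.pi fun _ : Fin n => P) {X | ∀ i, X i ∉ S} ≤ ENNReal.ofReal (Real.exp (-(n * q))) := by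
  have hset : {X : Fin n → E | ∀ i, X i ∉ S} = univ.pi fun _ => Sᶜ := by ext X; simp
  rw [hset, Measure.pi_pi, Finset.prod_const, Finset.card_univ, Fintype.card_fin]
  have h1 : P Sᶜ ≤ ENNReal.ofReal (Real.exp (-q)) := by
    rw [prob_compl_eq_one_sub hS]
    calc 1 - P S ≤ 1 - ENNReal.ofReal q := tsub_le_tsub_left hq 1
      _ ≤ ENNReal.ofReal (1 - q) := by
          rw [tsub_le_iff_right, ← ENNReal.ofReal_one]
          calc ENNReal.ofReal 1 = ENNReal.ofReal (1 - q + q) := by ring_nf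
            _ ≤ _ := ENNReal.ofReal_add_le
      _ ≤ ENNReal.ofReal (Real.exp (-q)) := by
          refine ENNReal.ofReal_le_ofReal ?_
          linarith [Real.add_one_le_exp (-q)]
  calc P Sᶜ ^ n ≤ ENNReal.ofReal (Real.exp (-q)) ^ n := pow_le_pow_left' h1 n
    _ = _ := by
        rw [← ENNReal.ofReal_pow (Real.exp_pos _).le, ← Real.exp_nat_mul]
        congr 2; ring

/-- All cells of length `η` of the grid in `(0, H]` contain the coordinate of an observation. -/
def GridFilled {D n : ℕ} (c : ℝ → Ambient D) (η H : ℝ) (X : Fin n → Ambient D) : Prop :=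
  ∀ j : ℕ, (j + 1) * η ≤ H → ∃ i, ∃ t ∈ Ioc (j * η) ((j + 1) * η), c t = X i

variable {D n : ℕ} {c : ℝ → Ambient D} {x : Ambient D} {α β τ L fmin fmax R : ℝ}
  {P : Measure (Ambient D)} {f : Ambient D → ℝ}

/-- Union bound over at most `J` cells, each of mass at least `fmin * η` because `c` preserves
length. -/
lemma InModel.measure_not_gridFilled_le (hP : InModel x α β τ L fmin fmax R P f) (hτ : 0 < τ)
    (hfmin : 0 < fmin) (hc : ∀ T, IsUnitCurve P.support c (-T) T) {η H : ℝ} (hη : 0 < η)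
    (hHτ : H < τ) {J : ℕ} (hJ : H / η ≤ J) :
    (Measure.pi fun _ : Fin n => P) {X | ¬ GridFilled c η H X} ≤
      J * ENNReal.ofReal (Real.exp (-(n * (fmin * η)))) := by
  classical
  have hprob := hP.prob
  have hM := hP.isReachCurve hτ
  set I : ℕ → Set ℝ := fun j => Ioc (j * η) ((j + 1) * η) with hI
  set s := (Finset.range J).filter fun j : ℕ => (j + 1) * η ≤ H with hs
  have hsub : {X : Fin n → Ambient D | ¬ GridFilled c η H X} ⊆
      ⋃ j ∈ s, {X | ∀ i, X i ∉ c '' I j} := by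
    intro X hX
    obtain ⟨j, hj⟩ := not_forall.1 hX
    obtain ⟨hj, hne⟩ := Classical.not_imp.1 hj
    rw [mem_iUnion₂]
    refine ⟨j, Finset.mem_filter.2 ⟨Finset.mem_range.2 ?_, hj⟩, fun i hi => ?_⟩
    · have h1 : (j : ℝ) + 1 ≤ H / η := by rwa [le_div_iff₀ hη]
      have : (j : ℝ) < J := by linarith
      exact_mod_cast this
    · obtain ⟨t, ht, hti⟩ := hi
      exact hne ⟨i, t, ht, hti⟩
  have hcell : ∀ j ∈ s, (Measure.pi fun _ : Fin n => P) {X | ∀ i, X i ∉ c '' I j} ≤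
      ENNReal.ofReal (Real.exp (-(n * (fmin * η)))) := by
    intro j hj
    have hj' := (Finset.mem_filter.1 hj).2
    have hIτ : I j ⊆ Ioo (-τ) τ := fun t ht => by
      have : (0 : ℝ) ≤ j * η := by positivity
      exact ⟨by linarith [ht.1], by linarith [ht.2]⟩
    have hvol : volume (I j) = ENNReal.ofReal η := by
      rw [hI, Real.volume_Ioc]; congr 1; ring
    have hle := hP.mul_volume_le hτ hc hIτ measurableSet_Ioc
    rw [hvol, ← ENNReal.ofReal_mul hfmin.le] at hle
    exact pi_forall_notMem_le P (measurableSet_Ioc.image_of_continuousOn_injOn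
      (contDiff_of_forall_isUnitCurve hc).continuous.continuousOn ((hM.injOn hc).mono hIτ)) hle n
  calc (Measure.pi fun _ : Fin n => P) {X | ¬ GridFilled c η H X}
      ≤ ∑ j ∈ s, (Measure.pi fun _ : Fin n => P) {X | ∀ i, X i ∉ c '' I j} :=
        (measure_mono hsub).trans (measure_biUnion_finset_le _ _)
    _ ≤ ∑ _j ∈ s, ENNReal.ofReal (Real.exp (-(n * (fmin * η)))) := Finset.sum_le_sum hcell
    _ = s.card * ENNReal.ofReal (Real.exp (-(n * (fmin * η)))) := by
        rw [Finset.sum_const, nsmul_eq_mul]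
    _ ≤ _ := by
        gcongr
        exact (Finset.card_filter_le _ _).trans (by simp)

/-! ### Error of the estimator -/

/-- The error of the Isomap kernel estimator for a given sample. -/
lemma InModel.abs_error_le (hP : InModel x α β τ L fmin fmax R P f) (hτ : 0 < τ) (hfmin : 0 < fmin)
    (hc : ∀ T, IsUnitCurve P.support c (-T) T) (hβ : 0 ≤ β) (hR : 0 ≤ R) (l : ℕ)
    (hβl : β ≤ l + 1) {h ε B : ℝ} (hh : 0 < h) (hhτ : 2 * h < τ) (hε : 0 < ε) (hετ : ε ≤ τ / 8)
    (hB0 : 0 < B) (hB : ∀ t, |kernel (l + 1) t| ≤ B)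
    (hBlip : ∀ s t, |kernel (l + 1) s - kernel (l + 1) t| ≤ B * |s - t|) (hn : 0 < n)
    {X : Fin n → Ambient D} (hX : ∀ i, X i ∈ P.support) :
    |isomapKernelEstimator (l + 1) h ε (c 0) X - f (c 0)| ≤
      2 * B * (ε ^ 2 / τ ^ 2) / h + (2 * B * R + (2 * B + 1) * fmax) * h ^ β +
      |1 / (n * h) * ∑ i, (arcKernel l h τ c (X i) - ∫ y, arcKernel l h τ c y ∂P)| +
      {X | ¬ (GridFilled c (ε / 4) (2 * h) X ∧
        GridFilled (fun t => c (-t)) (ε / 4) (2 * h) X)}.indicator (fun _ => 2 * B / h) X := by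
  have hM := hP.isReachCurve hτ
  have hn' : (0 : ℝ) < n := by exact_mod_cast hn
  set w : Fin n → ℝ := fun i => if isomapDist ε (c 0) X i = ⊤ then 0 else
    kernel (l + 1) ((isomapDist ε (c 0) X i).toReal / h) with hw
  set κ := arcKernel l h τ c with hκ
  set μ := ∫ y, κ y ∂P with hμ
  have hbias := hP.abs_bias_le hτ hfmin hc hβ hR l hβl hh (by linarith : h < τ) hB
  -- Error from replacing arc length by graph distance, plus bias, plus centred fluctuation.
  have hdec : isomapKernelEstimator (l + 1) h ε (c 0) X - f (c 0) =
      1 / (n * h) * ∑ i, (w i - κ (X i)) + (1 / h * μ - f (c 0)) +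
        1 / (n * h) * ∑ i, (κ (X i) - μ) := by
    rw [isomapKernelEstimator, Finset.sum_sub_distrib, Finset.sum_sub_distrib, Finset.sum_const,
      Finset.card_univ, Fintype.card_fin, nsmul_eq_mul]
    field_simp
    ring
  have hsum : ∀ b : ℝ, (∀ i, |w i - κ (X i)| ≤ b) →
      |1 / (n * h) * ∑ i, (w i - κ (X i))| ≤ b / h := by
    intro b hb
    rw [abs_mul, abs_of_pos (by positivity : 0 < 1 / (n * h))]
    have h1 : |∑ i, (w i - κ (X i))| ≤ n * b := by
      refine (Finset.abs_sum_le_sum_abs _ _).trans ((Finset.sum_le_sum fun i _ => hb i).trans ?_)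
      simp
    calc 1 / (n * h) * |∑ i, (w i - κ (X i))| ≤ 1 / (n * h) * (n * b) := by gcongr
      _ = b / h := by field_simp
  have hδ : 0 ≤ 2 * B * (ε ^ 2 / τ ^ 2) / h := by positivity
  have hwerr : |1 / (n * h) * ∑ i, (w i - κ (X i))| ≤ 2 * B * (ε ^ 2 / τ ^ 2) / h +
      {X | ¬ (GridFilled c (ε / 4) (2 * h) X ∧
        GridFilled (fun t => c (-t)) (ε / 4) (2 * h) X)}.indicator (fun _ => 2 * B / h) X := by
    by_cases hgood : GridFilled c (ε / 4) (2 * h) X ∧ GridFilled (fun t => c (-t)) (ε / 4) (2 * h) X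
    · rw [indicator_of_notMem (by simpa using hgood), add_zero]
      exact hsum _ fun i => hM.abs_weight_sub_arcKernel_le hc (by linarith) (by linarith) hετ hh hhτ
        hX hgood.1 hgood.2 l hB0.le hBlip i
    -- With an empty cell the graph distance may be far too large or infinite, and only the
    -- boundedness of both weights is used.
    · rw [indicator_of_mem (by simpa using hgood)]
      refine le_trans (hsum (2 * B) fun i => ?_) (by linarith)
      have h1 : |w i| ≤ B := by
        rw [hw]; simp only
        split_ifs
        · simpa using hB0.le
        · exact hB _
      have h2 := abs_arcKernel_le l (h := h) (hM.injOn hc) hB (X i)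
      have h3 := abs_sub (w i) (κ (X i))
      linarith
  rw [hdec]
  have h1 := abs_add_le (1 / (n * h) * ∑ i, (w i - κ (X i)) + (1 / h * μ - f (c 0)))
    (1 / (n * h) * ∑ i, (κ (X i) - μ))
  have h2 := abs_add_le (1 / (n * h) * ∑ i, (w i - κ (X i))) (1 / h * μ - f (c 0))
  linarith

lemma add_add_rpow_le {a b c p : ℝ} (ha : 0 ≤ a) (hb : 0 ≤ b) (hc : 0 ≤ c) (hp : 0 ≤ p) :
    (a + b + c) ^ p ≤ 3 ^ p * (a ^ p + b ^ p + c ^ p) := by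
  set m := max (max a b) c with hm
  have hm0 : 0 ≤ m := hc.trans (le_max_right _ _)
  have h1 : a + b + c ≤ 3 * m := by
    have : a ≤ m := (le_max_left _ _).trans (le_max_left _ _)
    have : b ≤ m := (le_max_right _ _).trans (le_max_left _ _)
    have : c ≤ m := le_max_right _ _
    linarith
  have h2 : m ^ p ≤ a ^ p + b ^ p + c ^ p := by
    have ha' := Real.rpow_nonneg ha p
    have hb' := Real.rpow_nonneg hb p
    have hc' := Real.rpow_nonneg hc p
    rcases max_choice (max a b) c with h | h
    · rcases max_choice a b with h' | h' <;> rw [hm, h, h'] <;> linarith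
    · rw [hm, h]; linarith
  calc (a + b + c) ^ p ≤ (3 * m) ^ p := Real.rpow_le_rpow (by positivity) h1 hp
    _ = 3 ^ p * m ^ p := Real.mul_rpow (by norm_num) hm0
    _ ≤ _ := by gcongr

/-- Moment bound for the error, in terms of the normalized rate `r`. -/
lemma InModel.lintegral_error_le (hP : InModel x α β τ L fmin fmax R P f) (hτ : 0 < τ)
    (hfmin : 0 < fmin) (hc : ∀ T, IsUnitCurve P.support c (-T) T) (hβ : 0 ≤ β) (hR : 0 ≤ R)
    (l : ℕ) (hβl : β ≤ l + 1) {h ε B p A r C₀ C₁ : ℝ} (hp : 1 ≤ p) (hh : 0 < h) (hhτ : 2 * h < τ)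
    (hε : 0 < ε) (hετ : ε ≤ τ / 8) (hB0 : 0 < B) (hB : ∀ t, |kernel (l + 1) t| ≤ B)
    (hBlip : ∀ s t, |kernel (l + 1) s - kernel (l + 1) t| ≤ B * |s - t|) (hn : 0 < n)
    (hA0 : 0 < A) (hA : ∀ u : ℝ, 0 ≤ u → u ^ p ≤ A * Real.exp u)
    (hr0 : 0 < r) (hr1 : r ≤ 1) (hnhr : n * h * r ^ 2 = 1)
    (hC₀ : 2 * B * (ε ^ 2 / τ ^ 2) / h + (2 * B * R + (2 * B + 1) * fmax) * h ^ β ≤ C₀ * r)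
    {J : ℕ} (hJ : 2 * h / (ε / 4) ≤ J)
    (hbad : (2 * B / h) ^ p * (2 * (J * Real.exp (-(n * (fmin * (ε / 4)))))) ≤ C₁ * r ^ p) :
    ∫⁻ X : Fin n → Ambient D,
      ENNReal.ofReal (|isomapKernelEstimator (l + 1) h ε (c 0) X - f (c 0)| ^ p)
        ∂(Measure.pi fun _ => P) ≤
      ENNReal.ofReal (3 ^ p * (C₀ ^ p + (2 * B) ^ p * (2 * A * Real.exp (fmax / 2)) + C₁) * r ^ p) := by
  classical
  have hprob := hP.prob
  have hM := hP.isReachCurve hτ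
  have hcont := (contDiff_of_forall_isUnitCurve hc).continuous
  have hn' : (0 : ℝ) < n := by exact_mod_cast hn
  have hp0 : 0 ≤ p := by linarith
  have hmem0 : c 0 ∈ P.support := (hc 1).mem 0 (by simp)
  have hfmax : 0 ≤ fmax := hfmin.le.trans ((hP.lower _ hmem0).trans (hP.upper _ hmem0))
  have hC₀0 : 0 ≤ C₀ := by
    have : 0 ≤ C₀ * r := le_trans (by positivity) hC₀
    exact nonneg_of_mul_nonneg_left this hr0
  set κ := arcKernel l h τ c with hκ
  have hκm : Measurable κ := measurable_arcKernel l h hcont (hM.injOn hc)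
  have hκB : ∀ y, |κ y| ≤ B := abs_arcKernel_le l (hM.injOn hc) hB
  set μ := ∫ y, κ y ∂P with hμ
  have hκi : Integrable κ P := Integrable.of_bound hκm.aestronglyMeasurable B
    (Eventually.of_forall hκB)
  have hκ2i : Integrable (fun y => κ y ^ 2) P := by
    refine Integrable.of_bound (hκm.pow_const 2).aestronglyMeasurable (B ^ 2)
      (Eventually.of_forall fun y => ?_)
    rw [Real.norm_eq_abs, abs_pow]
    exact pow_le_pow_left₀ (abs_nonneg _) (hκB y) 2
  have hμB : |μ| ≤ B := by
    have := norm_integral_le_of_norm_le_const (μ := P) (f := κ) (C := B) (Eventually.of_forall hκB)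
    simpa using this
  set Y : Ambient D → ℝ := fun y => κ y - μ with hY
  have hYm : Measurable Y := hκm.sub_const μ
  have hYb : ∀ y, |Y y| ≤ 2 * B := fun y => by
    have := abs_sub (κ y) μ
    linarith [hκB y]
  have hYmean : ∫ y, Y y ∂P = 0 := by
    rw [hY, integral_sub hκi (integrable_const μ)]; simp [hμ]
  have hYvar : ∫ y, Y y ^ 2 ∂P ≤ 2 * fmax * B ^ 2 * h := by
    have h1 : ∫ y, Y y ^ 2 ∂P = ∫ y, κ y ^ 2 ∂P - μ ^ 2 := by
      have h2 : ∀ y, Y y ^ 2 = κ y ^ 2 - (2 * μ * κ y - μ ^ 2) := fun y => by rw [hY]; ring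
      simp_rw [h2]
      have h3 : Integrable (fun y => 2 * μ * κ y - μ ^ 2) P :=
        (hκi.const_mul _).sub (integrable_const _)
      rw [integral_sub hκ2i h3, integral_sub (hκi.const_mul _) (integrable_const _),
        integral_const_mul, ← hμ]
      simp
      ring
    have h4 := hP.integral_arcKernel_sq_le hτ hfmin hc l hh hB
    rw [h1]
    nlinarith [sq_nonneg μ]
  set bad : Set (Fin n → Ambient D) := {X | ¬ (GridFilled c (ε / 4) (2 * h) X ∧
    GridFilled (fun t => c (-t)) (ε / 4) (2 * h) X)} with hbaddef
  -- This scale gives `lam * (2 B) ≤ 1`, and with `n h r² = 1` it turns the exponent `n lam² (2 fmax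
  -- B² h)` into the constant `fmax / 2`.
  set lam := r / (2 * B) with hlam
  have hlam0 : 0 < lam := by positivity
  have hmom := lintegral_abs_sum_rpow_le P hYm (lam := lam) hYb hlam0
    (by rw [hlam, div_mul_cancel₀ _ (by positivity)]; exact hr1) hYmean hYvar n hA0 hA
  have hexp : (n : ℝ) * (lam ^ 2 * (2 * fmax * B ^ 2 * h)) = fmax / 2 := by
    have : (n : ℝ) * (lam ^ 2 * (2 * fmax * B ^ 2 * h)) = fmax / 2 * (n * h * r ^ 2) := by
      rw [hlam]; field_simp
    rw [this, hnhr, mul_one]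
  rw [hexp] at hmom
  have hS : ∀ X : Fin n → Ambient D, |1 / (n * h) * ∑ i, Y (X i)| =
      2 * B * r * |lam * ∑ i, Y (X i)| := by
    intro X
    have h1 : (1 : ℝ) / (n * h) = 2 * B * r * lam := by
      rw [hlam, div_eq_iff (by positivity)]
      field_simp
      linarith
    rw [h1, mul_assoc, abs_mul, abs_of_pos (by positivity : 0 < 2 * B * r)]
  have hbadm : (Measure.pi fun _ : Fin n => P) bad ≤
      ENNReal.ofReal (2 * (J * Real.exp (-(n * (fmin * (ε / 4)))))) := by
    have hc' : ∀ T, IsUnitCurve P.support (fun t => c (-t)) (-T) T := fun T => by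
      simpa using (hc T).reverse
    have hsub : bad ⊆ {X | ¬ GridFilled c (ε / 4) (2 * h) X} ∪
        {X | ¬ GridFilled (fun t => c (-t)) (ε / 4) (2 * h) X} := by
      intro X hX
      exact not_and_or.1 hX
    refine (measure_mono hsub).trans ((measure_union_le _ _).trans ?_)
    have h1 := hP.measure_not_gridFilled_le (n := n) hτ hfmin hc (by linarith : 0 < ε / 4) hhτ hJ
    have h2 := hP.measure_not_gridFilled_le (n := n) hτ hfmin hc' (by linarith : 0 < ε / 4) hhτ hJ
    refine (add_le_add h1 h2).trans (le_of_eq ?_)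
    rw [← two_mul, ENNReal.ofReal_mul zero_le_two, ENNReal.ofReal_mul (Nat.cast_nonneg J),
      ENNReal.ofReal_natCast]
    simp
  have hae : ∀ᵐ X ∂(Measure.pi fun _ : Fin n => P), ∀ i, X i ∈ P.support := by
    rw [ae_all_iff]
    intro i
    exact (Measure.quasiMeasurePreserving_eval (μ := fun _ : Fin n => P) i).ae
      (Measure.support_mem_ae (μ := P))
  set K₁ := 3 ^ p * (C₀ * r) ^ p with hK₁
  set K₂ := 3 ^ p * (2 * B * r) ^ p with hK₂
  set K₃ := 3 ^ p * (2 * B / h) ^ p with hK₃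
  have hK₁0 : 0 ≤ K₁ := by positivity
  have hK₂0 : 0 ≤ K₂ := by positivity
  have hK₃0 : 0 ≤ K₃ := by positivity
  have hpt : ∀ᵐ X ∂(Measure.pi fun _ : Fin n => P),
      ENNReal.ofReal (|isomapKernelEstimator (l + 1) h ε (c 0) X - f (c 0)| ^ p) ≤
        ENNReal.ofReal K₁ + (ENNReal.ofReal K₂ * ENNReal.ofReal (|lam * ∑ i, Y (X i)| ^ p) +
          bad.indicator (fun _ => ENNReal.ofReal K₃) X) := by
    filter_upwards [hae] with X hX
    have h1 := hP.abs_error_le hτ hfmin hc hβ hR l hβl hh hhτ hε hετ hB0 hB hBlip hn hX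
    set ι := bad.indicator (fun _ => 2 * B / h) X with hι
    have hι0 : 0 ≤ ι := indicator_nonneg (fun _ _ => by positivity) X
    have h2 : |isomapKernelEstimator (l + 1) h ε (c 0) X - f (c 0)| ≤
        C₀ * r + 2 * B * r * |lam * ∑ i, Y (X i)| + ι := by
      rw [← hS]; exact h1.trans (by gcongr)
    have h3 : ι ^ p = bad.indicator (fun _ => (2 * B / h) ^ p) X := by
      rw [hι, indicator_apply, indicator_apply]
      split_ifs
      · rfl
      · exact Real.zero_rpow (by linarith)
    have h4 : |isomapKernelEstimator (l + 1) h ε (c 0) X - f (c 0)| ^ p ≤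
        K₁ + (K₂ * |lam * ∑ i, Y (X i)| ^ p + bad.indicator (fun _ => K₃) X) := by
      refine (Real.rpow_le_rpow (abs_nonneg _) h2 hp0).trans ?_
      refine (add_add_rpow_le (by positivity) (by positivity) hι0 hp0).trans (le_of_eq ?_)
      rw [h3, Real.mul_rpow (by positivity) (abs_nonneg _), hK₁, hK₂, indicator_apply,
        indicator_apply]
      split_ifs <;> ring
    refine (ENNReal.ofReal_le_ofReal h4).trans ?_
    rw [ENNReal.ofReal_add hK₁0 (add_nonneg (by positivity) (indicator_nonneg (fun _ _ => hK₃0) X)),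
      ENNReal.ofReal_add (by positivity) (indicator_nonneg (fun _ _ => hK₃0) X),
      ENNReal.ofReal_mul hK₂0]
    refine le_of_eq ?_
    congr 2
    rw [indicator_apply, indicator_apply]
    split_ifs <;> simp
  have hYsum : Measurable fun X : Fin n → Ambient D =>
      ENNReal.ofReal (|lam * ∑ i, Y (X i)| ^ p) := by
    have : Measurable fun X : Fin n → Ambient D => lam * ∑ i, Y (X i) :=
      (Finset.measurable_fun_sum _ fun i _ => hYm.comp (measurable_pi_apply i)).const_mul lam
    exact ((continuous_abs.measurable.comp this).pow_const p).ennreal_ofReal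
  refine (lintegral_mono_ae hpt).trans ?_
  rw [lintegral_add_left measurable_const, lintegral_add_left (hYsum.const_mul _), lintegral_const,
    measure_univ, mul_one, lintegral_const_mul _ hYsum]
  calc ENNReal.ofReal K₁ + (ENNReal.ofReal K₂ *
          ∫⁻ X : Fin n → Ambient D, ENNReal.ofReal (|lam * ∑ i, Y (X i)| ^ p)
            ∂(Measure.pi fun _ => P) +
        ∫⁻ X, bad.indicator (fun _ => ENNReal.ofReal K₃) X ∂(Measure.pi fun _ => P))
      ≤ ENNReal.ofReal K₁ + (ENNReal.ofReal K₂ * ENNReal.ofReal (2 * A * Real.exp (fmax / 2)) +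
        ENNReal.ofReal K₃ *
          ENNReal.ofReal (2 * (J * Real.exp (-(n * (fmin * (ε / 4))))))) := by
        gcongr
        exact (lintegral_indicator_const_le _ _).trans (by gcongr)
    _ = ENNReal.ofReal (K₁ + (K₂ * (2 * A * Real.exp (fmax / 2)) +
          K₃ * (2 * (J * Real.exp (-(n * (fmin * (ε / 4)))))))) := by
        rw [ENNReal.ofReal_add hK₁0 (by positivity), ENNReal.ofReal_add (by positivity)
          (by positivity), ENNReal.ofReal_mul hK₂0, ENNReal.ofReal_mul hK₃0]
    _ ≤ _ := by
        refine ENNReal.ofReal_le_ofReal ?_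
        have h3 : (0 : ℝ) ≤ 3 ^ p := by positivity
        have h1 : K₃ * (2 * (J * Real.exp (-(n * (fmin * (ε / 4)))))) ≤ 3 ^ p * (C₁ * r ^ p) := by
          rw [hK₃, mul_assoc]
          exact mul_le_mul_of_nonneg_left hbad h3
        rw [hK₁, hK₂, Real.mul_rpow hC₀0 hr0.le, Real.mul_rpow (by positivity) hr0.le]
        nlinarith

end

/-! ### Bandwidth and rate -/

section Rate

variable {β z : ℝ}

/-- The stochastic error `(n h)^(-1/2)` equals the rate; with `bandwidth_rpow` for the bias `h ^ β`,
this is the balance that defines the bandwidth. -/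
lemma mul_bandwidth_mul_rate_sq (hβ : 0 ≤ β) (hz : 0 < z) :
    z * z ^ (-1 / (2 * β + 1)) * (z ^ (-β / (2 * β + 1))) ^ 2 = 1 := by
  have hq : (2 * β + 1) ≠ 0 := by positivity
  rw [← Real.rpow_natCast, ← Real.rpow_mul hz.le]
  nth_rewrite 1 [← Real.rpow_one z]
  rw [← Real.rpow_add hz, ← Real.rpow_add hz]
  have : 1 + -1 / (2 * β + 1) + -β / (2 * β + 1) * ((2 : ℕ) : ℝ) = 0 := by
    push_cast; field_simp; ring
  rw [this, Real.rpow_zero]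

lemma bandwidth_rpow (hz : 0 < z) :
    (z ^ (-1 / (2 * β + 1))) ^ β = z ^ (-β / (2 * β + 1)) := by
  rw [← Real.rpow_mul hz.le]; congr 1; ring

/-- The exponents add up to `-(β + 1) / (2 β + 1) ≥ -1`. Together with `sq_log_div_le` this puts the
graph error `ε² / h` below the rate. -/
lemma inv_le_bandwidth_mul_rate (hβ : 0 ≤ β) (hz : 1 ≤ z) :
    z⁻¹ ≤ z ^ (-1 / (2 * β + 1)) * z ^ (-β / (2 * β + 1)) := by
  have hz0 : 0 < z := by linarith
  rw [← Real.rpow_add hz0, ← Real.rpow_neg_one]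
  refine Real.rpow_le_rpow_of_exponent_le hz ?_
  rw [← add_div, le_div_iff₀ (by positivity)]
  linarith

lemma inv_bandwidth_le (hβ : 0 ≤ β) (hz : 1 ≤ z) : (z ^ (-1 / (2 * β + 1)))⁻¹ ≤ z := by
  have hz0 : 0 < z := by linarith
  rw [← Real.rpow_neg hz0.le]
  nth_rewrite 2 [← Real.rpow_one z]
  refine Real.rpow_le_rpow_of_exponent_le hz ?_
  rw [neg_div, neg_neg, div_le_one (by positivity)]
  linarith

lemma inv_le_rate (hβ : 0 ≤ β) (hz : 1 ≤ z) : z⁻¹ ≤ z ^ (-β / (2 * β + 1)) := by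
  rw [← Real.rpow_neg_one]
  refine Real.rpow_le_rpow_of_exponent_le hz ?_
  rw [le_div_iff₀ (by positivity)]
  linarith

lemma rate_le_one (hβ : 0 ≤ β) (hz : 1 ≤ z) : z ^ (-β / (2 * β + 1)) ≤ 1 :=
  Real.rpow_le_one_of_one_le_of_nonpos hz
    (div_nonpos_of_nonpos_of_nonneg (by linarith) (by positivity))

lemma bandwidth_le_one (hβ : 0 ≤ β) (hz : 1 ≤ z) : z ^ (-1 / (2 * β + 1)) ≤ 1 :=
  Real.rpow_le_one_of_one_le_of_nonpos hz
    (div_nonpos_of_nonpos_of_nonneg (by linarith) (by positivity))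

lemma tendsto_bandwidth (hβ : 0 ≤ β) :
    Tendsto (fun n : ℕ => (n : ℝ) ^ (-1 / (2 * β + 1))) atTop (𝓝 0) := by
  have h := (tendsto_rpow_neg_atTop (y := 1 / (2 * β + 1)) (by positivity)).comp
    (tendsto_natCast_atTop_atTop (R := ℝ))
  refine h.congr fun n => ?_
  simp only [Function.comp, neg_div]

lemma tendsto_log_div_natCast : Tendsto (fun n : ℕ => Real.log n / n) atTop (𝓝 0) := by
  have h := (Real.isLittleO_log_id_atTop.tendsto_div_nhds_zero).comp
    (tendsto_natCast_atTop_atTop (R := ℝ))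
  exact h

/-- Uses `log z ≤ 2 √z`: crude, but an upper bound of order `1 / z` is enough and leaves no
logarithm in the final rate. -/
lemma sq_log_div_le (hz : 1 ≤ z) : (Real.log z / z) ^ 2 ≤ 4 * z⁻¹ := by
  have hz0 : 0 < z := by linarith
  have h1 : Real.log z ≤ z ^ (1 / 2 : ℝ) / (1 / 2) := Real.log_le_rpow_div hz0.le (by norm_num)
  have h2 : Real.log z ^ 2 ≤ 4 * z := by
    have h3 := pow_le_pow_left₀ (Real.log_nonneg hz) h1 2
    rw [div_pow, ← Real.rpow_natCast (z ^ (1 / 2 : ℝ)), ← Real.rpow_mul hz0.le] at h3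
    norm_num at h3
    linarith
  rw [div_pow, div_le_iff₀ (by positivity)]
  calc Real.log z ^ 2 ≤ 4 * z := h2
    _ = 4 * z⁻¹ * z ^ 2 := by field_simp

/-- The contribution of samples with an empty grid cell is negligible. -/
lemma bad_event_le (hβ : 0 ≤ β) {p fmin B : ℝ} (hp : 1 ≤ p) (hfmin : 0 < fmin) (hB : 0 < B)
    (hz : 1 ≤ z) (hlog : 1 ≤ Real.log z) :
    (2 * B / z ^ (-1 / (2 * β + 1))) ^ p *
      (2 * (⌈2 * z ^ (-1 / (2 * β + 1)) / (32 * (p + 1) / fmin * (Real.log z / z) / 4)⌉₊ *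
        Real.exp (-(z * (fmin * (32 * (p + 1) / fmin * (Real.log z / z) / 4)))))) ≤
      (2 * B) ^ p * (2 * (fmin + 1)) * (z ^ (-β / (2 * β + 1))) ^ p := by
  have hz0 : 0 < z := by linarith
  set h := z ^ (-1 / (2 * β + 1)) with hh
  set r := z ^ (-β / (2 * β + 1)) with hr
  have hh0 : 0 < h := Real.rpow_pos_of_pos hz0 _
  -- The constant `32 (p + 1) / fmin` is divided by `4` for the cell length; `fmin` cancels and
  -- leaves the power `-8 (p + 1)`.
  have hexp : Real.exp (-(z * (fmin * (32 * (p + 1) / fmin * (Real.log z / z) / 4)))) =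
      z ^ (-(8 * (p + 1))) := by
    rw [Real.rpow_def_of_pos hz0]
    congr 1
    field_simp
    ring
  have hJ : (⌈2 * h / (32 * (p + 1) / fmin * (Real.log z / z) / 4)⌉₊ : ℝ) ≤ (fmin + 1) * z := by
    have h0 : 0 ≤ 2 * h / (32 * (p + 1) / fmin * (Real.log z / z) / 4) := by positivity
    have h1 := (Nat.ceil_lt_add_one h0).le
    have h2 : 2 * h / (32 * (p + 1) / fmin * (Real.log z / z) / 4) =
        h * fmin * z / (4 * (p + 1) * Real.log z) := by
      have : Real.log z ≠ 0 := by linarith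
      field_simp
      norm_num
    have h3 : h * fmin * z / (4 * (p + 1) * Real.log z) ≤ fmin * z := by
      rw [div_le_iff₀ (by positivity)]
      have h4 : h ≤ 1 := bandwidth_le_one hβ hz
      have h5 : 1 ≤ 4 * (p + 1) * Real.log z := by nlinarith
      calc h * fmin * z ≤ 1 * fmin * z := by gcongr
        _ = fmin * z * 1 := by ring
        _ ≤ fmin * z * (4 * (p + 1) * Real.log z) := by gcongr
    rw [h2] at h1
    rw [h2]
    linarith
  have hinv : 2 * B / h ≤ 2 * B * z := by
    rw [div_eq_mul_inv]
    gcongr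
    exact inv_bandwidth_le hβ hz
  rw [hexp]
  calc (2 * B / h) ^ p * (2 * (⌈2 * h / (32 * (p + 1) / fmin * (Real.log z / z) / 4)⌉₊ *
        z ^ (-(8 * (p + 1)))))
      ≤ (2 * B * z) ^ p * (2 * ((fmin + 1) * z * z ^ (-(8 * (p + 1))))) := by gcongr
    -- `p` comes from the error size `1 / h ≤ z` and `1` from the number of cells; the total `-7 (p
    -- + 1)` lies below `-p`.
    _ = (2 * B) ^ p * (2 * (fmin + 1)) * z ^ (p + 1 + -(8 * (p + 1))) := by
        rw [Real.mul_rpow (by positivity) hz0.le, Real.rpow_add hz0, Real.rpow_add hz0,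
          Real.rpow_one]
        ring
    _ ≤ (2 * B) ^ p * (2 * (fmin + 1)) * z ^ (-1 * p) := by
        gcongr
        linarith
    _ ≤ _ := by
        gcongr
        rw [Real.rpow_mul hz0.le, Real.rpow_neg_one]
        exact Real.rpow_le_rpow (by positivity) (inv_le_rate hβ hz) (by linarith)

end Rate

/-! ### Uniform risk bound -/

/-- Risk bound with explicit constants for large samples. -/
lemma InModel.risk_le {D n : ℕ} {x : Ambient D} {α β τ L fmin fmax R : ℝ}
    {P : Measure (Ambient D)} {f : Ambient D → ℝ} (hP : InModel x α β τ L fmin fmax R P f)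
    (hτ : 0 < τ) (hfmin : 0 < fmin) (hβ : 0 ≤ β) (hR : 0 ≤ R) (l : ℕ) (hβl : β ≤ l + 1)
    {B p A : ℝ} (hp : 1 ≤ p) (hB0 : 0 < B) (hB : ∀ t, |kernel (l + 1) t| ≤ B)
    (hBlip : ∀ s t, |kernel (l + 1) s - kernel (l + 1) t| ≤ B * |s - t|)
    (hA0 : 0 < A) (hA : ∀ u : ℝ, 0 ≤ u → u ^ p ≤ A * Real.exp u) (hn : 3 ≤ n)
    (hhτ : 2 * (n : ℝ) ^ (-1 / (2 * β + 1)) < τ)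
    (hετ : 32 * (p + 1) / fmin * (Real.log n / n) ≤ τ / 8) :
    risk p P (fun X : Fin n → Ambient D => onedimEstimator (l + 1) β p fmin x X) (f x) ≤
      ENNReal.ofReal ((3 ^ p * ((8 * B * (32 * (p + 1) / fmin) ^ 2 / τ ^ 2 +
        (2 * B * R + (2 * B + 1) * fmax)) ^ p + (2 * B) ^ p * (2 * A * Real.exp (fmax / 2)) +
        (2 * B) ^ p * (2 * (fmin + 1)))) ^ (1 / p) * (n : ℝ) ^ (-β / (2 * β + 1))) := by
  have hM := hP.isReachCurve hτ
  obtain ⟨c, hc, rfl⟩ := hM.exists_global_unitCurve hP.support.mem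
  have hmem0 : c 0 ∈ P.support := hP.support.mem
  have hfmax : 0 ≤ fmax := hfmin.le.trans ((hP.lower _ hmem0).trans (hP.upper _ hmem0))
  have hz : (1 : ℝ) ≤ n := by exact_mod_cast (by omega : 1 ≤ n)
  have hz0 : (0 : ℝ) < n := by linarith
  -- This is where `n ≥ 3 > e` is needed; it also makes `ε` positive.
  have hlog : 1 ≤ Real.log n := by
    rw [Real.le_log_iff_exp_le hz0]
    have h3 : (3 : ℝ) ≤ n := by exact_mod_cast hn
    linarith [Real.exp_one_lt_d9]
  set h := (n : ℝ) ^ (-1 / (2 * β + 1)) with hh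
  set r := (n : ℝ) ^ (-β / (2 * β + 1)) with hr
  set a := 32 * (p + 1) / fmin with ha
  have ha0 : 0 < a := by positivity
  set ε := a * (Real.log n / n) with hε
  have hε0 : 0 < ε := by positivity
  have hh0 : 0 < h := Real.rpow_pos_of_pos hz0 _
  have hr0 : 0 < r := Real.rpow_pos_of_pos hz0 _
  have hC₀ : 2 * B * (ε ^ 2 / τ ^ 2) / h + (2 * B * R + (2 * B + 1) * fmax) * h ^ β ≤
      (8 * B * a ^ 2 / τ ^ 2 + (2 * B * R + (2 * B + 1) * fmax)) * r := by
    have hhβ : h ^ β = r := bandwidth_rpow hz0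
    rw [hhβ, add_mul (8 * B * a ^ 2 / τ ^ 2)]
    refine add_le_add ?_ le_rfl
    have h1 : ε ^ 2 ≤ a ^ 2 * (4 * (h * r)) := by
      rw [hε, mul_pow]
      gcongr
      exact (sq_log_div_le hz).trans (by gcongr; exact inv_le_bandwidth_mul_rate hβ hz)
    calc 2 * B * (ε ^ 2 / τ ^ 2) / h ≤ 2 * B * (a ^ 2 * (4 * (h * r)) / τ ^ 2) / h := by gcongr
      _ = _ := by field_simp; ring
  have hmain := hP.lintegral_error_le (n := n) hτ hfmin hc hβ hR l hβl hp hh0 hhτ hε0 hετ hB0 hB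
    hBlip (by omega) hA0 hA hr0 (rate_le_one hβ hz) (mul_bandwidth_mul_rate_sq hβ hz0) hC₀
    (Nat.le_ceil _) (C₁ := (2 * B) ^ p * (2 * (fmin + 1)))
    (bad_event_le hβ hp hfmin hB0 hz hlog)
  unfold risk
  refine (ENNReal.rpow_le_rpow hmain (by positivity)).trans (le_of_eq ?_)
  rw [ENNReal.ofReal_rpow_of_nonneg (by positivity) (by positivity),
    Real.mul_rpow (by positivity) (by positivity), ← Real.rpow_mul hr0.le,
    mul_one_div_cancel (by linarith), Real.rpow_one]

end ManifoldDensity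

end

open ManifoldDensity in
theorem theorem3p3 (β p fmin : ℝ) (hβ : 0 ≤ β) (hp : 1 ≤ p) (hfmin : 0 < fmin)
    (ℓ : ℕ) (hℓ : 1 ≤ ℓ) (hβℓ : β ≤ ℓ) :
    (∀ (D n : ℕ) (x : Ambient D),
      Measurable (fun X : Fin n → Ambient D => onedimEstimator ℓ β p fmin x X)) ∧
    ∀ α τ L fmax R : ℝ, 0 ≤ α → 0 < τ → 0 < L → fmin < fmax → 0 < R →
      ∃ (C : ℝ) (N : ℕ), 0 < C ∧ ∀ (D : ℕ) (x : Ambient D), 2 ≤ D → ∀ n : ℕ, N ≤ n →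
        (⨆ (P : MeasureTheory.Measure (Ambient D)) (f : Ambient D → ℝ)
            (_ : InModel x α β τ L fmin fmax R P f),
          risk p P (fun X : Fin n → Ambient D => onedimEstimator ℓ β p fmin x X) (f x)) ≤
        ENNReal.ofReal (C * (n : ℝ) ^ (-β / (2 * β + 1))) := by
  obtain ⟨l, rfl⟩ : ∃ l, ℓ = l + 1 := ⟨ℓ - 1, by omega⟩
  refine ⟨fun D n x => measurable_isomapKernelEstimator l _ _ x, ?_⟩
  intro α τ L fmax R _ hτ _ hff hR
  obtain ⟨B, hB0, hB, hBlip⟩ := exists_kernel_bounds l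
  obtain ⟨A, hA0, hA⟩ := exists_rpow_le_exp p hp
  have hfmax : 0 < fmax := hfmin.trans hff
  have h1 : ∀ᶠ n : ℕ in Filter.atTop, (n : ℝ) ^ (-1 / (2 * β + 1)) < τ / 2 :=
    (tendsto_bandwidth hβ).eventually_lt_const (by positivity)
  have h2 : ∀ᶠ n : ℕ in Filter.atTop, 32 * (p + 1) / fmin * (Real.log n / n) < τ / 8 :=
    (tendsto_log_div_natCast.const_mul (32 * (p + 1) / fmin)).eventually_lt_const
      (by rw [mul_zero]; positivity)
  obtain ⟨N, hN⟩ := Filter.eventually_atTop.1 (h1.and (h2.and (Filter.eventually_ge_atTop 3)))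
  -- The constant is found by unification with `InModel.risk_le`; neither it nor `N` involves `D`,
  -- `x`, `P` or `f`.
  refine ⟨_, N, ?_, fun D x _ n hn => iSup_le fun P => iSup_le fun f => iSup_le fun hP =>
    hP.risk_le hτ hfmin hβ hR.le l (by push_cast at hβℓ; exact hβℓ) hp hB0 hB hBlip hA0 hA
      (hN n hn).2.2 (by have := (hN n hn).1; linarith) (hN n hn).2.1.le⟩
  positivity
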